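/- Lemma 2.1 (Covering Construction). Let $M$ be a closed hyperbolic Riemann surface and let $\epsilon,R>0$. Definitions. For an oriented closed geodesic $\gamma$ of $M$ let $\bar\gamma$ be $\gamma$ with the opposite orientation and $\mathbf{hl}(\gamma)$ half the length of $\gamma$. Call $\gamma$ good if $|\mathbf{hl}(\gamma)-R|\le\epsilon$. The space $\sqrt\gamma$ of pairs of antipodal points of $\gamma$ is identified, by arc length along $\gamma$, with the circle $\mathbb R/\mathbf{hl}(\gamma)\mathbb Z$; so is the space $N^1_+(\sqrt\gamma)$ of pairs of unit normal vectors at antipodal points pointing to the right side of $\gamma$. An immersed pair of pants $\Pi$ in $M$ is an orientation-preserving immersion to $M$ of a topological pair of pants with cuffs $C_1,C_2,C_3$ mapping the cuffs to closed geodesics, up to homotopy and mapping classes of the pair of pants; cuffs are oriented so that the pants lie on their right. The seam $S_i$ is the shortest geodesic arc from $C_i$ to $C_{i+1}$ (indices mod 3) in the homotopy class of the simple arc joining them. The foot of $\Pi$ at the cuff $C_i$ is the point of $N^1_+(\sqrt{\Pi(C_i)})$ given by the unit normal vectors at which $S_i$ starts and $S_{i-1}$ ends; they sit at antipodal points. (If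 $\gamma=\Pi(C_i)$ is a proper power, all the points of the circle obtained from one another by rotating $\gamma$ over itself are counted as feet.) $\boldsymbol\Pi_{\epsilon,R}$ is the set of immersed pairs of pants with three good cuffs. Two measures $\mu,\nu$ on a metric space $X$ are $\delta$-equivalent if $\mu(X)=\nu(X)$ and $\mu(A)\le\nu(N_\delta(A))$ for all Borel $A\subset X$, where $N_\delta(A)$ is the open $\delta$-neighbourhood. Let $\mu$ be a multi-pants with positive integral coefficients, that is, a finite family $\Pi_1,\dots,\Pi_n$ (repetitions allowed) of elements of $\boldsymbol\Pi_{\epsilon,R}$. Suppose 1. (Evenly distributed) $\partial\mu=\sum_{m=1}^n\sum_{i=1}^3\Pi_m(C_i)=0$ in the group of formal integral sums of oriented closed curves, where $\bar\gamma$ is identified with $-\gamma$; 2. (Equidistributed) for every good $\gamma$ the measure $\hat\partial_\gamma\mu$ on $N^1_+(\sqrt\gamma)\cong\mathbb R/\mathbf{hl}(\gamma)\mathbb Z$ that counts, with multiplicity, the feet on $\gamma$ of the pants of $\mu$ is $\frac{\epsilon}{2R}$-equivalent to a constant multiple of the Lebesgue measure. Then $\Pi_1,\dots,\Pi_n$ can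 be glued along their cuffs to a finite (possibly disconnected) cover $M_{\epsilon,R}\to M$: there are such a cover and a pants decomposition of $M_{\epsilon,R}$ by closed geodesics, whose pieces, mapped to $M$ by the covering map, are exactly $\Pi_1,\dots,\Pi_n$. This pants decomposition is $(\epsilon,R)$-good: every curve $C$ of it satisfies $$|\mathbf{hl}(C)-R|\le\epsilon\quad\text{and}\quad|\mathbf s(C)-1|<\frac{\epsilon}{R}.$$ Here $\mathbf s(C)\in\mathbb R/\mathbf{hl}(C)\mathbb Z$ is the length along $C$ from the foot of the pants on the right of $C$ to the foot of the pants on the left of $C$ (it does not depend on the orientation of $C$), and $|\cdot|$ is the distance to $0$ in $\mathbb R/\mathbf{hl}(C)\mathbb Z$; when $\epsilon\le R$ and $1+\epsilon/R\le\mathbf{hl}(C)$ this is the same as the inequality for the representative $\mathbf s(C)\in[0,\mathbf{hl}(C))$. -/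

import Mathlib

open Real MeasureTheory Set
open scoped UpperHalfPlane MatrixGroups NNReal ENNReal

namespace GoodPants

noncomputable section

/-! ## The hyperbolic plane, geodesics, closed hyperbolic surfaces -/

/-- The group `PSL(2, ℝ)` of orientation preserving isometries of the hyperbolic plane `ℍ`,
realised as the group of all Möbius transformations of `ℍ`. -/
abbrev Mob : Type := ↥(MulAction.toPermHom SL(2, ℝ) ℍ).range

/-- The unit speed geodesic `t ↦ i e^t`, going up the imaginary axis. -/
def stdGeodesic (t : ℝ) : ℍ := ⟨⟨0, Real.exp t⟩, Real.exp_pos t⟩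

/-- The oriented unit speed geodesic `t ↦ A (i e^t)`. Every oriented unit speed geodesic of `ℍ`
is of this form for exactly one `A`; in this way `Mob` is the unit tangent bundle of `ℍ`. -/
def geodesic (A : Mob) (t : ℝ) : ℍ := A • stdGeodesic t

/-- The open half-plane on the right of the oriented geodesic `geodesic A`
(the half-plane `0 < Re z` is on the right of the upwards oriented imaginary axis). -/
def rightSide (A : Mob) : Set ℍ := {z | 0 < (A⁻¹ • z).re}

/-- The closed half-plane on the right of the oriented geodesic `geodesic A`. -/
def closedRightSide (A : Mob) : Set ℍ := {z | 0 ≤ (A⁻¹ • z).re}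

/-- The surface `Γ \ ℍ`. -/
abbrev Surface (Γ : Subgroup Mob) : Type := MulAction.orbitRel.Quotient Γ ℍ

/-- `Γ` acts freely and properly discontinuously on `ℍ` with compact quotient. By uniformization
the closed (connected) hyperbolic Riemann surfaces are exactly the quotients `Γ \ ℍ` by
such groups `Γ`. -/
structure IsClosedSurfaceGroup (Γ : Subgroup Mob) : Prop where
  free : ∀ (g : Γ) (z : ℍ), g • z = z → g = 1
  discontinuous : ProperlyDiscontinuousSMul Γ ℍ
  compact : CompactSpace (Surface Γ)

/-! ## Closed geodesics -/

/-- An oriented closed geodesic of `Γ \ ℍ`, given through a lift to `ℍ`: an oriented geodesic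
`geodesic axis` of `ℍ` together with an element of `Γ` that translates it forwards by the
distance `len > 0`, the length of the closed geodesic. Two such data describe the same oriented
closed geodesic (up to the parametrization) iff the elements are conjugate in `Γ`. -/
structure ClosedGeodesic (Γ : Subgroup Mob) where
  elt : Γ
  axis : Mob
  len : ℝ
  len_pos : 0 < len
  translate : ∀ t : ℝ, elt • geodesic axis t = geodesic axis (t + len)

namespace ClosedGeodesic

variable {Γ : Subgroup Mob}

/-- The half length. -/
def hl (γ : ClosedGeodesic Γ) : ℝ := γ.len / 2

instance instFactHlPos (γ : ClosedGeodesic Γ) : Fact (0 < γ.hl) := ⟨half_pos γ.len_pos⟩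

/-- A closed geodesic is good if its half length is `ε`-close to `R`. -/
def IsGood (ε R : ℝ) (γ : ClosedGeodesic Γ) : Prop := |γ.hl - R| ≤ ε

/-- The image in `Γ \ ℍ` of a closed geodesic of the covering surface `Λ \ ℍ`, for `Λ ≤ Γ`. -/
def push {Λ : Subgroup Mob} (h : Λ ≤ Γ) (γ : ClosedGeodesic Λ) : ClosedGeodesic Γ where
  elt := Subgroup.inclusion h γ.elt
  axis := γ.axis
  len := γ.len
  len_pos := γ.len_pos
  translate := γ.translate

end ClosedGeodesic

/-- The relations `γ + γ̄ = 0` between oriented closed curves, where `γ̄` is `γ` with the opposite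
orientation. Oriented closed curves up to free homotopy are conjugacy classes of `Γ`. -/
def reversalRelations (Γ : Subgroup Mob) : AddSubgroup (ConjClasses Γ →₀ ℤ) :=
  AddSubgroup.closure
    {f | ∃ g : Γ, f = Finsupp.single (ConjClasses.mk g) 1 + Finsupp.single (ConjClasses.mk g⁻¹) 1}

/-- Formal integral sums of oriented closed curves, where `γ̄` is identified with `-γ`. -/
abbrev MultiCurve (Γ : Subgroup Mob) : Type := (ConjClasses Γ →₀ ℤ) ⧸ reversalRelations Γ

/-- The class of an oriented closed geodesic in the group of multicurves. -/
def ClosedGeodesic.toMultiCurve {Γ : Subgroup Mob} (γ : ClosedGeodesic Γ) : MultiCurve Γ :=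
  QuotientAddGroup.mk (Finsupp.single (ConjClasses.mk γ.elt) 1)

/-! ## Immersed pairs of pants -/

/-- An immersed pair of pants in `Γ \ ℍ`, with geodesic cuffs and compatible with orientations,
given through a lift of its marking to `ℍ`.

The fundamental group of the topological pair of pants is
`⟨C₀, C₁, C₂ | C₀ C₁ C₂ = 1⟩`, the `Cₖ` being its cuffs, all oriented so that the pants lie on
their right. A map of the pair of pants to `Γ \ ℍ` up to homotopy is a homomorphism of this group
to `Γ` up to conjugation, here `Cₖ ↦ (cuff k).elt`. It is homotopic to an orientation preserving
immersion with geodesic boundary iff the axes of the three elements are pairwise disjoint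
and each has the other two on its right. These axes together with their three common
perpendiculars then bound the lift of one of the two right-angled hexagons of the pants. -/
structure Pants (Γ : Subgroup Mob) where
  cuff : Fin 3 → ClosedGeodesic Γ
  prod_eq_one : (cuff 0).elt * (cuff 1).elt * (cuff 2).elt = 1
  right : ∀ i j, i ≠ j → ∀ t, geodesic (cuff j).axis t ∈ rightSide (cuff i).axis

namespace Pants

variable {Γ : Subgroup Mob}

/-- All cuffs have half length `ε`-close to `R`. -/
def IsGood (ε R : ℝ) (P : Pants Γ) : Prop := ∀ k, (P.cuff k).IsGood ε R

/-- The image of the fundamental group of the pair of pants in `Γ`. -/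
def group (P : Pants Γ) : Subgroup Γ := Subgroup.closure (Set.range fun k => (P.cuff k).elt)

/-- The lift to `ℍ` of the (closed) pair of pants: the convex region bounded by all the lifts
`h • axis` of the cuffs, `h ∈ P.group`. The hyperbolic pair of pants itself
is the quotient of this region by `P.group`, and the immersion is induced by the inclusion of the
region in `ℍ`. -/
def region (P : Pants Γ) : Set ℍ :=
  {z | ∀ h ∈ P.group, ∀ k, z ∈ closedRightSide ((h : Mob) * (P.cuff k).axis)}

/-- The image in `Γ \ ℍ` of a pair of pants of the covering surface `Λ \ ℍ`, for `Λ ≤ Γ`. -/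
def push {Λ : Subgroup Mob} (h : Λ ≤ Γ) (P : Pants Λ) : Pants Γ where
  cuff k := (P.cuff k).push h
  prod_eq_one := congrArg (Subgroup.inclusion h) P.prod_eq_one
  right := P.right

/-- Two markings describe the same immersed pair of pants in `Γ \ ℍ`, that is, they agree up to
homotopy and the action of the mapping class group of the pair of pants. Forgetting the marking
up to mapping classes leaves the image of the fundamental group, up to conjugation in `Γ`. -/
def Same (P Q : Pants Γ) : Prop :=
  ∃ h : Γ, Q.group = P.group.map (MulAut.conj h).toMonoidHom

/-- `x` is the initial point, on (the lift of) the cuff `k`, of the seam joining the cuff `k` to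
the cuff `k + 1`, that is, of the geodesic arc of minimal length from the one to the other.
(The terminal point of the seam from the cuff `k - 1` to the cuff `k` is
the antipodal point of the closed geodesic.) -/
def IsFootPoint (P : Pants Γ) (k : Fin 3) (x : ℍ) : Prop :=
  ∃ a b : ℝ, x = geodesic (P.cuff k).axis a ∧
    ∀ a' b' : ℝ, dist (geodesic (P.cuff k).axis a) (geodesic (P.cuff (k + 1)).axis b) ≤
      dist (geodesic (P.cuff k).axis a') (geodesic (P.cuff (k + 1)).axis b')

/-- The foot of `P` on the oriented closed geodesic `γ` at the cuff `k`, if this cuff is `γ` (the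
set is empty otherwise). The space `√γ` of pairs of antipodal points of `γ` is the circle
`ℝ / hl(γ) ℤ`, the parameter being the arc length along `γ`; the unit normal vectors at the foot
points towards the pants are those on the right side of `γ`, so that the same circle is
`N¹₊(√γ)`. If `γ` is not a proper power of another closed geodesic, then the foot is exactly one
point; if it is, then the feet are all the points that give this normal vector, and they form
one orbit of the rotations of `γ` over itself. -/
def foot (P : Pants Γ) (k : Fin 3) (γ : ClosedGeodesic Γ) : Set (AddCircle γ.hl) :=
  {s | ∃ h : Γ, h * (P.cuff k).elt * h⁻¹ = γ.elt ∧
    ∃ (x : ℍ) (b : ℝ), P.IsFootPoint k x ∧ h • x = geodesic γ.axis b ∧ s = (b : AddCircle γ.hl)}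

/-- The twist parameters in `ℝ / hl ℤ` of `P` at its cuff `k` and `Q` at its cuff `l`, where the
second cuff is the first one with the opposite orientation, so that the pants
lie on the two sides of one closed geodesic: the signed length from the foot of `P` to the
foot of `Q`, measured along the cuff `k` of `P`. (There is none if the cuffs do not match.) -/
def twist (P : Pants Γ) (k : Fin 3) (Q : Pants Γ) (l : Fin 3) : Set (AddCircle (P.cuff k).hl) :=
  {s | ∃ h : Γ, h * (Q.cuff l).elt * h⁻¹ = (P.cuff k).elt⁻¹ ∧
    ∃ (x y : ℍ) (a b : ℝ), P.IsFootPoint k x ∧ Q.IsFootPoint l y ∧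
      x = geodesic (P.cuff k).axis a ∧ h • y = geodesic (P.cuff k).axis b ∧
      s = ((b - a : ℝ) : AddCircle (P.cuff k).hl)}

/-- The boundary of a pair of pants. -/
def boundary (P : Pants Γ) : MultiCurve Γ := ∑ k, (P.cuff k).toMultiCurve

end Pants

/-! ## Multi-pants and their boundaries

A multi-pants with positive integral coefficients is a finite family of immersed pairs of pants,
in which repetitions are allowed. -/

/-- The boundary `∂μ` of a multi-pants. -/
def multiBoundary {Γ : Subgroup Mob} {ι : Type*} [Fintype ι] (μ : ι → Pants Γ) : MultiCurve Γ :=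
  ∑ i, (μ i).boundary

/-- The measure on `N¹₊(√γ)` that counts the feet on `γ` of the pants of `μ`,
with multiplicity. -/
def footMeasure {Γ : Subgroup Mob} {ι : Type*} [Fintype ι] (μ : ι → Pants Γ)
    (γ : ClosedGeodesic Γ) : Measure (AddCircle γ.hl) :=
  ∑ i, ∑ k, Measure.count.restrict ((μ i).foot k γ)

/-- `δ`-equivalence of two measures on a metric space. -/
def MeasureEquivalent {X : Type*} [PseudoMetricSpace X] [MeasurableSpace X] (δ : ℝ)
    (μ ν : Measure X) : Prop :=
  μ univ = ν univ ∧ ∀ A : Set X, MeasurableSet A → μ A ≤ ν (Metric.thickening δ A)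

/-- The feet of `μ` on `γ` are `δ`-equidistributed: the measure that counts them is `δ`-equivalent
to a Euclidean measure, that is, to a constant multiple of the Lebesgue measure. -/
def EquidistributedOn {Γ : Subgroup Mob} {ι : Type*} [Fintype ι] (δ : ℝ) (μ : ι → Pants Γ)
    (γ : ClosedGeodesic Γ) : Prop :=
  ∃ K : ℝ≥0, MeasureEquivalent δ (footMeasure μ γ) (K • (volume : Measure (AddCircle γ.hl)))

/-! ## Pants decompositions -/

/-- The pairs of pants `P i` of the surface `Λ \ ℍ` are the pieces of a pants decomposition: they
cover the surface, they are embedded in their interiors, and their interiors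
are pairwise disjoint. (The curves of the decomposition are the cuffs of the pieces.) -/
structure IsPantsDecomposition (Λ : Subgroup Mob) {I : Type*} (P : I → Pants Λ) : Prop where
  covers : ∀ z : ℍ, ∃ (i : I) (h : Λ), h • z ∈ (P i).region
  disjoint : ∀ (i j : I) (h : Λ) (z : ℍ), z ∈ interior (P i).region →
    h • z ∈ interior (P j).region → i = j ∧ h ∈ (P i).group

/-- An `(ε, R)`-good pants decomposition: all the curves `C` of the decomposition have half length
`ε`-close to `R`, and the twist parameter `s(C) ∈ ℝ / hl(C) ℤ` of the two pairs of pants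
that meet at `C` (from either side) is at distance less than `ε / R` from `1`. -/
structure IsGoodPantsDecomposition (ε R : ℝ) (Λ : Subgroup Mob) {I : Type*} (P : I → Pants Λ) :
    Prop extends IsPantsDecomposition Λ P where
  good : ∀ i, (P i).IsGood ε R
  twist_close : ∀ (i j : I) (k l : Fin 3), ∀ s ∈ (P i).twist k (P j) l,
    ‖s - ((1 : ℝ) : AddCircle ((P i).cuff k).hl)‖ < ε / R

/-- A finite cover of the surface `Γ \ ℍ`, possibly disconnected: the disjoint union of finitely
many surfaces `Λ j \ ℍ`, each with the natural covering map to `Γ \ ℍ`, where `Λ j` is a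
subgroup of finite index in `Γ`. -/
structure FiniteCover (Γ : Subgroup Mob) where
  numComponents : ℕ
  group : Fin numComponents → Subgroup Mob
  le : ∀ j, group j ≤ Γ
  finiteIndex : ∀ j, (group j).IsFiniteRelIndex Γ

end

end GoodPants

namespace GoodPants

noncomputable section

/-! ## The hyperboloid model -/

/-! Fix a closed geodesic γ. The pants with a cuff γ lie on one side of it, those with a cuff γ̄ on
the other, and ∂μ = 0 makes them equally many (`card_class_eq`). A gluing with shear close to 1 is a
bijection between the two families under which the foot at s goes to a foot within ε/R of s + 1.
Hall's marriage theorem provides it (`exists_injective_matching`): both foot measures are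
ε/(2R)-equivalent to the same multiple of Lebesgue measure. For a set S of feet, the
ε/(2R)-neighbourhoods of S and of the shifted feet that are admissible for no element of S are
disjoint. Their measures therefore add up to at most the whole circle, and this is Hall's condition
for S. No closed geodesic is conjugate to its inverse (`not_conj_inv`), so the bijections assemble
to an involution on all cuffs (`exists_gluing`).

The cover is built inside ℍ. The tiles are the translates of the lifted pants, indexed by cosets of
their groups, and each side of a tile is joined to the tile that the gluing prescribes behind it.
Each component of this graph of tiles tiles ℍ. Its union is open and closed, because the sides of a
tile have a uniform separation δ (`exists_reach_mem`). Tiles do not overlap, because the half-planes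
beyond the successive sides of a path without backtracking are nested (`eq_of_mem_interior`). Only
finitely many tiles contain a given point, so the stabilizer of a component has finite index
(`finiteIndex_compGroup`); its quotient surface is a component of the cover.

The geometric input is that distinct sides of a lifted pair of pants bound outer half-planes at a
uniform positive distance (`exists_cuff_separation`), and that the lift is bounded modulo its group
(`exists_region_bound`). In the hyperboloid model, cuffs and seams are unit vectors, and each cuff
element is the product of the reflections in two seams (`elt_smul`). The pants group thus consists
of the even words in three reflections. Ping-pong and folding reduce both facts to one right-angled
hexagon. -/

/-- Three-dimensional Minkowski space. -/
abbrev LVec : Type := ℝ × ℝ × ℝ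

/-- The Lorentzian form, of signature `(2, 1)`. -/
def lq (u v : LVec) : ℝ := u.2.1 * v.2.1 - 2 * (u.1 * v.2.2 + u.2.2 * v.1)

/-- The determinant of three vectors. -/
def ldet (u v w : LVec) : ℝ :=
  u.1 * (v.2.1 * w.2.2 - v.2.2 * w.2.1) - u.2.1 * (v.1 * w.2.2 - v.2.2 * w.1) +
    u.2.2 * (v.1 * w.2.1 - v.2.1 * w.1)

/-- The point of the hyperboloid that corresponds to a point of the upper half-plane. -/
def vec (z : ℍ) : LVec := (-1 / (2 * z.im), z.re / z.im, -(z.re ^ 2 + z.im ^ 2) / (2 * z.im))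

lemma lq_comm (u v : LVec) : lq u v = lq v u := by unfold lq; ring

lemma lq_add_left (u v w : LVec) : lq (u + v) w = lq u w + lq v w := by
  simp only [lq, Prod.fst_add, Prod.snd_add]; ring

lemma lq_sub_left (u v w : LVec) : lq (u - v) w = lq u w - lq v w := by
  simp only [lq, Prod.fst_sub, Prod.snd_sub]; ring

lemma lq_smul_left (c : ℝ) (u w : LVec) : lq (c • u) w = c * lq u w := by
  simp only [lq, Prod.smul_fst, Prod.smul_snd, smul_eq_mul]; ring

lemma lq_neg_left (u w : LVec) : lq (-u) w = -lq u w := by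
  simp only [lq, Prod.fst_neg, Prod.snd_neg]; ring

lemma lq_add_right (u v w : LVec) : lq w (u + v) = lq w u + lq w v := by
  simp only [lq, Prod.fst_add, Prod.snd_add]; ring

lemma lq_sub_right (u v w : LVec) : lq w (u - v) = lq w u - lq w v := by
  simp only [lq, Prod.fst_sub, Prod.snd_sub]; ring

lemma lq_smul_right (c : ℝ) (u w : LVec) : lq w (c • u) = c * lq w u := by
  simp only [lq, Prod.smul_fst, Prod.smul_snd, smul_eq_mul]; ring

lemma lq_neg_right (u w : LVec) : lq w (-u) = -lq w u := by
  simp only [lq, Prod.fst_neg, Prod.snd_neg]; ring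

/-- A vector (l, m, k) stands for the quadratic form l|z|² + m Re z + k, and `lq` is its polarized
discriminant. A unit vector is then a geodesic, the zero set of its form, with a chosen side. -/
lemma lq_vec (v : LVec) (z : ℍ) :
    lq v (vec z) = (v.1 * (z.re ^ 2 + z.im ^ 2) + v.2.1 * z.re + v.2.2) / z.im := by
  have := z.im_ne_zero
  simp only [lq, vec]; field_simp; ring

lemma lq_vec_self (z : ℍ) : lq (vec z) (vec z) = -1 := by
  have := z.im_ne_zero
  rw [lq_vec]; simp only [vec]; field_simp; ring

lemma cosh_dist_eq (z w : ℍ) : Real.cosh (dist z w) = -lq (vec z) (vec w) := by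
  have := z.im_ne_zero
  have := w.im_ne_zero
  rw [UpperHalfPlane.cosh_dist, lq_vec, Complex.dist_eq, Complex.sq_norm, Complex.normSq_apply]
  simp only [vec, Complex.sub_re, Complex.sub_im, UpperHalfPlane.coe_re, UpperHalfPlane.coe_im]
  field_simp; ring

lemma one_le_neg_lq (z w : ℍ) : 1 ≤ -lq (vec z) (vec w) := by
  rw [← cosh_dist_eq]; exact Real.one_le_cosh _

lemma vec_injective : Function.Injective vec := by
  intro z w h
  have h1 : Real.cosh (dist z w) = 1 := by rw [cosh_dist_eq, h, lq_vec_self]; norm_num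
  by_contra hne
  exact (Real.one_lt_cosh.2 (dist_ne_zero.2 hne)).ne' h1

lemma dist_eq_of_lq {z w z' w' : ℍ} (h : lq (vec z) (vec w) = lq (vec z') (vec w')) :
    dist z w = dist z' w' := by
  have h1 : Real.cosh (dist z w) = Real.cosh (dist z' w') := by
    rw [cosh_dist_eq, cosh_dist_eq, h]
  have := Real.cosh_strictMonoOn.injOn (mem_Ici.2 dist_nonneg) (mem_Ici.2 dist_nonneg) h1
  exact this

lemma dist_le_of_lq {z w z' w' : ℍ} (h : lq (vec z') (vec w') ≤ lq (vec z) (vec w)) :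
    dist z w ≤ dist z' w' := by
  have h1 : Real.cosh (dist z w) ≤ Real.cosh (dist z' w') := by
    rw [cosh_dist_eq, cosh_dist_eq]; linarith
  simpa using Real.cosh_le_cosh.1 h1

/-- The factor -4 is the determinant of the form itself. Its sign makes every Gram determinant
nonpositive, which is the source of the distance estimates. -/
lemma gram_det (u v w : LVec) :
    lq u u * (lq v v * lq w w - lq v w ^ 2) - lq u v * (lq u v * lq w w - lq v w * lq u w)
      + lq u w * (lq u v * lq v w - lq v v * lq u w) = -4 * ldet u v w ^ 2 := by
  unfold lq ldet; ring

/-- The component of `t` orthogonal to the timelike vector `vec z` is spacelike; the difference of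
the two sides is its square. -/
lemma sq_lq_vec_ge (t : LVec) (z : ℍ) : -lq t t ≤ lq t (vec z) ^ 2 := by
  have h0 := z.im_pos
  have := z.im_ne_zero
  have h : lq t (vec z) ^ 2 + lq t t = ((t.1 * z.re ^ 2 + t.2.1 * z.re + t.2.2 - t.1 * z.im ^ 2) ^ 2
      + (2 * t.1 * z.re + t.2.1) ^ 2 * z.im ^ 2) / z.im ^ 2 := by
    rw [lq_vec]; simp only [lq]; field_simp; ring
  have h2 : 0 ≤ lq t (vec z) ^ 2 + lq t t := by rw [h]; positivity
  linarith

/-- The vectors of i, 2i and 1 + i form a basis. -/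
lemma linearMap_ext_vec {L₁ L₂ : LVec →ₗ[ℝ] LVec} (h : ∀ z, L₁ (vec z) = L₂ (vec z)) :
    L₁ = L₂ := by
  have h1 := h ⟨⟨0, 1⟩, one_pos⟩
  have h2 := h ⟨⟨0, 2⟩, two_pos⟩
  have h3 := h ⟨⟨1, 1⟩, one_pos⟩
  refine LinearMap.ext fun v => ?_
  have hv : v = (2 * v.2.2 / 3 + v.2.1 - 8 * v.1 / 3 - v.2.1) • vec ⟨⟨0, 1⟩, one_pos⟩
      + (4 * v.1 / 3 - 4 * v.2.2 / 3 - 2 / 3 * v.2.1) • vec ⟨⟨0, 2⟩, two_pos⟩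
      + v.2.1 • vec ⟨⟨1, 1⟩, one_pos⟩ - (2 / 3 * v.2.1) • vec ⟨⟨0, 1⟩, one_pos⟩ := by
    simp only [vec, UpperHalfPlane.re, UpperHalfPlane.im]
    ext <;> simp <;> ring
  rw [hv]
  simp only [map_add, map_sub, map_smul, h1, h2, h3]

/-- The distance of two disjoint half-planes whose boundary lines are ultraparallel. -/
lemma cosh_dist_ge_of_disjoint {n m : LVec} (hn : lq n n = 1) (hm : lq m m = 1)
    (hnm : lq n m < -1) (hpos : ∀ z, 0 < lq (n - lq n m • m) (vec z)) {z w : ℍ}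
    (hz : lq n (vec z) ≤ 0) (hw : lq m (vec w) ≤ 0) : -lq n m ≤ Real.cosh (dist z w) := by
  set κ := -lq n m with hκ
  set s := lq n (vec w) with hs
  have ht : lq (n - lq n m • m) (n - lq n m • m) = 1 - κ ^ 2 := by
    simp only [lq_sub_left, lq_sub_right, lq_smul_left, lq_smul_right, hn, hm, lq_comm m n]
    rw [hκ]; ring
  have h1 := sq_lq_vec_ge (n - lq n m • m) w
  -- A product below -1 says that either the half-planes `n ≤ 0`, `m ≤ 0` or their opposites are
  -- disjoint. The positivity of this timelike vector selects the first case.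
  have h2 := hpos w
  rw [ht] at h1
  have h3 : lq (n - lq n m • m) (vec w) = s + κ * lq m (vec w) := by
    simp only [lq_sub_left, lq_smul_left]; rw [hκ]; ring
  rw [h3] at h1 h2
  have h4 : κ * lq m (vec w) ≤ 0 := mul_nonpos_of_nonneg_of_nonpos (by linarith) hw
  have h5 : κ ^ 2 - 1 ≤ s ^ 2 := by nlinarith
  have hs0 : 0 ≤ s := by linarith
  have hC : 1 ≤ -lq (vec z) (vec w) := one_le_neg_lq z w
  have hg := gram_det n (vec z) (vec w)
  rw [hn, lq_vec_self, lq_vec_self, ← hs] at hg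
  rw [cosh_dist_eq]
  set C := -lq (vec z) (vec w) with hCd
  have hC' : lq (vec z) (vec w) = -C := by rw [hCd]; ring
  rw [hC'] at hg
  set f := lq n (vec z)
  -- The Gram determinant of `n`, `vec z`, `vec w` is nonpositive. As `z` and `w` lie on different
  -- sides of `n`, the mixed term can be dropped, leaving C² ≥ 1 + s² ≥ κ².
  have h6 : C ^ 2 + 2 * C * (f * s) ≥ 1 + f ^ 2 + s ^ 2 := by
    nlinarith [sq_nonneg (ldet n (vec z) (vec w))]
  have h7 : C * (f * s) ≤ 0 :=
    mul_nonpos_of_nonneg_of_nonpos (by linarith) (mul_nonpos_of_nonpos_of_nonneg hz hs0)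
  have h8 : κ ^ 2 ≤ C ^ 2 := by nlinarith [sq_nonneg f]
  exact abs_le_of_sq_le_sq' h8 (by linarith) |>.2

/-! ### Reflections -/

/-- The reflection in the orthogonal complement of a unit vector. -/
def reflLin (n : LVec) : LVec →ₗ[ℝ] LVec where
  toFun v := v - (2 * lq n v) • n
  map_add' u v := by rw [lq_add_right]; module
  map_smul' c v := by rw [lq_smul_right, RingHom.id_apply]; module

lemma reflLin_apply (n v : LVec) : reflLin n v = v - (2 * lq n v) • n := rfl

lemma reflLin_reflLin {n : LVec} (hn : lq n n = 1) (v : LVec) : reflLin n (reflLin n v) = v := by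
  simp only [reflLin_apply, lq_sub_right, lq_smul_right, hn]; module

lemma lq_reflLin {n : LVec} (hn : lq n n = 1) (u v : LVec) :
    lq (reflLin n u) (reflLin n v) = lq u v := by
  simp only [reflLin_apply, lq_sub_right, lq_smul_right, lq_sub_left, lq_smul_left, hn,
    lq_comm u n]; ring

lemma reflLin_neg (n : LVec) : reflLin (-n) = reflLin n := by
  ext1 <;> ext <;> simp [reflLin_apply, lq_neg_left]

/-- Up to the factor -1/(2 Im z) this is the first coordinate of the reflected vector. Its
positivity puts the mirror image in the upper half-plane. -/
lemma refl_aux {n : LVec} (hn : lq n n = 1) (z : ℍ) :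
    0 < 1 + 4 * n.1 * (n.1 * (z.re ^ 2 + z.im ^ 2) + n.2.1 * z.re + n.2.2) := by
  have h : 1 + 4 * n.1 * (n.1 * (z.re ^ 2 + z.im ^ 2) + n.2.1 * z.re + n.2.2)
      = (2 * n.1 * z.re + n.2.1) ^ 2 + (2 * n.1 * z.im) ^ 2 := by
    rw [← hn]; unfold lq; ring
  rw [h]
  rcases eq_or_ne n.1 0 with h0 | h0
  · have : n.2.1 * n.2.1 = 1 := by rw [← hn]; unfold lq; rw [h0]; ring
    rw [h0]; nlinarith
  · have := z.im_pos
    positivity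

/-- The reflection of a point in the line given by a unit vector. -/
def reflFun (n : LVec) (hn : lq n n = 1) (z : ℍ) : ℍ :=
  ⟨⟨(z.re - 2 * n.2.1 * (n.1 * (z.re ^ 2 + z.im ^ 2) + n.2.1 * z.re + n.2.2)) /
      (1 + 4 * n.1 * (n.1 * (z.re ^ 2 + z.im ^ 2) + n.2.1 * z.re + n.2.2)),
    z.im / (1 + 4 * n.1 * (n.1 * (z.re ^ 2 + z.im ^ 2) + n.2.1 * z.re + n.2.2))⟩,
    div_pos z.im_pos (refl_aux hn z)⟩

lemma vec_reflFun {n : LVec} (hn : lq n n = 1) (z : ℍ) :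
    vec (reflFun n hn z) = reflLin n (vec z) := by
  have h0 := z.im_ne_zero
  have h1 := (refl_aux hn z).ne'
  have e1 : (reflFun n hn z).re = (z.re - 2 * n.2.1 *
      (n.1 * (z.re ^ 2 + z.im ^ 2) + n.2.1 * z.re + n.2.2)) /
      (1 + 4 * n.1 * (n.1 * (z.re ^ 2 + z.im ^ 2) + n.2.1 * z.re + n.2.2)) := rfl
  have e2 : (reflFun n hn z).im = z.im /
      (1 + 4 * n.1 * (n.1 * (z.re ^ 2 + z.im ^ 2) + n.2.1 * z.re + n.2.2)) := rfl
  have hm : n.2.1 ^ 2 = 1 + 4 * n.1 * n.2.2 := by rw [← hn]; unfold lq; ring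
  rw [reflLin_apply, lq_vec]
  simp only [vec, e1, e2]
  generalize z.re = x at *
  generalize z.im = y at *
  obtain ⟨l, m, k⟩ := n
  simp only at *
  obtain ⟨S, hS⟩ : ∃ S, S = l * (x ^ 2 + y ^ 2) + m * x + k := ⟨_, rfl⟩
  have h2 : (x - 2 * m * S) ^ 2 + y ^ 2 = (1 + 4 * l * S) * (x ^ 2 + y ^ 2 + 4 * k * S) := by
    linear_combination 4 * S ^ 2 * hm + 4 * S * hS
  obtain ⟨E, hE⟩ : ∃ E, E = 1 + 4 * l * S := ⟨_, rfl⟩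
  rw [← hS, ← hE] at h1 ⊢
  rw [← hE] at h2
  refine Prod.ext ?_ (Prod.ext ?_ ?_)
  · simp only [Prod.fst_sub, Prod.smul_fst, smul_eq_mul]
    field_simp
    rw [hE]; ring
  · simp only [Prod.fst_sub, Prod.snd_sub, Prod.smul_fst, Prod.smul_snd, smul_eq_mul]
    field_simp
  · simp only [Prod.snd_sub, Prod.smul_snd, smul_eq_mul]
    have h3 : ((x - 2 * m * S) / E) ^ 2 + (y / E) ^ 2 = (x ^ 2 + y ^ 2 + 4 * k * S) / E := by
      rw [div_pow, div_pow, ← add_div, h2]; field_simp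
    rw [h3]
    field_simp
    ring

/-- The reflection in the line given by a unit vector, as a permutation. -/
def refl (n : LVec) (hn : lq n n = 1) : Equiv.Perm ℍ :=
  have h : Function.Involutive (reflFun n hn) := fun z => vec_injective (by
    rw [vec_reflFun, vec_reflFun, reflLin_reflLin hn])
  h.toPerm

lemma vec_refl {n : LVec} (hn : lq n n = 1) (z : ℍ) :
    vec (refl n hn z) = reflLin n (vec z) := vec_reflFun hn z

lemma refl_refl {n : LVec} (hn : lq n n = 1) (z : ℍ) : refl n hn (refl n hn z) = z :=
  vec_injective (by rw [vec_refl, vec_refl, reflLin_reflLin hn])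

lemma lq_vec_refl {n : LVec} (hn : lq n n = 1) (v : LVec) (z : ℍ) :
    lq v (vec (refl n hn z)) = lq v (vec z) - 2 * lq n (vec z) * lq v n := by
  rw [vec_refl, reflLin_apply, lq_sub_right, lq_smul_right]

lemma dist_refl {n : LVec} (hn : lq n n = 1) (z w : ℍ) :
    dist (refl n hn z) (refl n hn w) = dist z w :=
  dist_eq_of_lq (by rw [vec_refl, vec_refl, lq_reflLin hn])

/-- Folding: reflecting `w` to the side of `z` changes the product by a term of known sign. This
later removes the letters of a word one by one. -/
lemma dist_refl_le {n : LVec} (hn : lq n n = 1) {z w : ℍ} (hz : 0 ≤ lq n (vec z))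
    (hw : lq n (vec w) ≤ 0) : dist z (refl n hn w) ≤ dist z w := by
  refine dist_le_of_lq ?_
  rw [lq_vec_refl, lq_comm (vec z) n]
  nlinarith [mul_nonpos_of_nonneg_of_nonpos hz hw]

/-! ### The linear action of the isometry group -/

/-- The action of `SL(2, ℝ)` on Minkowski space. -/
def slLin (M : SL(2, ℝ)) : LVec →ₗ[ℝ] LVec where
  toFun v := (M 1 1 ^ 2 * v.1 - M 1 0 * M 1 1 * v.2.1 + M 1 0 ^ 2 * v.2.2,
    -2 * M 0 1 * M 1 1 * v.1 + (M 0 0 * M 1 1 + M 0 1 * M 1 0) * v.2.1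
      - 2 * M 0 0 * M 1 0 * v.2.2,
    M 0 1 ^ 2 * v.1 - M 0 0 * M 0 1 * v.2.1 + M 0 0 ^ 2 * v.2.2)
  map_add' u v := by ext <;> simp <;> ring
  map_smul' c v := by ext <;> simp <;> ring

lemma slLin_apply (M : SL(2, ℝ)) (v : LVec) :
    slLin M v = (M 1 1 ^ 2 * v.1 - M 1 0 * M 1 1 * v.2.1 + M 1 0 ^ 2 * v.2.2,
    -2 * M 0 1 * M 1 1 * v.1 + (M 0 0 * M 1 1 + M 0 1 * M 1 0) * v.2.1
      - 2 * M 0 0 * M 1 0 * v.2.2,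
    M 0 1 ^ 2 * v.1 - M 0 0 * M 0 1 * v.2.1 + M 0 0 ^ 2 * v.2.2) := rfl

lemma lq_slLin (M : SL(2, ℝ)) (u v : LVec) : lq (slLin M u) (slLin M v) = lq u v := by
  have h : M 0 0 * M 1 1 - M 0 1 * M 1 0 = 1 := by
    have := M.det_coe; rwa [Matrix.det_fin_two] at this
  have h2 : lq (slLin M u) (slLin M v) = (M 0 0 * M 1 1 - M 0 1 * M 1 0) ^ 2 * lq u v := by
    simp only [lq, slLin_apply]; ring
  rw [h2, h]; ring

lemma sl_smul_re_im (M : SL(2, ℝ)) (z : ℍ) :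
    (M • z).im = z.im / ((M 1 0 * z.re + M 1 1) ^ 2 + (M 1 0 * z.im) ^ 2) ∧
    (M • z).re = ((M 0 0 * z.re + M 0 1) * (M 1 0 * z.re + M 1 1) + M 0 0 * M 1 0 * z.im ^ 2) /
      ((M 1 0 * z.re + M 1 1) ^ 2 + (M 1 0 * z.im) ^ 2) := by
  have h : M 0 0 * M 1 1 - M 0 1 * M 1 0 = 1 := by
    have := M.det_coe; rwa [Matrix.det_fin_two] at this
  have e := UpperHalfPlane.specialLinearGroup_apply M z
  have e1 : (M • z).re = ((M • z : ℍ) : ℂ).re := rfl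
  have e2 : (M • z).im = ((M • z : ℍ) : ℂ).im := rfl
  rw [e1, e2, e]
  simp only [Complex.div_re, Complex.div_im, Complex.normSq_apply]
  simp
  constructor
  · rw [← sub_div]
    congr 1
    · linear_combination z.im * h
    · ring
  · rw [← add_div]
    congr 1 <;> ring

lemma vec_sl_smul (M : SL(2, ℝ)) (z : ℍ) : vec (M • z) = slLin M (vec z) := by
  have h : M 0 0 * M 1 1 - M 0 1 * M 1 0 = 1 := by
    have := M.det_coe; rwa [Matrix.det_fin_two] at this
  obtain ⟨e1, e2⟩ := sl_smul_re_im M z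
  have hy := z.im_pos
  have hD : 0 < (M 1 0 * z.re + M 1 1) ^ 2 + (M 1 0 * z.im) ^ 2 := by
    have h1 := (M • z).im_pos
    rw [e1] at h1
    exact (div_pos_iff_of_pos_left hy).1 h1
  have hD' := hD.ne'
  have hy' := hy.ne'
  simp only [vec, slLin_apply, e1, e2]
  generalize M 0 0 = a at *
  generalize M 0 1 = b at *
  generalize M 1 0 = c at *
  generalize M 1 1 = d at *
  generalize z.re = x at *
  generalize z.im = y at *
  obtain ⟨D, hDD⟩ : ∃ D, D = (c * x + d) ^ 2 + (c * y) ^ 2 := ⟨_, rfl⟩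
  rw [← hDD] at hD hD' ⊢
  refine Prod.ext ?_ (Prod.ext ?_ ?_)
  · simp only; field_simp; rw [hDD]; ring
  · simp only; field_simp; ring
  · simp only
    have h3 : (((a * x + b) * (c * x + d) + a * c * y ^ 2) / D) ^ 2 + (y / D) ^ 2
        = ((a * x + b) ^ 2 + (a * y) ^ 2) / D := by
      rw [div_pow, div_pow, ← add_div, div_eq_div_iff (by positivity) hD', hDD]
      linear_combination
        -(y ^ 2 * ((c * x + d) ^ 2 + (c * y) ^ 2) * (1 + (a * d - b * c))) * h
    rw [h3]; field_simp; ring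

/-- The Möbius transformation given by a matrix. -/
def mob : SL(2, ℝ) →* Mob := (MulAction.toPermHom SL(2, ℝ) ℍ).rangeRestrict

lemma mob_surjective : Function.Surjective mob := MonoidHom.rangeRestrict_surjective _

lemma mob_smul (M : SL(2, ℝ)) (z : ℍ) : mob M • z = M • z := rfl

lemma Mob.ext {g h : Mob} (H : ∀ z : ℍ, g • z = h • z) : g = h :=
  Subtype.ext (Equiv.ext H)

/-- The action of `Mob` on Minkowski space. -/
def mobLin (g : Mob) : LVec →ₗ[ℝ] LVec := slLin (Function.surjInv mob_surjective g)

lemma vec_smul (g : Mob) (z : ℍ) : vec (g • z) = mobLin g (vec z) := by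
  rw [mobLin, ← vec_sl_smul, ← mob_smul, Function.surjInv_eq mob_surjective g]

lemma lq_mobLin (g : Mob) (u v : LVec) : lq (mobLin g u) (mobLin g v) = lq u v := lq_slLin _ _ _

/-- The matrix chosen in `mobLin` does not matter, since a linear map is determined by its effect on
points. -/
lemma mobLin_mob (M : SL(2, ℝ)) : mobLin (mob M) = slLin M :=
  linearMap_ext_vec fun z => by rw [← vec_smul, ← vec_sl_smul, mob_smul]

lemma mobLin_one : mobLin 1 = LinearMap.id :=
  linearMap_ext_vec fun z => by rw [← vec_smul, one_smul]; rfl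

lemma mobLin_mul (g h : Mob) : mobLin (g * h) = mobLin g ∘ₗ mobLin h :=
  linearMap_ext_vec fun z => by
    rw [← vec_smul, mul_smul, vec_smul, vec_smul]; rfl

lemma mobLin_mul_apply (g h : Mob) (v : LVec) : mobLin (g * h) v = mobLin g (mobLin h v) := by
  rw [mobLin_mul]; rfl

lemma mobLin_inv_apply (g : Mob) (v : LVec) : mobLin g⁻¹ (mobLin g v) = v := by
  rw [← mobLin_mul_apply, inv_mul_cancel, mobLin_one]; rfl

lemma mobLin_apply_inv (g : Mob) (v : LVec) : mobLin g (mobLin g⁻¹ v) = v := by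
  rw [← mobLin_mul_apply, mul_inv_cancel, mobLin_one]; rfl

lemma lq_mobLin_left (g : Mob) (u v : LVec) : lq (mobLin g u) v = lq u (mobLin g⁻¹ v) := by
  rw [← lq_mobLin g u, mobLin_apply_inv]

lemma Mob.dist_smul (g : Mob) (z w : ℍ) : dist (g • z) (g • w) = dist z w :=
  dist_eq_of_lq (by rw [vec_smul, vec_smul, lq_mobLin])

/-! ### Oriented geodesics -/

/-- The unit normal vector of an oriented geodesic. -/
def nrm (A : Mob) : LVec := mobLin A (0, 1, 0)

lemma nrm_mul (g A : Mob) : nrm (g * A) = mobLin g (nrm A) := mobLin_mul_apply _ _ _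

lemma lq_nrm_self (A : Mob) : lq (nrm A) (nrm A) = 1 := by
  rw [nrm, lq_mobLin]; simp [lq]

lemma lq_nrm_vec (A : Mob) (z : ℍ) : lq (nrm A) (vec z) = (A⁻¹ • z).re / (A⁻¹ • z).im := by
  rw [nrm, lq_mobLin_left, ← vec_smul, lq_vec]; simp

lemma mem_rightSide {A : Mob} {z : ℍ} : z ∈ rightSide A ↔ 0 < lq (nrm A) (vec z) := by
  rw [lq_nrm_vec, div_pos_iff_of_pos_right (UpperHalfPlane.im_pos _)]; rfl

lemma mem_closedRightSide {A : Mob} {z : ℍ} :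
    z ∈ closedRightSide A ↔ 0 ≤ lq (nrm A) (vec z) := by
  rw [lq_nrm_vec, le_div_iff₀ (UpperHalfPlane.im_pos _), zero_mul]; rfl

/-! ## Right-angled hexagons -/

/-- The Lorentzian cross product. -/
def lcross (u v : LVec) : LVec :=
  (-(u.1 * v.2.1 - u.2.1 * v.1) / 2, u.2.2 * v.1 - u.1 * v.2.2,
    -(u.2.1 * v.2.2 - u.2.2 * v.2.1) / 2)

lemma lq_lcross (u v w : LVec) : lq (lcross u v) w = ldet u v w := by
  unfold lq lcross ldet; ring

lemma lq_lcross_lcross (u v u' v' : LVec) : lq (lcross u v) (lcross u' v')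
    = -(lq u u' * lq v v' - lq u v' * lq v u') / 4 := by
  unfold lq lcross; ring

lemma ldet_smul_eq (u v w x : LVec) : ldet u v w • x =
    lq x u • lcross v w + lq x v • lcross w u + lq x w • lcross u v := by
  ext <;> simp [ldet, lq, lcross] <;> ring

lemma eq_zero_of_lq_eq_zero {u v w x : LVec} (h : ldet u v w ≠ 0) (hu : lq x u = 0)
    (hv : lq x v = 0) (hw : lq x w = 0) : x = 0 := by
  have := ldet_smul_eq u v w x
  rw [hu, hv, hw] at this
  simpa [h] using this

/-- A quadratic form of negative discriminant is definite, with the sign of its leading coefficient.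
-/
lemma pos_lq_vec_iff {t : LVec} (ht : lq t t < 0) :
    (∀ z, 0 < lq t (vec z)) ↔ 0 < t.1 := by
  have h4 : t.2.1 ^ 2 < 4 * t.1 * t.2.2 := by unfold lq at ht; nlinarith
  constructor
  · intro h
    have h1 := h ⟨⟨0, 1⟩, one_pos⟩
    rw [lq_vec] at h1
    simp only [UpperHalfPlane.re, UpperHalfPlane.im] at h1
    norm_num at h1
    by_contra hc
    nlinarith [sq_nonneg t.2.1]
  · intro h z
    rw [lq_vec]
    refine div_pos ?_ z.im_pos
    have h0 := z.im_pos
    have : 0 < 4 * t.1 * (t.1 * (z.re ^ 2 + z.im ^ 2) + t.2.1 * z.re + t.2.2) := by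
      nlinarith [sq_nonneg (2 * t.1 * z.re + t.2.1), sq_nonneg (t.1 * z.im)]
    exact pos_of_mul_pos_right this (by positivity)

/-- Two timelike vectors lie in the same cone if their product is negative. -/
lemma pos_lq_vec_of_lq_neg {t t' : LVec} (ht : lq t t < 0) (ht' : lq t' t' < 0)
    (h : lq t t' < 0) (hp : ∀ z, 0 < lq t (vec z)) : ∀ z, 0 < lq t' (vec z) := by
  rw [pos_lq_vec_iff ht']
  rw [pos_lq_vec_iff ht] at hp
  obtain ⟨l, m, k⟩ := t
  obtain ⟨l', m', k'⟩ := t'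
  simp only [lq] at *
  by_contra hc
  push Not at hc
  have h1 : m ^ 2 < 4 * l * k := by nlinarith
  have h2 : m' ^ 2 < 4 * l' * k' := by nlinarith
  have hl' : l' < 0 := lt_of_le_of_ne hc (by rintro rfl; nlinarith [sq_nonneg m'])
  have hk : 0 < k := by nlinarith [sq_nonneg m]
  have hk' : k' < 0 := by nlinarith [sq_nonneg m']
  have h3 : m * m' < 2 * (l * k' + k * l') := by linarith
  have h4 : 0 < -(l * k' + k * l') := by nlinarith [mul_pos hp (neg_pos.2 hk'), mul_pos hk (neg_pos.2 hl')]
  have h5 : (m * m') ^ 2 > (2 * (l * k' + k * l')) ^ 2 := by nlinarith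
  have h6 : (m * m') ^ 2 ≤ (4 * l * k) * (4 * l' * k') := by
    rw [mul_pow]; exact mul_le_mul h1.le h2.le (sq_nonneg _) (by positivity)
  nlinarith [sq_nonneg (l * k' - k * l')]

/-- The half-planes `n i` contain the three cuffs' common side, and the half-planes `b i` are
bounded by the common perpendiculars of the other two cuffs: their intersection is a right-angled
hexagon. -/
structure Hexagon (n b : Fin 3 → LVec) : Prop where
  nn_self : ∀ i, lq (n i) (n i) = 1
  bb_self : ∀ i, lq (b i) (b i) = 1
  nn : ∀ i j, i ≠ j → lq (n i) (n j) < -1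
  bb : ∀ i j, i ≠ j → lq (b i) (b j) < -1
  bn_self : ∀ i, lq (b i) (n i) < -1
  bn : ∀ i j, i ≠ j → lq (b i) (n j) = 0
  nn_pos : ∀ i j, i ≠ j → ∀ z, 0 < lq (n i - lq (n i) (n j) • n j) (vec z)
  det : ldet (n 0) (n 1) (n 2) ≠ 0

/-- The perpendicular to two cuffs is a multiple of their cross product. With κ > 1 for the negated
products of the cuffs, all inequalities follow from the Gram identity 4d² = κ₀² + κ₁² + κ₂² +
2κ₀κ₁κ₂ - 1. -/
lemma exists_hexagon_aux {n : Fin 3 → LVec} (h1 : ∀ i, lq (n i) (n i) = 1)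
    (h2 : ∀ i j, i ≠ j → lq (n i) (n j) < -1)
    (h3 : ∀ i j, i ≠ j → ∀ z, 0 < lq (n i - lq (n i) (n j) • n j) (vec z)) :
    ∃ b, Hexagon n b := by
  obtain ⟨d, hd⟩ : ∃ d, d = ldet (n 0) (n 1) (n 2) := ⟨_, rfl⟩
  have hdi : ∀ i, ldet (n (i + 1)) (n (i + 2)) (n i) = d := by
    intro i; rw [hd]; fin_cases i <;> simp [ldet] <;> ring
  have hne1 : ∀ i : Fin 3, i ≠ i + 1 := by decide
  have hne2 : ∀ i : Fin 3, i ≠ i + 2 := by decide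
  have hne3 : ∀ i : Fin 3, i + 1 ≠ i + 2 := by decide
  have hcases : ∀ i j : Fin 3, i ≠ j → j = i + 1 ∨ j = i + 2 := by decide
  have hgram : ∀ i, 4 * d ^ 2 = lq (n i) (n (i + 1)) ^ 2 + lq (n i) (n (i + 2)) ^ 2
      + lq (n (i + 1)) (n (i + 2)) ^ 2
      - 2 * (lq (n i) (n (i + 1)) * lq (n i) (n (i + 2)) * lq (n (i + 1)) (n (i + 2))) - 1 := by
    intro i
    have := gram_det (n (i + 1)) (n (i + 2)) (n i)
    rw [hdi, h1, h1, h1, lq_comm (n (i + 1)) (n i), lq_comm (n (i + 2)) (n i)] at this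
    linarith
  have hd0 : 0 < 4 * d ^ 2 := by
    rw [hgram 0]
    have e1 := h2 0 (0 + 1) (hne1 0)
    have e2 := h2 0 (0 + 2) (hne2 0)
    have e3 := h2 (0 + 1) (0 + 2) (hne3 0)
    nlinarith [mul_pos (neg_pos.2 (e1.trans (by norm_num : (-1:ℝ) < 0)))
      (neg_pos.2 (e2.trans (by norm_num : (-1:ℝ) < 0)))]
  have hdne : d ≠ 0 := by rintro rfl; simp at hd0
  set κ : Fin 3 → ℝ := fun i => -lq (n (i + 1)) (n (i + 2)) with hκ
  have hκ1 : ∀ i, 1 < κ i := fun i => by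
    have := h2 _ _ (hne3 i); simp only [hκ]; linarith
  set s : Fin 3 → ℝ := fun i => √(4 * d ^ 2 / (κ i ^ 2 - 1)) with hs
  have hκ0 : ∀ i, 0 < κ i ^ 2 - 1 := fun i => by nlinarith [hκ1 i]
  have hs2 : ∀ i, s i ^ 2 = 4 * d ^ 2 / (κ i ^ 2 - 1) := fun i =>
    Real.sq_sqrt (div_nonneg hd0.le (hκ0 i).le)
  have hs0 : ∀ i, 0 < s i := fun i => Real.sqrt_pos.2 (div_pos hd0 (hκ0 i))
  have hgram' : ∀ i, 4 * d ^ 2 = κ i ^ 2 + κ (i + 1) ^ 2 + κ (i + 2) ^ 2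
      + 2 * (κ i * κ (i + 1) * κ (i + 2)) - 1 := by
    intro i
    have e1 : κ (i + 1) = -lq (n i) (n (i + 2)) := by
      simp only [hκ]; rw [lq_comm]; fin_cases i <;> rfl
    have e2 : κ (i + 2) = -lq (n i) (n (i + 1)) := by
      simp only [hκ]; fin_cases i <;> rfl
    rw [e1, e2, hgram i]; simp only [hκ]; ring
  have hs1 : ∀ i, 1 < s i := by
    intro i
    have : 1 < s i ^ 2 := by
      rw [hs2, one_lt_div (hκ0 i), hgram' i]
      have e1 := hκ1 i
      have e2 := hκ1 (i + 1)
      have e3 := hκ1 (i + 2)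
      have := mul_pos (mul_pos (one_pos.trans e1) (one_pos.trans e2)) (one_pos.trans e3)
      nlinarith [sq_nonneg (κ (i + 1)), sq_nonneg (κ (i + 2))]
    nlinarith [hs0 i]
  -- The factor `s i` normalizes the length. The sign is such that the product with the opposite
  -- cuff is `-s i`.
  set b : Fin 3 → LVec := fun i => (-(s i / d)) • lcross (n (i + 1)) (n (i + 2)) with hb
  have hbb : ∀ i, lq (b i) (b i) = 1 := by
    intro i
    simp only [hb]
    rw [lq_smul_left, lq_smul_right, lq_lcross_lcross, h1, h1, lq_comm (n (i + 2))]
    have := hs2 i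
    have h0 := (hκ0 i).ne'
    rw [eq_div_iff h0] at this
    simp only [hκ] at this
    field_simp
    linarith
  have hbn_self : ∀ i, lq (b i) (n i) < -1 := by
    intro i
    simp only [hb]
    rw [lq_smul_left, lq_lcross, hdi, neg_mul, div_mul_cancel₀ _ hdne]
    linarith [hs1 i]
  have hbn : ∀ i j, i ≠ j → lq (b i) (n j) = 0 := by
    intro i j hij
    simp only [hb]
    rw [lq_smul_left, lq_lcross]
    rcases hcases i j hij with rfl | rfl <;> simp [ldet] <;> right <;> ring
  have hbb1 : ∀ i, lq (b i) (b (i + 1)) < -1 := by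
    intro i
    have e1 : κ (i + 1) = -lq (n (i + 2)) (n i) := by
      simp only [hκ]; fin_cases i <;> rfl
    have e2 : κ (i + 2) = -lq (n i) (n (i + 1)) := by
      simp only [hκ]; fin_cases i <;> rfl
    have e0 : κ i = -lq (n (i + 1)) (n (i + 2)) := rfl
    have e3 : i + 1 + 1 = i + 2 := by fin_cases i <;> rfl
    have e4 : i + 1 + 2 = i := by fin_cases i <;> rfl
    have hval : lq (b i) (b (i + 1)) =
        -(s i * s (i + 1) * (κ (i + 2) + κ i * κ (i + 1)) / (4 * d ^ 2)) := by
      simp only [hb]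
      rw [lq_smul_left, lq_smul_right, lq_lcross_lcross, e3, e4, h1, e2, e0, e1,
        lq_comm (n (i + 1)) (n i)]
      field_simp; ring
    rw [hval, neg_lt_neg_iff, one_lt_div hd0]
    refine lt_of_pow_lt_pow_left₀ 2 ?_ ?_
    · have := hκ1 i; have := hκ1 (i + 1); have := hκ1 (i + 2)
      have := hs0 i; have := hs0 (i + 1)
      positivity
    · rw [mul_pow (s i * s (i + 1)), mul_pow (s i), hs2, hs2]
      have h0 := hκ0 i
      have h0' := hκ0 (i + 1)
      rw [div_mul_div_comm, div_mul_eq_mul_div, lt_div_iff₀ (by positivity), ← pow_two]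
      refine mul_lt_mul_of_pos_left ?_ (by positivity)
      -- By the Gram identity, the two sides of the inequality differ by 4d².
      have := hgram' i
      nlinarith
  refine ⟨b, h1, hbb, h2, ?_, hbn_self, hbn, h3, hd ▸ hdne⟩
  intro i j hij
  rcases hcases i j hij with rfl | rfl
  · exact hbb1 i
  · have := hbb1 (i + 2)
    rw [lq_comm]
    convert this using 3
    fin_cases i <;> rfl

namespace Hexagon

variable {n b : Fin 3 → LVec}

lemma exists_ne (i : Fin 3) : ∃ j : Fin 3, i ≠ j := ⟨i + 1, by revert i; decide⟩

lemma timelike {u v : LVec} (hu : lq u u = 1) (hv : lq v v = 1) (h : lq u v < -1) :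
    lq (u - lq u v • v) (u - lq u v • v) < 0 := by
  simp only [lq_sub_left, lq_sub_right, lq_smul_left, lq_smul_right, hu, hv, lq_comm v u]
  nlinarith

/-- The orientation is inherited from the cuffs: since `b i` is orthogonal to `n j`, the timelike
vectors of the two pairs have negative product and lie in the same cone. -/
lemma bb_pos (h : Hexagon n b) (i j : Fin 3) (hij : i ≠ j) (z : ℍ) :
    0 < lq (b i - lq (b i) (b j) • b j) (vec z) := by
  refine pos_lq_vec_of_lq_neg (timelike (h.nn_self i) (h.nn_self j) (h.nn i j hij))
    (timelike (h.bb_self i) (h.bb_self j) (h.bb i j hij)) ?_ (h.nn_pos i j hij) z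
  simp only [lq_sub_left, lq_sub_right, lq_smul_left, lq_smul_right, lq_comm (n _) (b _),
    h.bn i j hij, h.bn j i hij.symm]
  nlinarith [h.nn i j hij, h.bb i j hij, h.bn_self i, h.bn_self j,
    mul_pos_of_neg_of_neg ((h.nn i j hij).trans (by norm_num : (-1:ℝ) < 0))
      ((h.bb i j hij).trans (by norm_num : (-1:ℝ) < 0))]

lemma nb_pos (h : Hexagon n b) (i : Fin 3) (z : ℍ) :
    0 < lq (n i - lq (n i) (b i) • b i) (vec z) := by
  obtain ⟨j, hij⟩ := exists_ne i
  have hb := h.bn_self i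
  rw [lq_comm] at hb
  refine pos_lq_vec_of_lq_neg (timelike (h.nn_self i) (h.nn_self j) (h.nn i j hij))
    (timelike (h.nn_self i) (h.bb_self i) hb) ?_ (h.nn_pos i j hij) z
  simp only [lq_sub_left, lq_sub_right, lq_smul_left, lq_smul_right, lq_comm (n _) (b _),
    h.bn i j hij, h.nn_self, lq_comm (n j) (n i)]
  nlinarith [h.nn i j hij, h.bn_self i]

/-- The closed half-planes outside of the hexagon are pairwise at positive distance, except for
those of adjacent sides. -/
lemma exists_separation (h : Hexagon n b) : ∃ δ > 0,
    (∀ i j, i ≠ j → ∀ z w, lq (n i) (vec z) ≤ 0 → lq (n j) (vec w) ≤ 0 → δ ≤ dist z w) ∧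
    (∀ i j, i ≠ j → ∀ z w, lq (b i) (vec z) ≤ 0 → lq (b j) (vec w) ≤ 0 → δ ≤ dist z w) ∧
    (∀ i, ∀ z w, lq (n i) (vec z) ≤ 0 → lq (b i) (vec w) ≤ 0 → δ ≤ dist z w) := by
  -- A common bound for the finitely many products of ultraparallel sides; `arcosh c` is the
  -- separating distance by `cosh_dist_ge_of_disjoint`.
  obtain ⟨c, hc1, hc⟩ : ∃ c > 1, ∀ i, (∀ j, i ≠ j → c ≤ -lq (n i) (n j)) ∧
      (∀ j, i ≠ j → c ≤ -lq (b i) (b j)) ∧ c ≤ -lq (n i) (b i) := by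
    have hfin : ∀ (S : Finset ℝ), (∀ x ∈ S, 1 < x) → ∃ c > 1, ∀ x ∈ S, c ≤ x := by
      intro S hS
      rcases S.eq_empty_or_nonempty with rfl | hne
      · exact ⟨2, by norm_num, by simp⟩
      · exact ⟨S.min' hne, hS _ (S.min'_mem hne), fun x hx => S.min'_le x hx⟩
    obtain ⟨c1, h1, h1'⟩ := hfin ((Finset.univ.filter fun p : Fin 3 × Fin 3 => p.1 ≠ p.2).image
      fun p => -lq (n p.1) (n p.2)) (by
        simp only [Finset.mem_image, Finset.mem_filter, Finset.mem_univ, true_and]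
        rintro _ ⟨p, hp, rfl⟩; linarith [h.nn _ _ hp])
    obtain ⟨c2, h2, h2'⟩ := hfin ((Finset.univ.filter fun p : Fin 3 × Fin 3 => p.1 ≠ p.2).image
      fun p => -lq (b p.1) (b p.2)) (by
        simp only [Finset.mem_image, Finset.mem_filter, Finset.mem_univ, true_and]
        rintro _ ⟨p, hp, rfl⟩; linarith [h.bb _ _ hp])
    obtain ⟨c3, h3, h3'⟩ := hfin (Finset.univ.image fun i : Fin 3 => -lq (n i) (b i)) (by
        simp only [Finset.mem_image, Finset.mem_univ, true_and]
        rintro _ ⟨p, rfl⟩; rw [lq_comm]; linarith [h.bn_self p])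
    refine ⟨min c1 (min c2 c3), by simp [h1, h2, h3], fun i => ⟨fun j hij => ?_, fun j hij => ?_, ?_⟩⟩
    · exact (min_le_left _ _).trans (h1' _ (Finset.mem_image.2 ⟨(i, j), by simp [hij], rfl⟩))
    · exact ((min_le_right _ _).trans (min_le_left _ _)).trans
        (h2' _ (Finset.mem_image.2 ⟨(i, j), by simp [hij], rfl⟩))
    · exact ((min_le_right _ _).trans (min_le_right _ _)).trans
        (h3' _ (Finset.mem_image.2 ⟨i, by simp, rfl⟩))
  have key : ∀ z w : ℍ, c ≤ Real.cosh (dist z w) → Real.arcosh c ≤ dist z w := fun z w hzw => by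
    rw [← Real.arcosh_cosh (dist_nonneg : 0 ≤ dist z w)]
    exact (Real.arcosh_le_arcosh (one_pos.trans hc1) (Real.cosh_pos _)).2 hzw
  refine ⟨Real.arcosh c, Real.arcosh_pos hc1, ?_, ?_, ?_⟩
  · intro i j hij z w hz hw
    exact key z w (((hc i).1 j hij).trans (cosh_dist_ge_of_disjoint (h.nn_self i) (h.nn_self j)
      (h.nn i j hij) (h.nn_pos i j hij) hz hw))
  · intro i j hij z w hz hw
    exact key z w (((hc i).2.1 j hij).trans (cosh_dist_ge_of_disjoint (h.bb_self i) (h.bb_self j)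
      (h.bb i j hij) (h.bb_pos i j hij) hz hw))
  · intro i z w hz hw
    exact key z w (((hc i).2.2).trans (cosh_dist_ge_of_disjoint (h.nn_self i) (h.bb_self i)
      (lq_comm (b i) (n i) ▸ h.bn_self i) (h.nb_pos i) hz hw))

lemma eq_zero (h : Hexagon n b) {x : LVec} (hx : ∀ i, lq x (n i) = 0) : x = 0 :=
  eq_zero_of_lq_eq_zero h.det (hx 0) (hx 1) (hx 2)

/-- The side `b i` is determined by being orthogonal to two cuffs. -/
lemma eq_or_eq_neg (h : Hexagon n b) {a : LVec} (ha : lq a a = 1) {i : Fin 3}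
    (hi : ∀ j, i ≠ j → lq a (n j) = 0) : a = b i ∨ a = -b i := by
  have h0 : lq (b i) (n i) ≠ 0 := by linarith [h.bn_self i]
  have h1 : a = (lq a (n i) / lq (b i) (n i)) • b i := by
    refine sub_eq_zero.1 (h.eq_zero fun j => ?_)
    rw [lq_sub_left, lq_smul_left]
    rcases eq_or_ne i j with rfl | hij
    · field_simp; ring
    · rw [hi j hij, h.bn i j hij]; ring
  have h2 := ha
  rw [h1, lq_smul_left, lq_smul_right, h.bb_self, mul_one] at h2
  rcases mul_self_eq_one_iff.1 h2 with h3 | h3 <;> rw [h3] at h1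
  · left; simpa using h1
  · right; simpa using h1

/-- A right-angled hexagon is bounded. -/
lemma bounded (h : Hexagon n b) : ∃ r : ℝ, ∀ z : ℍ, (∀ i, 0 ≤ lq (b i) (vec z)) →
    (∀ i, 0 ≤ lq (n i) (vec z)) → dist z UpperHalfPlane.I ≤ r := by
  obtain ⟨e, he0, he⟩ : ∃ e > 0, ∀ i j, i ≠ j → e ≤ -lq (b i) (b j) - 1 := by
    refine ⟨min (-lq (b 0) (b 1) - 1) (min (-lq (b 1) (b 2) - 1) (-lq (b 2) (b 0) - 1)), ?_, ?_⟩
    · have h1 := h.bb 0 1 (by decide)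
      have h2 := h.bb 1 2 (by decide)
      have h3 := h.bb 2 0 (by decide)
      refine lt_min (by linarith) (lt_min (by linarith) (by linarith))
    · intro i j hij
      fin_cases i <;> fin_cases j <;>
        simp [lq_comm (b 1) (b 0), lq_comm (b 2) (b 1), lq_comm (b 0) (b 2)] at hij ⊢
  obtain ⟨K, hK0, hK⟩ : ∃ K > 0, ∀ i j, i ≠ j → -lq (b i) (b j) ≤ K := by
    refine ⟨max (-lq (b 0) (b 1)) (max (-lq (b 1) (b 2)) (-lq (b 2) (b 0))), ?_, ?_⟩
    · have h1 := h.bb 0 1 (by decide)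
      exact lt_max_of_lt_left (by linarith)
    · intro i j hij
      fin_cases i <;> fin_cases j <;>
        simp [lq_comm (b 1) (b 0), lq_comm (b 2) (b 1), lq_comm (b 0) (b 2)] at hij ⊢
  set C := 2 * K / e with hC
  set N := ∑ i, |lq (b i) (vec UpperHalfPlane.I)| with hN
  refine ⟨Real.arcosh (1 + √C * N), fun z hb hn => ?_⟩
  -- The vectors `b i` are, up to scale, the basis dual to the cuffs. In the hexagon the coordinates
  -- `X i` of `vec z` with respect to `-b i` and the values `y i` on the seams are nonnegative, and
  -- `vec z` having square -1 means ∑ X i * y i = 1.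
  set X : Fin 3 → ℝ := fun i => -(lq (n i) (vec z) / lq (b i) (n i)) with hX
  have hX0 : ∀ i, 0 ≤ X i := fun i => by
    simp only [hX]
    rw [← div_neg]
    exact div_nonneg (hn i) (by linarith [h.bn_self i])
  have hvec : vec z = -∑ i, X i • b i := by
    refine eq_neg_of_add_eq_zero_left (h.eq_zero fun j => ?_)
    have h0 := (h.bn_self j).trans (by norm_num : (-1:ℝ) < 0) |>.ne
    simp only [Fin.sum_univ_three, lq_add_left, lq_smul_left]
    fin_cases j
    · have h1 := h.bn 1 0 (by decide)
      have h2 := h.bn 2 0 (by decide)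
      simp only [hX, Fin.zero_eta] at h0 ⊢
      rw [h1, h2, lq_comm (vec z)]; field_simp; ring
    · have h1 := h.bn 0 1 (by decide)
      have h2 := h.bn 2 1 (by decide)
      simp only [hX, Fin.mk_one] at h0 ⊢
      rw [h1, h2, lq_comm (vec z)]; field_simp; ring
    · have h1 := h.bn 0 2 (by decide)
      have h2 := h.bn 1 2 (by decide)
      simp only [hX, Fin.reduceFinMk] at h0 ⊢
      rw [h1, h2, lq_comm (vec z)]; field_simp; ring
  set y : Fin 3 → ℝ := fun i => lq (b i) (vec z) with hy
  have hsum : X 0 * y 0 + X 1 * y 1 + X 2 * y 2 = 1 := by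
    have h1 := lq_vec_self z
    nth_rewrite 1 [hvec] at h1
    simp only [lq_neg_left, Fin.sum_univ_three, lq_add_left, lq_smul_left] at h1
    simp only [hy]; linarith
  have hyi : ∀ j, y j = -(X 0 * lq (b j) (b 0) + X 1 * lq (b j) (b 1) + X 2 * lq (b j) (b 2)) := by
    intro j
    simp only [hy]
    rw [hvec]
    simp only [lq_neg_right, Fin.sum_univ_three, lq_add_right, lq_smul_right]
  have hterm : ∀ i, X i * y i ≤ 1 := by
    have h0 := mul_nonneg (hX0 0) (hb 0)
    have h1 := mul_nonneg (hX0 1) (hb 1)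
    have h2 := mul_nonneg (hX0 2) (hb 2)
    intro i
    fin_cases i <;> simp only [Fin.zero_eta, Fin.mk_one, Fin.reduceFinMk, hy] at hsum ⊢ <;> linarith
  -- For the largest coordinate `X i`, the value `y j` of each other seam is at least `e * X i`, so
  -- `X j * y j ≤ 1` bounds `X i * X j`. Moreover `0 ≤ y i` bounds `X i` by `K * (X j + X k)`.
  -- Together they bound `X i ^ 2`.
  have main : ∀ i j k, i ≠ j → i ≠ k → j ≠ k → X j ≤ X i → X k ≤ X i → X i ^ 2 ≤ C := by
    intro i j k hij hik hjk hj hk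
    have hyl : ∀ l, y l = -(X i * lq (b l) (b i) + X j * lq (b l) (b j) + X k * lq (b l) (b k)) := by
      intro l
      rw [hyi l]
      fin_cases i <;> fin_cases j <;> fin_cases k <;> simp at hij hik hjk ⊢ <;> ring
    have hbound : ∀ j k, i ≠ j → i ≠ k → j ≠ k → X j ≤ X i →
        (∀ l, y l = -(X i * lq (b l) (b i) + X j * lq (b l) (b j) + X k * lq (b l) (b k))) →
        e * (X i * X j) ≤ 1 := by
      intro j k hij hik hjk hj hyl
      have h1 := hyl j
      rw [h.bb_self] at h1
      have h2 := he j i hij.symm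
      have h3 := he j k hjk
      have h5 : e * X i ≤ y j := by
        have a1 : e * X i ≤ (-lq (b j) (b i) - 1) * X i := mul_le_mul_of_nonneg_right h2 (hX0 i)
        have a2 : 0 ≤ (-lq (b j) (b k)) * X k := mul_nonneg (by linarith) (hX0 k)
        rw [h1]; nlinarith
      calc e * (X i * X j) = X j * (e * X i) := by ring
        _ ≤ X j * y j := mul_le_mul_of_nonneg_left h5 (hX0 j)
        _ ≤ 1 := hterm j
    have hj1 := hbound j k hij hik hjk hj hyl
    have hk1 := hbound k j hik hij hjk.symm hk (fun l => by rw [hyl l]; ring)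
    have h1 := hyl i
    rw [h.bb_self] at h1
    have h2 : 0 ≤ y i := hb i
    have h3 : X i ≤ K * X j + K * X k := by
      have a1 := mul_le_mul_of_nonneg_right (hK i j hij) (hX0 j)
      have a2 := mul_le_mul_of_nonneg_right (hK i k hik) (hX0 k)
      nlinarith
    rw [hC, le_div_iff₀ he0]
    calc X i ^ 2 * e = e * (X i * X i) := by ring
      _ ≤ e * (X i * (K * X j + K * X k)) := by
        gcongr; exact hX0 i
      _ = K * (e * (X i * X j)) + K * (e * (X i * X k)) := by ring
      _ ≤ K * 1 + K * 1 := by gcongr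
      _ = 2 * K := by ring
  have hXC : ∀ i, X i ≤ √C := by
    have hmax : ∃ i, ∀ j, X j ≤ X i := Finite.exists_max X
    obtain ⟨i, hi⟩ := hmax
    intro j
    refine (hi j).trans (Real.le_sqrt_of_sq_le ?_)
    have h3 : ∀ i : Fin 3, i ≠ i + 1 ∧ i ≠ i + 2 ∧ i + 1 ≠ i + 2 := by decide
    exact main i (i + 1) (i + 2) (h3 i).1 (h3 i).2.1 (h3 i).2.2 (hi _) (hi _)
  have hcosh : Real.cosh (dist z UpperHalfPlane.I) ≤ 1 + √C * N := by
    rw [cosh_dist_eq, hvec]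
    simp only [lq_neg_left, Fin.sum_univ_three, lq_add_left, lq_smul_left, hN, neg_neg]
    have : ∀ i, X i * lq (b i) (vec UpperHalfPlane.I) ≤ √C * |lq (b i) (vec UpperHalfPlane.I)| :=
      fun i => (mul_le_mul_of_nonneg_left (le_abs_self _) (hX0 i)).trans
          (mul_le_mul_of_nonneg_right (hXC i) (abs_nonneg _))
    linarith [this 0, this 1, this 2]
  rw [← Real.arcosh_cosh (dist_nonneg : 0 ≤ dist z UpperHalfPlane.I)]
  exact (Real.arcosh_le_arcosh (Real.cosh_pos _) ((Real.cosh_pos _).trans_le hcosh)).2 hcosh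

end Hexagon

/-! ## Translations -/

/-- A matrix of determinant one, by its entries. -/
def slMk (a b c d : ℝ) (h : a * d - b * c = 1) : SL(2, ℝ) :=
  ⟨!![a, b; c, d], by rw [Matrix.det_fin_two_of, h]⟩

lemma slLin_slMk {a b c d : ℝ} (h : a * d - b * c = 1) (v : LVec) :
    slLin (slMk a b c d h) v = (d ^ 2 * v.1 - c * d * v.2.1 + c ^ 2 * v.2.2,
      -2 * b * d * v.1 + (a * d + b * c) * v.2.1 - 2 * a * c * v.2.2,
      b ^ 2 * v.1 - a * b * v.2.1 + a ^ 2 * v.2.2) := rfl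

/-- The translation by `t` along the standard geodesic. -/
def trans (t : ℝ) : Mob :=
  mob (slMk (Real.exp (t / 2)) 0 0 (Real.exp (-(t / 2))) (by rw [← Real.exp_add]; simp))

/-- The rotation that reverses the standard geodesic. -/
def swap : Mob := mob (slMk 0 (-1) 1 0 (by norm_num))

lemma mobLin_trans (t : ℝ) (v : LVec) :
    mobLin (trans t) v = (Real.exp (-t) * v.1, v.2.1, Real.exp t * v.2.2) := by
  have h1 : Real.exp (-(t / 2)) ^ 2 = Real.exp (-t) := by rw [← Real.exp_nat_mul]; congr 1; push_cast; ring
  have h2 : Real.exp (t / 2) ^ 2 = Real.exp t := by rw [← Real.exp_nat_mul]; congr 1; push_cast; ring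
  have h3 : Real.exp (t / 2) * Real.exp (-(t / 2)) = 1 := by rw [← Real.exp_add]; simp
  rw [trans, mobLin_mob, slLin_slMk]
  simp [h1, h2, h3]

lemma mobLin_swap (v : LVec) : mobLin swap v = (v.2.2, -v.2.1, v.1) := by
  rw [swap, mobLin_mob, slLin_slMk]; simp

lemma vec_stdGeodesic (t : ℝ) : vec (stdGeodesic t) = (-Real.exp (-t) / 2, 0, -Real.exp t / 2) := by
  have h1 : (stdGeodesic t).re = 0 := rfl
  have h2 : (stdGeodesic t).im = Real.exp t := rfl
  have h3 := (Real.exp_pos t).ne'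
  simp only [vec, h1, h2, Real.exp_neg]
  refine Prod.ext ?_ (Prod.ext ?_ ?_)
  · simp only; field_simp
  · simp
  · simp only; field_simp; ring

lemma vec_geodesic (A : Mob) (t : ℝ) :
    vec (geodesic A t) = mobLin A (-Real.exp (-t) / 2, 0, -Real.exp t / 2) := by
  rw [geodesic, vec_smul, vec_stdGeodesic]

lemma Mob.ext_lin {g h : Mob} (H : ∀ v, mobLin g v = mobLin h v) : g = h :=
  Mob.ext fun z => vec_injective (by rw [vec_smul, vec_smul, H])

lemma trans_zero : trans 0 = 1 := Mob.ext_lin fun v => by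
  rw [mobLin_trans, mobLin_one]; simp

lemma trans_add (s t : ℝ) : trans (s + t) = trans s * trans t := Mob.ext_lin fun v => by
  rw [mobLin_mul_apply, mobLin_trans, mobLin_trans, mobLin_trans, neg_add, Real.exp_add,
    Real.exp_add]
  simp [mul_assoc]

lemma trans_neg (t : ℝ) : trans (-t) = (trans t)⁻¹ := by
  rw [eq_inv_iff_mul_eq_one, ← trans_add, neg_add_cancel, trans_zero]

lemma trans_zpow (t : ℝ) (m : ℤ) : trans t ^ m = trans (m * t) := by
  let f : Multiplicative ℝ →* Mob :=
    { toFun := fun s => trans s.toAdd, map_one' := trans_zero, map_mul' := fun a b => trans_add _ _ }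
  have h : f (Multiplicative.ofAdd t ^ m) = f (Multiplicative.ofAdd t) ^ m := map_zpow f _ _
  rw [← ofAdd_zsmul, zsmul_eq_mul] at h
  exact h.symm

lemma trans_smul_stdGeodesic (s t : ℝ) : trans s • stdGeodesic t = stdGeodesic (t + s) :=
  vec_injective (by
    rw [vec_smul, vec_stdGeodesic, vec_stdGeodesic, mobLin_trans, neg_add, Real.exp_add,
      Real.exp_add]
    refine Prod.ext ?_ (Prod.ext rfl ?_) <;> simp only <;> ring)

lemma swap_smul_stdGeodesic (t : ℝ) : swap • stdGeodesic t = stdGeodesic (-t) :=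
  vec_injective (by rw [vec_smul, vec_stdGeodesic, vec_stdGeodesic, mobLin_swap]; simp)

lemma geodesic_mul (g A : Mob) (t : ℝ) : geodesic (g * A) t = g • geodesic A t := mul_smul _ _ _

lemma geodesic_mul_trans (A : Mob) (s t : ℝ) : geodesic (A * trans s) t = geodesic A (t + s) := by
  rw [geodesic_mul, geodesic, trans_smul_stdGeodesic, geodesic]

lemma geodesic_mul_swap (A : Mob) (t : ℝ) : geodesic (A * swap) t = geodesic A (-t) := by
  rw [geodesic_mul, geodesic, swap_smul_stdGeodesic, geodesic]

lemma stdGeodesic_injective : Function.Injective stdGeodesic := by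
  intro s t h
  have : (stdGeodesic s).im = (stdGeodesic t).im := by rw [h]
  exact Real.exp_injective this

lemma geodesic_injective (A : Mob) : Function.Injective (geodesic A) := fun _ _ h =>
  stdGeodesic_injective (MulAction.injective A h)

lemma trans_injective : Function.Injective trans := fun s t h => by
  have := congrArg (fun g : Mob => g • stdGeodesic 0) h
  simp only [trans_smul_stdGeodesic] at this
  simpa using stdGeodesic_injective this

lemma nrm_trans (A : Mob) (t : ℝ) : nrm (A * trans t) = nrm A := by
  rw [nrm, mobLin_mul_apply, mobLin_trans]; simp [nrm]

lemma nrm_swap (A : Mob) : nrm (A * swap) = -nrm A := by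
  rw [nrm, mobLin_mul_apply, mobLin_swap, nrm, ← map_neg]; simp

/-! ### Isometries determined by their effect on a geodesic -/

lemma sl_det (M : SL(2, ℝ)) : M 0 0 * M 1 1 - M 0 1 * M 1 0 = 1 := by
  have := M.det_coe; rwa [Matrix.det_fin_two] at this

/-- The entry `M 0 0` may be negative, as the matrix is determined only up to sign. `Real.log`
depends on the absolute value only, so the formula covers both cases. -/
lemma mob_eq_trans {M : SL(2, ℝ)} (hb : M 0 1 = 0) (hc : M 1 0 = 0) :
    mob M = trans (2 * Real.log (M 0 0)) := by
  have hd := sl_det M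
  rw [hb, hc, zero_mul, sub_zero] at hd
  have ha : M 0 0 ≠ 0 := left_ne_zero_of_mul_eq_one hd
  have h1 : Real.exp (2 * Real.log (M 0 0)) = M 0 0 ^ 2 := by
    rw [two_mul, Real.exp_add, ← pow_two, Real.exp_log_eq_abs ha, sq_abs]
  have h2 : Real.exp (-(2 * Real.log (M 0 0))) = M 1 1 ^ 2 := by
    rw [Real.exp_neg, h1, ← inv_pow, eq_comm, ← eq_inv_of_mul_eq_one_right hd]
  refine Mob.ext_lin fun v => ?_
  rw [mobLin_trans, mobLin_mob, slLin_apply, hb, hc, h1, h2]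
  simp [hd]

/-- An orientation preserving isometry with two fixed points is trivial. After conjugation, i and 2i
(parameters 0 and log 2) suffice. -/
lemma eq_one_of_geodesic {A g : Mob} (h : ∀ t, g • geodesic A t = geodesic A t) : g = 1 := by
  obtain ⟨M, hM⟩ := mob_surjective (A⁻¹ * g * A)
  have h' : ∀ t, mob M • stdGeodesic t = stdGeodesic t := fun t => by
    rw [hM, mul_smul, mul_smul]
    have := h t
    rw [geodesic] at this
    rw [this, inv_smul_smul]
  have h0 := h' 0
  have h1 := h' (Real.log 2)
  rw [← (vec_injective.eq_iff), vec_smul, vec_stdGeodesic, mobLin_mob, slLin_apply] at h0 h1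
  have hd := sl_det M
  simp only [Real.exp_neg, Real.exp_log two_pos, Real.exp_zero, Prod.mk.injEq] at h0 h1
  norm_num at h0 h1
  have hb : M 0 1 = 0 := by
    have : M 0 1 ^ 2 = 0 := by linarith
    simpa using this
  have hc : M 1 0 = 0 := by
    have : M 1 0 ^ 2 = 0 := by linarith
    simpa using this
  have : mob M = 1 := by
    rw [mob_eq_trans hb hc]
    have : M 0 0 ^ 2 = 1 := by rw [hb, hc] at h0; linarith [h0.2.2]
    have h4 : 2 * Real.log (M 0 0) = 0 := by
      have h5 := Real.log_pow (M 0 0) 2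
      rw [this, Real.log_one] at h5
      push_cast at h5; linarith
    rw [h4, trans_zero]
  rw [hM, mul_assoc, inv_mul_eq_one] at this
  simpa using this

lemma ClosedGeodesic.elt_eq {Γ : Subgroup Mob} (γ : ClosedGeodesic Γ) :
    (γ.elt : Mob) = γ.axis * trans γ.len * γ.axis⁻¹ := by
  rw [← inv_mul_eq_one]
  refine eq_one_of_geodesic (A := γ.axis) fun t => ?_
  rw [mul_smul, inv_smul_eq_iff, ← geodesic_mul, inv_mul_cancel_right, geodesic_mul_trans]
  exact (γ.translate t).symm

/-- Conjugating one translation to another. -/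
lemma conj_trans {C : Mob} {a b : ℝ} (ha : 0 < a) (hb : 0 < b)
    (h : C * trans a = trans b * C) : a = b ∧ ∃ t, C = trans t := by
  obtain ⟨M, rfl⟩ := mob_surjective C
  -- The isotropic vectors (1, 0, 0) and (0, 0, 1) are the ends of the imaginary axis. They are
  -- eigenvectors of translations, and since `a` and `b` are both positive, `C` must fix each end
  -- rather than exchange them.
  have h1 : mobLin (mob M * trans a) (1, 0, 0) = mobLin (trans b * mob M) (1, 0, 0) := by rw [h]
  have h2 : mobLin (mob M * trans a) (0, 0, 1) = mobLin (trans b * mob M) (0, 0, 1) := by rw [h]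
  simp only [mobLin_mul_apply, mobLin_trans, mobLin_mob, slLin_apply] at h1 h2
  simp only [Prod.mk.injEq, mul_zero, mul_one, add_zero, zero_add, sub_zero] at h1 h2
  have ea : Real.exp (-a) < 1 := by simpa using ha
  have eb : 1 < Real.exp b := by simpa using hb
  have ea' : 1 < Real.exp a := by simpa using ha
  have eb' : Real.exp (-b) < 1 := by simpa using hb
  have hB : M 0 1 = 0 := by
    by_contra hne
    have := mul_left_cancel₀ (pow_ne_zero 2 hne) (h1.2.2.trans (mul_comm _ _))
    linarith
  have hC : M 1 0 = 0 := by
    by_contra hne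
    have h3 : M 1 0 ^ 2 * Real.exp a = M 1 0 ^ 2 * Real.exp (-b) := by
      rw [mul_comm _ (Real.exp (-b))]; simpa using h2.1
    have := mul_left_cancel₀ (pow_ne_zero 2 hne) h3
    linarith
  have hd := sl_det M
  rw [hB, zero_mul, sub_zero] at hd
  have hD : M 1 1 ≠ 0 := right_ne_zero_of_mul_eq_one hd
  refine ⟨?_, _, mob_eq_trans hB hC⟩
  have := mul_left_cancel₀ (pow_ne_zero 2 hD) (h1.1.trans (mul_comm _ _))
  simpa using this

lemma swap_mul_trans (t : ℝ) : swap * trans t = trans (-t) * swap := Mob.ext_lin fun v => by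
  simp [mobLin_mul_apply, mobLin_swap, mobLin_trans]

lemma swap_mul_swap : swap * swap = 1 := Mob.ext_lin fun v => by
  simp [mobLin_mul_apply, mobLin_swap, mobLin_one]

lemma conj_trans_neg {C : Mob} {a b : ℝ} (ha : 0 < a) (hb : 0 < b)
    (h : C * trans a = trans (-b) * C) : a = b ∧ ∃ t, C = trans t * swap := by
  obtain ⟨h1, t, ht⟩ := conj_trans (C := swap * C) ha hb (by
    rw [mul_assoc, h, ← mul_assoc, swap_mul_trans, neg_neg, mul_assoc])
  refine ⟨h1, -t, ?_⟩
  rw [← swap_mul_trans, ← ht, ← mul_assoc, swap_mul_swap, one_mul]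

/-! ### The axes of a pair of pants -/

/-- The sign of the leading term as t → ∞; for negative `u`, the value at `t = log w` already
contradicts positivity. -/
lemma nonneg_of_exp_comb {u v : ℝ} (h : ∀ t, 0 < u * Real.exp t + v * Real.exp (-t)) : 0 ≤ u := by
  by_contra hu
  push Not at hu
  set w := max 1 (v / -u) with hw
  have h1 := h (Real.log w)
  have hw1 : 1 ≤ w := le_max_left _ _
  have hw2 : v ≤ w * -u := (div_le_iff₀ (neg_pos.2 hu)).1 (le_max_right _ _)
  rw [Real.exp_neg, Real.exp_log (by linarith)] at h1
  have h3 : v * w⁻¹ ≤ -u := by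
    rw [← div_eq_mul_inv, div_le_iff₀ (by linarith)]; linarith
  nlinarith

lemma nonneg_of_exp_comb' {u v : ℝ} (h : ∀ t, 0 < u * Real.exp t + v * Real.exp (-t)) : 0 ≤ v :=
  nonneg_of_exp_comb (v := u) fun t => by
    have := h (-t); rw [neg_neg] at this; linarith

/-- In the frame of `A`, the line `B` is given by a matrix (a, b; c, d), and the hypotheses are
positivity of exponential sums with coefficients ac, bd and -cd, -ab. Given ad - bc = 1, these signs
leave only ad ≤ 0, so the product ad + bc is at most -1. Equality corresponds to a common end at
infinity and is excluded for pants in `lq_nrm_lt`. -/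
lemma mutual_right {A B : Mob} (h1 : ∀ t, geodesic B t ∈ rightSide A)
    (h2 : ∀ t, geodesic A t ∈ rightSide B) : lq (nrm A) (nrm B) ≤ -1 ∧
      (lq (nrm A) (nrm B) < -1 → ∀ z, 0 < lq (nrm A - lq (nrm A) (nrm B) • nrm B) (vec z)) := by
  obtain ⟨M, hM⟩ := mob_surjective (A⁻¹ * B)
  have hB : B = A * mob M := by rw [hM]; group
  have hd := sl_det M
  have hl : nrm B = mobLin A (-(M 1 0 * M 1 1), M 0 0 * M 1 1 + M 0 1 * M 1 0, -(M 0 0 * M 0 1)) := by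
    rw [hB, nrm_mul, nrm, mobLin_mob, slLin_apply]; simp
  have hQ : lq (nrm A) (nrm B) = M 0 0 * M 1 1 + M 0 1 * M 1 0 := by
    rw [hl, nrm, lq_mobLin]; simp [lq]
  have k1 : ∀ t, 0 < (M 0 0 * M 1 0) * Real.exp t + (M 0 1 * M 1 1) * Real.exp (-t) := fun t => by
    have := mem_rightSide.1 (h1 t)
    rw [hB, vec_geodesic, mobLin_mul_apply, nrm, lq_mobLin, mobLin_mob, slLin_apply] at this
    simp only [lq] at this
    linarith
  have k2 : ∀ t, 0 < (-(M 1 0 * M 1 1)) * Real.exp t + (-(M 0 0 * M 0 1)) * Real.exp (-t) :=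
    fun t => by
    have := mem_rightSide.1 (h2 t)
    rw [hl, vec_geodesic, lq_mobLin] at this
    simp only [lq] at this
    linarith
  have a1 := nonneg_of_exp_comb k1
  have a2 := nonneg_of_exp_comb' k1
  have a3 := nonneg_of_exp_comb k2
  have a4 := nonneg_of_exp_comb' k2
  have a5 := k2 0
  rw [neg_zero, Real.exp_zero, mul_one, mul_one] at a5
  generalize M 0 0 = a at *
  generalize M 0 1 = b at *
  generalize M 1 0 = c at *
  generalize M 1 1 = d at *
  have hle : a * d + b * c ≤ -1 := by
    have hbc : b * c < 0 := by
      by_contra hbc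
      push Not at hbc
      have had : 0 < a * d := by linarith
      have e1 : (a * c) * (c * d) = a * d * c ^ 2 := by ring
      have hc : c = 0 := by
        by_contra hc
        have : 0 < a * d * c ^ 2 := by positivity
        nlinarith
      have hb : b = 0 := by
        by_contra hb
        have e2 : (b * d) * (a * b) = a * d * b ^ 2 := by ring
        have : 0 < a * d * b ^ 2 := by positivity
        nlinarith
      rw [hb, hc] at a5
      simp at a5
    have hadle : a * d ≤ 0 := by
      by_contra had
      push Not at had
      have e1 : (a * c) * (c * d) = a * d * c ^ 2 := by ring
      have hc : c ≠ 0 := by rintro rfl; simp at hbc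
      have : 0 < a * d * c ^ 2 := by positivity
      nlinarith
    linarith
  rw [hQ]
  refine ⟨hle, fun hlt z => ?_⟩
  have hvec : nrm A - (a * d + b * c) • nrm B = mobLin A ((0, 1, 0) -
      (a * d + b * c) • (-(c * d), a * d + b * c, -(a * b))) := by
    rw [hl, nrm, map_sub, map_smul]
  rw [hvec, lq_mobLin_left, ← vec_smul]
  revert z
  have hcd : 0 < -(c * d) := by
    refine lt_of_le_of_ne a3 fun h0 => ?_
    have : (a * d) * (b * c) = 0 := by linear_combination (a * b) * h0
    rcases mul_eq_zero.1 this with h | h <;> rw [h] at hd hlt <;> linarith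
  have := (pos_lq_vec_iff (t := (0, 1, 0) - (a * d + b * c) • (-(c * d), a * d + b * c, -(a * b)))
    ?_).2 ?_
  · exact fun z => this (A⁻¹ • z)
  · have hs : (a * d + b * c) ^ 2 - 1 = 4 * (a * b * (c * d)) := by
      linear_combination (a * d - b * c + 1) * hd
    have hs1 : 1 < (a * d + b * c) ^ 2 := by nlinarith
    have he : lq ((0, 1, 0) - (a * d + b * c) • (-(c * d), a * d + b * c, -(a * b)))
        ((0, 1, 0) - (a * d + b * c) • (-(c * d), a * d + b * c, -(a * b))) =
        1 - (a * d + b * c) ^ 2 := by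
      simp [lq]
      linear_combination (a * d + b * c) ^ 2 * hs
    rw [he]; linarith
  · simp
    nlinarith

/-- `e` is an eigenvector of the linear action of `g`. -/
def IsEigen (g : Mob) (e : LVec) : Prop := ∃ c : ℝ, mobLin g e = c • e

lemma IsEigen.mul {g h : Mob} {e : LVec} (hg : IsEigen g e) (hh : IsEigen h e) :
    IsEigen (g * h) e := by
  obtain ⟨c, hc⟩ := hg
  obtain ⟨d, hd⟩ := hh
  exact ⟨d * c, by rw [mobLin_mul_apply, hd, map_smul, hc, smul_smul]⟩

lemma IsEigen.inv {g : Mob} {e : LVec} (hg : IsEigen g e) : IsEigen g⁻¹ e := by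
  obtain ⟨c, hc⟩ := hg
  refine ⟨c⁻¹, ?_⟩
  have h := mobLin_inv_apply g e
  rw [hc, map_smul] at h
  rcases eq_or_ne c 0 with rfl | h0
  · rw [zero_smul] at h; rw [← h]; simp
  · rw [← h, smul_smul, inv_mul_cancel₀ h0, one_smul, h]

/-- An isotropic vector orthogonal to the normal of a line is an end of that line, and translations
along the line fix its ends. -/
lemma isEigen_of_orthogonal {A : Mob} {e : LVec} (t : ℝ) (h0 : lq e e = 0)
    (h : lq (nrm A) e = 0) : IsEigen (A * trans t * A⁻¹) e := by
  obtain ⟨v, rfl⟩ : ∃ v, e = mobLin A v := ⟨_, (mobLin_apply_inv A e).symm⟩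
  rw [lq_mobLin] at h0
  rw [nrm, lq_mobLin] at h
  obtain ⟨l, m, k⟩ := v
  simp [lq] at h h0
  subst h
  simp only [IsEigen, mobLin_mul_apply, mobLin_inv_apply, mobLin_trans, ← map_smul]
  have : l = 0 ∨ k = 0 := by rw [← mul_eq_zero]; linarith
  rcases this with rfl | rfl
  · exact ⟨Real.exp t, by simp⟩
  · exact ⟨Real.exp (-t), by simp⟩

/-- Conversely, a nontrivial translation fixes no other points at infinity. -/
lemma orthogonal_of_isEigen {A : Mob} {e : LVec} {t : ℝ} (ht : t ≠ 0) (h0 : lq e e = 0)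
    (h : IsEigen (A * trans t * A⁻¹) e) : lq (nrm A) e = 0 := by
  obtain ⟨v, rfl⟩ : ∃ v, e = mobLin A v := ⟨_, (mobLin_apply_inv A e).symm⟩
  rw [lq_mobLin] at h0
  rw [nrm, lq_mobLin]
  obtain ⟨l, m, k⟩ := v
  obtain ⟨c, hc⟩ := h
  rw [mobLin_mul_apply, mobLin_mul_apply, mobLin_inv_apply, ← map_smul] at hc
  have hc' := congrArg (mobLin A⁻¹) hc
  rw [mobLin_inv_apply, mobLin_inv_apply, mobLin_trans] at hc'
  simp at hc'
  simp [lq] at h0 ⊢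
  by_contra hm
  have hc1 : c = 1 := by
    have := hc'.2.1; field_simp at this; linarith
  rw [hc1] at hc'
  have hl : l = 0 := by simpa [ht] using hc'.1
  rw [hl] at h0; apply hm; nlinarith

namespace Pants

variable {Γ : Subgroup Mob}

lemma prod_mob (P : Pants Γ) : ((P.cuff 0).elt : Mob) * (P.cuff 1).elt * (P.cuff 2).elt = 1 := by
  exact_mod_cast congrArg Subtype.val P.prod_eq_one

/-- The cuffs of a pair of pants have no common points at infinity. -/
lemma lq_nrm_lt (P : Pants Γ) {i j : Fin 3} (hij : i ≠ j) :
    lq (nrm (P.cuff i).axis) (nrm (P.cuff j).axis) < -1 := by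
  have hle : ∀ i j, i ≠ j → lq (nrm (P.cuff i).axis) (nrm (P.cuff j).axis) ≤ -1 :=
    fun i j hij => (mutual_right (P.right i j hij) (P.right j i hij.symm)).1
  refine lt_of_le_of_ne (hle i j hij) fun heq => ?_
  -- In the case of equality this sum is isotropic: it is the common end of the two axes. Both
  -- elements fix it, hence so does the third, the product of the three being one. It is then
  -- orthogonal to the third normal, although its product with that normal is at most -2.
  set e := nrm (P.cuff i).axis + nrm (P.cuff j).axis with he
  have e0 : lq e e = 0 := by
    rw [he, lq_add_left, lq_add_right, lq_add_right, lq_nrm_self, lq_nrm_self,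
      lq_comm (nrm (P.cuff j).axis), heq]; ring
  have hi : IsEigen (P.cuff i).elt e := by
    rw [ClosedGeodesic.elt_eq]
    exact isEigen_of_orthogonal _ e0 (by rw [he, lq_add_right, lq_nrm_self, heq]; ring)
  have hj : IsEigen (P.cuff j).elt e := by
    rw [ClosedGeodesic.elt_eq]
    exact isEigen_of_orthogonal _ e0 (by
      rw [he, lq_add_right, lq_nrm_self, lq_comm (nrm (P.cuff j).axis), heq]; ring)
  have hp := P.prod_mob
  have h2 : ((P.cuff 2).elt : Mob) = (((P.cuff 0).elt : Mob) * (P.cuff 1).elt)⁻¹ :=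
    eq_inv_of_mul_eq_one_right hp
  have h0 : ((P.cuff 0).elt : Mob) = (((P.cuff 1).elt : Mob) * (P.cuff 2).elt)⁻¹ :=
    eq_inv_of_mul_eq_one_left (by rw [← mul_assoc]; exact hp)
  have h1 : ((P.cuff 1).elt : Mob) = (((P.cuff 2).elt : Mob) * (P.cuff 0).elt)⁻¹ := by
    rw [h2]; group
  have hall : ∀ k, IsEigen (P.cuff k).elt e := by
    intro k
    have : ∀ k : Fin 3, k = i ∨ k = j ∨ ((i = k + 1 ∧ j = k + 2) ∨ (i = k + 2 ∧ j = k + 1)) := by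
      clear_value e; clear * - hij; revert i j; decide
    rcases this k with rfl | rfl | hk
    · exact hi
    · exact hj
    · have h12 : IsEigen (P.cuff (k + 1)).elt e ∧ IsEigen (P.cuff (k + 2)).elt e := by
        rcases hk with ⟨rfl, rfl⟩ | ⟨rfl, rfl⟩
        exacts [⟨hi, hj⟩, ⟨hj, hi⟩]
      fin_cases k
      · exact h0 ▸ (h12.1.mul h12.2).inv
      · exact h1 ▸ (h12.1.mul h12.2).inv
      · exact h2 ▸ (h12.1.mul h12.2).inv
  obtain ⟨k, hk1, hk2⟩ : ∃ k : Fin 3, k ≠ i ∧ k ≠ j := by clear * - hij; revert i j; decide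
  have h := hall k
  rw [ClosedGeodesic.elt_eq] at h
  have := orthogonal_of_isEigen (P.cuff k).len_pos.ne' e0 h
  rw [he, lq_add_right] at this
  linarith [hle k i hk1, hle k j hk2]

lemma exists_hexagon (P : Pants Γ) : ∃ b, Hexagon (fun i => nrm (P.cuff i).axis) b :=
  exists_hexagon_aux (fun _ => lq_nrm_self _) (fun _ _ hij => P.lq_nrm_lt hij) fun i j hij =>
    (mutual_right (P.right i j hij) (P.right j i hij.symm)).2 (P.lq_nrm_lt hij)

/-- The common perpendiculars of the cuffs. -/
def seam (P : Pants Γ) : Fin 3 → LVec := P.exists_hexagon.choose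

lemma hexagon (P : Pants Γ) : Hexagon (fun i => nrm (P.cuff i).axis) P.seam :=
  P.exists_hexagon.choose_spec

end Pants

/-! ### Cuffs as products of reflections in seams -/

/-- A translation is the product of two reflections in lines perpendicular to its axis. -/
lemma exists_refl_eq_trans {A : Mob} {b : LVec} (hb : lq b b = 1) (h : lq b (nrm A) = 0)
    (t : ℝ) : ∃ (a : LVec) (ha : lq a a = 1), lq a (nrm A) = 0 ∧
      ∀ z, refl a ha z = (A * trans t * A⁻¹) • refl b hb z := by
  -- A reflection in a perpendicular of the axis inverts the translations along it.
  have hconj : ∀ (s : ℝ) v, reflLin b (mobLin (A * trans s * A⁻¹) v) =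
      mobLin (A * trans (-s) * A⁻¹) (reflLin b v) := by
    intro s v
    obtain ⟨b, rfl⟩ : ∃ v, b = mobLin A v := ⟨_, (mobLin_apply_inv A b).symm⟩
    obtain ⟨v, rfl⟩ : ∃ w, v = mobLin A w := ⟨_, (mobLin_apply_inv A v).symm⟩
    rw [lq_mobLin] at hb
    rw [nrm, lq_mobLin] at h
    obtain ⟨l, m, k⟩ := b
    obtain ⟨p, q, r⟩ := v
    simp [lq] at h hb
    subst h
    have e1 : ∀ w, reflLin (mobLin A (l, 0, k)) (mobLin A w) = mobLin A (reflLin (l, 0, k) w) :=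
      fun w => by rw [reflLin_apply, reflLin_apply, lq_mobLin, map_sub, map_smul]
    simp only [mobLin_mul_apply, mobLin_inv_apply, e1]
    congr 1
    simp only [mobLin_trans, reflLin_apply, lq, neg_neg]
    refine Prod.ext ?_ (Prod.ext ?_ ?_)
    · simp
      linear_combination (-Real.exp (-s) * p + Real.exp s * p) * hb
    · simp
    · simp
      linear_combination (-Real.exp s * r + Real.exp (-s) * r) * hb
  -- Conjugating the reflection by the translation through half the distance, and moving the inverse
  -- across it, gives the full translation times the reflection.
  set g := A * trans (t / 2) * A⁻¹ with hg
  have hg' : A * trans (-(t / 2)) * A⁻¹ = g⁻¹ := by rw [hg, trans_neg]; group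
  have ha : lq (mobLin g b) (mobLin g b) = 1 := by rw [lq_mobLin, hb]
  refine ⟨mobLin g b, ha, ?_, fun z => vec_injective ?_⟩
  · rw [lq_mobLin_left, ← nrm_mul, ← hg', inv_mul_cancel_right, nrm_trans, h]
  · have h2 : A * trans t * A⁻¹ = g * g := by
      rw [hg]; nth_rewrite 1 [← add_halves t]; rw [trans_add]; group
    have e1 : ∀ w, reflLin (mobLin g b) (mobLin g w) = mobLin g (reflLin b w) :=
      fun w => by rw [reflLin_apply, reflLin_apply, lq_mobLin, map_sub, map_smul]
    have h3 := hconj (-(t / 2)) (vec z)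
    rw [neg_neg, hg', ← hg] at h3
    rw [vec_refl, vec_smul, vec_refl, h2, mobLin_mul_apply g g, ← h3]
    rw [← e1, mobLin_apply_inv]

lemma refl_eq_of_eq_or_neg {a b : LVec} (ha : lq a a = 1) (hb : lq b b = 1)
    (h : a = b ∨ a = -b) : refl a ha = refl b hb := by
  refine Equiv.ext fun z => vec_injective ?_
  rw [vec_refl, vec_refl]
  rcases h with rfl | rfl
  · rfl
  · rw [reflLin_neg]

namespace Pants

variable {Γ : Subgroup Mob}

/-- The reflection in a common perpendicular of two cuffs. -/
def rho (P : Pants Γ) (i : Fin 3) : Equiv.Perm ℍ := refl (P.seam i) (P.hexagon.bb_self i)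

lemma rho_rho (P : Pants Γ) (i : Fin 3) (z : ℍ) : P.rho i (P.rho i z) = z := refl_refl _ z

/-- The cuffs are products of reflections in the common perpendiculars. -/
lemma elt_smul (P : Pants Γ) (k : Fin 3) (z : ℍ) :
    ((P.cuff k).elt : Mob) • z = P.rho (k + 1) (P.rho (k + 2) z) := by
  have H := P.hexagon
  -- The elements of cuffs 0 and 1 are written as ρ_a ρ₂ and ρ₂ ρ_b, with `a` perpendicular to cuff
  -- 0 and `b` to cuff 1. Then ρ_a ρ_b is the inverse of the third element. It remains to see that
  -- `a` and `b` are also perpendicular to cuff 2, so that they are the other two seams up to sign.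
  obtain ⟨a, ha, ha0, har⟩ := exists_refl_eq_trans (H.bb_self 2) (H.bn 2 0 (by decide))
    (P.cuff 0).len
  obtain ⟨b, hb, hb0, hbr⟩ := exists_refl_eq_trans (H.bb_self 2) (H.bn 2 1 (by decide))
    (-(P.cuff 1).len)
  have e1 : (P.cuff 1).axis * trans (-(P.cuff 1).len) * (P.cuff 1).axis⁻¹ =
      ((P.cuff 1).elt : Mob)⁻¹ := by rw [ClosedGeodesic.elt_eq, trans_neg]; group
  rw [← ClosedGeodesic.elt_eq] at har
  rw [e1] at hbr
  have hbr' : ∀ z, P.rho 2 (((P.cuff 1).elt : Mob) • z) = refl b hb z := fun z => by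
    have h1 := hbr (P.rho 2 (((P.cuff 1).elt : Mob) • z))
    have h2 : refl (P.seam 2) (H.bb_self 2) (P.rho 2 (((P.cuff 1).elt : Mob) • z)) =
      ((P.cuff 1).elt : Mob) • z := P.rho_rho 2 _
    rw [h2, inv_smul_smul] at h1
    rw [← refl_refl hb (P.rho 2 _), h1]
  have har' : ∀ z, refl a ha z = ((P.cuff 0).elt : Mob) • P.rho 2 z := har
  have hab : ∀ z, refl a ha (refl b hb z) = ((P.cuff 2).elt : Mob)⁻¹ • z := fun z => by
    rw [har', ← hbr', P.rho_rho, ← mul_smul, eq_inv_of_mul_eq_one_left P.prod_mob]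
  set n2 := nrm (P.cuff 2).axis with hn2
  have hfix : reflLin a (reflLin b n2) = n2 := by
    have h1 : reflLin a ∘ₗ reflLin b = mobLin ((P.cuff 2).elt : Mob)⁻¹ :=
      linearMap_ext_vec fun z => by
        rw [← vec_smul, ← hab, vec_refl, vec_refl]; rfl
    have h2 : mobLin ((P.cuff 2).elt : Mob)⁻¹ n2 = n2 := by
      rw [hn2, ← nrm_mul, ClosedGeodesic.elt_eq]
      have : ((P.cuff 2).axis * trans (P.cuff 2).len * (P.cuff 2).axis⁻¹)⁻¹ * (P.cuff 2).axis
        = (P.cuff 2).axis * trans (-(P.cuff 2).len) := by rw [trans_neg]; group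
      rw [this, nrm_trans]
    exact (congrArg (fun f : LVec →ₗ[ℝ] LVec => f n2) h1).trans h2
  -- Both reflections move `n2` in the same way. If they moved it at all, they would coincide and
  -- the third cuff element would be trivial.
  have heq : lq b n2 • b = lq a n2 • a := by
    have h1 : reflLin b n2 = reflLin a n2 := by rw [← hfix, reflLin_reflLin ha, hfix]
    rw [reflLin_apply, reflLin_apply, sub_right_inj, mul_smul, mul_smul] at h1
    exact (smul_right_injective LVec (two_ne_zero' ℝ)) h1
  have ha2 : lq a n2 = 0 := by
    by_contra h0
    have h1 : a = (lq b n2 / lq a n2) • b := by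
      rw [div_eq_inv_mul, mul_smul, heq, smul_smul, inv_mul_cancel₀ h0, one_smul]
    have h2 := ha
    rw [h1, lq_smul_left, lq_smul_right, hb, mul_one] at h2
    have h3 : a = b ∨ a = -b := by
      rcases mul_self_eq_one_iff.1 h2 with h3 | h3 <;> rw [h3] at h1
      · left; simpa using h1
      · right; simpa using h1
    have h4 : ((P.cuff 2).elt : Mob)⁻¹ = 1 := Mob.ext fun z => by
      rw [← hab, refl_eq_of_eq_or_neg ha hb h3, refl_refl, one_smul]
    rw [inv_eq_one, ClosedGeodesic.elt_eq, mul_inv_eq_one, mul_eq_left, ← trans_zero] at h4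
    exact (P.cuff 2).len_pos.ne' (trans_injective h4)
  have hb2 : lq b n2 = 0 := by
    rw [ha2, zero_smul] at heq
    have := congrArg (lq b) heq
    rw [lq_smul_right, hb, mul_one] at this
    rw [this]; simp [lq]
  have hra : refl a ha = P.rho 1 := refl_eq_of_eq_or_neg _ _ (H.eq_or_eq_neg ha fun j hj => by
    fin_cases j
    · exact ha0
    · exact absurd rfl hj
    · exact ha2)
  have hrb : refl b hb = P.rho 0 := refl_eq_of_eq_or_neg _ _ (H.eq_or_eq_neg hb fun j hj => by
    fin_cases j
    · exact absurd rfl hj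
    · exact hb0
    · exact hb2)
  rw [hra] at har' hab
  rw [hrb] at hbr' hab
  fin_cases k
  · change ((P.cuff 0).elt : Mob) • z = P.rho 1 (P.rho 2 z)
    rw [har', P.rho_rho]
  · change ((P.cuff 1).elt : Mob) • z = P.rho 2 (P.rho 0 z)
    rw [← hbr', P.rho_rho]
  · change _ = P.rho 0 (P.rho 1 z)
    have := hab (P.rho 0 (P.rho 1 z))
    rw [P.rho_rho, P.rho_rho, eq_inv_smul_iff] at this
    exact this

end Pants

/-! ## The reflection group of a pair of pants -/

lemma continuous_lq_vec (v : LVec) : Continuous fun z : ℍ => lq v (vec z) := by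
  simp only [lq_vec]
  refine Continuous.div ?_ UpperHalfPlane.continuous_im fun z => z.im_ne_zero
  have h1 := UpperHalfPlane.continuous_re
  have h2 := UpperHalfPlane.continuous_im
  fun_prop

/-- A point and its mirror image give opposite values, and the plane is connected. -/
lemma exists_lq_vec_eq_zero {n : LVec} (hn : lq n n = 1) : ∃ z : ℍ, lq n (vec z) = 0 := by
  have h : lq n (vec (refl n hn UpperHalfPlane.I)) = -lq n (vec UpperHalfPlane.I) := by
    rw [lq_vec_refl, hn]; ring
  rcases le_total 0 (lq n (vec UpperHalfPlane.I)) with h0 | h0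
  · exact mem_range_of_exists_le_of_exists_ge (continuous_lq_vec n) ⟨_, by rw [h]; linarith⟩ ⟨_, h0⟩
  · exact mem_range_of_exists_le_of_exists_ge (continuous_lq_vec n) ⟨_, h0⟩ ⟨_, by rw [h]; linarith⟩

lemma ldet_slLin (M : SL(2, ℝ)) (u v w : LVec) :
    ldet (slLin M u) (slLin M v) (slLin M w) = ldet u v w := by
  have h : ldet (slLin M u) (slLin M v) (slLin M w) =
      (M 0 0 * M 1 1 - M 0 1 * M 1 0) ^ 3 * ldet u v w := by
    simp only [ldet, slLin_apply]; ring
  rw [h, sl_det]; ring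

lemma ldet_reflLin {n : LVec} (hn : lq n n = 1) (u v w : LVec) :
    ldet (reflLin n u) (reflLin n v) (reflLin n w) = -ldet u v w := by
  have h : ldet (reflLin n u) (reflLin n v) (reflLin n w) = (1 - 2 * lq n n) * ldet u v w := by
    simp only [ldet, reflLin_apply, lq, Prod.fst_sub, Prod.snd_sub, Prod.smul_fst, Prod.smul_snd,
      smul_eq_mul]
    ring
  rw [h, hn]; ring

/-- A reflection does not preserve the orientation. -/
lemma smul_ne_refl {n : LVec} (hn : lq n n = 1) (g : Mob) : ¬ ∀ z, g • z = refl n hn z := by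
  intro h
  have h1 : mobLin g = reflLin n := linearMap_ext_vec fun z => by rw [← vec_smul, h, vec_refl]
  have h2 := ldet_reflLin hn (1, 0, 0) (0, 1, 0) (0, 0, 1)
  rw [← h1, mobLin, ldet_slLin] at h2
  norm_num [ldet] at h2

namespace Pants

variable {Γ : Subgroup Mob} (P : Pants Γ)

/-- The position of a point with respect to a common perpendicular. -/
def fseam (i : Fin 3) (z : ℍ) : ℝ := lq (P.seam i) (vec z)

/-- The position of a point with respect to a cuff. -/
def fcuff (i : Fin 3) (z : ℍ) : ℝ := lq (nrm (P.cuff i).axis) (vec z)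

lemma fseam_rho (i : Fin 3) (z : ℍ) : P.fseam i (P.rho i z) = -P.fseam i z := by
  rw [fseam, rho, lq_vec_refl, P.hexagon.bb_self, fseam]; ring

lemma fcuff_rho {i j : Fin 3} (hij : i ≠ j) (z : ℍ) : P.fcuff j (P.rho i z) = P.fcuff j z := by
  rw [fcuff, rho, lq_vec_refl, lq_comm (nrm _) (P.seam i), P.hexagon.bn i j hij, fcuff]; ring

lemma exists_delta : ∃ δ > 0,
    (∀ i j, i ≠ j → ∀ z w, P.fcuff i z ≤ 0 → P.fcuff j w ≤ 0 → δ ≤ dist z w) ∧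
    (∀ i j, i ≠ j → ∀ z w, P.fseam i z ≤ 0 → P.fseam j w ≤ 0 → δ ≤ dist z w) ∧
    (∀ i, ∀ z w, P.fcuff i z ≤ 0 → P.fseam i w ≤ 0 → δ ≤ dist z w) :=
  P.hexagon.exists_separation

lemma fseam_pos {i j : Fin 3} (hij : i ≠ j) {z : ℍ} (h : P.fseam i z ≤ 0) : 0 < P.fseam j z := by
  obtain ⟨δ, hδ, -, h2, -⟩ := P.exists_delta
  by_contra hc
  have := h2 i j hij z z h (not_lt.1 hc)
  rw [dist_self] at this; linarith

lemma fseam_pos_of_fcuff {i : Fin 3} {z : ℍ} (h : P.fcuff i z ≤ 0) : 0 < P.fseam i z := by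
  obtain ⟨δ, hδ, -, -, h3⟩ := P.exists_delta
  by_contra hc
  have := h3 i z z h (not_lt.1 hc)
  rw [dist_self] at this; linarith

/-- The fundamental domain of the reflection group. -/
def dom : Set ℍ := {z | ∀ i, 0 ≤ P.fseam i z}

/-- Products of reflections. -/
def word (l : List (Fin 3)) : Equiv.Perm ℍ := (l.map P.rho).prod

lemma word_nil (z : ℍ) : P.word [] z = z := rfl

lemma word_cons (i : Fin 3) (l : List (Fin 3)) (z : ℍ) :
    P.word (i :: l) z = P.rho i (P.word l z) := by
  simp [word]

lemma word_append (l l' : List (Fin 3)) (z : ℍ) :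
    P.word (l ++ l') z = P.word l (P.word l' z) := by
  simp [word]

lemma word_reverse (l : List (Fin 3)) (z : ℍ) : P.word l.reverse (P.word l z) = z := by
  induction l generalizing z with
  | nil => rfl
  | cons i l ih => rw [List.reverse_cons, word_append, word_cons, word_cons, word_nil, rho_rho, ih]

lemma word_reverse' (l : List (Fin 3)) (z : ℍ) : P.word l (P.word l.reverse z) = z := by
  simpa using P.word_reverse l.reverse z

lemma dist_rho (i : Fin 3) (z w : ℍ) : dist (P.rho i z) (P.rho i w) = dist z w := dist_refl _ z w

lemma dist_word (l : List (Fin 3)) (z w : ℍ) : dist (P.word l z) (P.word l w) = dist z w := by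
  induction l with
  | nil => rfl
  | cons i l ih => rw [word_cons, word_cons, dist_rho, ih]

lemma exists_reduced (l : List (Fin 3)) :
    ∃ l', l'.IsChain (· ≠ ·) ∧ ∀ z, P.word l' z = P.word l z := by
  induction l with
  | nil => exact ⟨[], List.isChain_nil, fun _ => rfl⟩
  | cons i l ih =>
    obtain ⟨l', h1, h2⟩ := ih
    cases l' with
    | nil => exact ⟨[i], List.isChain_singleton _, fun z => by rw [word_cons, h2, word_cons]⟩
    | cons j l'' =>
      by_cases hij : i = j
      · subst hij
        refine ⟨l'', h1.tail, fun z => ?_⟩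
        rw [word_cons, ← h2, word_cons, rho_rho]
      · exact ⟨i :: j :: l'', List.isChain_cons_cons.2 ⟨hij, h1⟩, fun z => by
          rw [word_cons, h2, word_cons]⟩

/-- Ping-pong: a reduced word beginning with `j` maps the domain beyond the seam `j`, and the
half-planes beyond different seams are disjoint. -/
lemma fseam_word {i : Fin 3} {l : List (Fin 3)} (hl : (i :: l).IsChain (· ≠ ·)) {z : ℍ}
    (hz : z ∈ P.dom) : 0 ≤ P.fseam i (P.word l z) := by
  induction l generalizing i with
  | nil => exact hz i
  | cons j l ih =>
    obtain ⟨hij, hl⟩ := List.isChain_cons_cons.1 hl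
    refine (P.fseam_pos hij.symm ?_).le
    rw [word_cons, fseam_rho]
    linarith [ih hl]

lemma fseam_word_cons {i : Fin 3} {l : List (Fin 3)} (hl : (i :: l).IsChain (· ≠ ·)) {z : ℍ}
    (hz : z ∈ P.dom) : P.fseam i (P.word (i :: l) z) ≤ 0 := by
  rw [word_cons, fseam_rho]
  linarith [P.fseam_word hl hz]

/-- The union of the translates of the domain contains the δ-ball around each of its points, hence
is open and closed: a point at distance less than δ from the domain can be outside one seam only,
and reflecting in it brings the point back. -/
lemma exists_word (z : ℍ) : ∃ l, ∃ y ∈ P.dom, z = P.word l y := by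
  obtain ⟨δ, hδ, -, h2, -⟩ := P.exists_delta
  set U : Set ℍ := {z | ∃ l, ∃ y ∈ P.dom, z = P.word l y} with hU
  have key : ∀ z ∈ U, ∀ w, dist z w < δ → w ∈ U := by
    rintro _ ⟨l, y, hy, rfl⟩ w hw
    obtain ⟨x, rfl⟩ : ∃ x, w = P.word l x := ⟨_, (P.word_reverse' l w).symm⟩
    rw [dist_word] at hw
    by_cases hx : x ∈ P.dom
    · exact ⟨l, x, hx, rfl⟩
    · simp only [dom, mem_ofPred_eq, not_forall, not_le] at hx
      obtain ⟨i, hi⟩ := hx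
      refine ⟨l ++ [i], P.rho i x, fun j => ?_, by
        rw [word_append, word_cons, word_nil, rho_rho]⟩
      by_contra hj
      push Not at hj
      have hij : i ≠ j := by
        rintro rfl; rw [fseam_rho] at hj; linarith
      have := h2 i j hij (P.rho i y) (P.rho i x) (by rw [fseam_rho]; linarith [hy i]) hj.le
      rw [dist_rho] at this
      linarith
  have hne : U.Nonempty := by
    obtain ⟨z, hz⟩ := exists_lq_vec_eq_zero (P.hexagon.bb_self 0)
    refine ⟨z, [], z, fun i => ?_, rfl⟩
    rcases eq_or_ne 0 i with rfl | hi
    · exact hz.ge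
    · exact (P.fseam_pos hi hz.le).le
  have hclopen : IsClopen U := by
    constructor
    · rw [← isOpen_compl_iff, Metric.isOpen_iff]
      refine fun z hz => ⟨δ, hδ, fun w hw hwU => hz (key w hwU z ?_)⟩
      exact hw
    · rw [Metric.isOpen_iff]
      refine fun z hz => ⟨δ, hδ, fun w hw => key z hz w ?_⟩
      rw [dist_comm]; exact hw
  have := hclopen.eq_univ hne
  have hz : z ∈ U := by rw [this]; trivial
  exact hz

/-- A point beyond the cuff `k` is strictly inside the seam `k`, so a reduced word leading to it
cannot begin with `k`. The other two reflections preserve the cuff, so the first letter can be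
removed and the argument repeated. -/
lemma exists_word_of_fcuff {k : Fin 3} {z : ℍ} (hz : P.fcuff k z ≤ 0) :
    ∃ l : List (Fin 3), (∀ i ∈ l, i ≠ k) ∧ ∃ y ∈ P.dom, P.fcuff k y ≤ 0 ∧ z = P.word l y := by
  obtain ⟨l, y, hy, rfl⟩ := P.exists_word z
  obtain ⟨l', hl', h⟩ := P.exists_reduced l
  rw [← h] at hz ⊢
  refine ⟨l', ?_, y, hy, ?_⟩
  · clear h
    induction l' with
    | nil => simp
    | cons i l' ih =>
      have hik : i ≠ k := by
        rintro rfl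
        have h1 := P.fseam_word_cons hl' hy
        have h2 := P.fseam_pos_of_fcuff hz
        linarith
      rw [word_cons, P.fcuff_rho hik] at hz
      exact List.forall_mem_cons.2 ⟨hik, ih hz hl'.tail⟩
  · clear h
    induction l' with
    | nil => exact ⟨hz, rfl⟩
    | cons i l' ih =>
      have hik : i ≠ k := by
        rintro rfl
        have h1 := P.fseam_word_cons hl' hy
        have h2 := P.fseam_pos_of_fcuff hz
        linarith
      rw [word_cons, P.fcuff_rho hik] at hz
      exact ⟨(ih hz hl'.tail).1, rfl⟩

/-- If the first letter is not `k`, dropping it does not increase the distance, by `dist_refl_le`.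
If it is `k`, the image of `y` lies beyond the seam `k`, which is far from the half-plane beyond the
cuff `k`. When no letters are left, the two cuffs are compared directly. -/
lemma separation_word {δ : ℝ}
    (h1 : ∀ i j, i ≠ j → ∀ z w, P.fcuff i z ≤ 0 → P.fcuff j w ≤ 0 → δ ≤ dist z w)
    (h3 : ∀ i, ∀ z w, P.fcuff i z ≤ 0 → P.fseam i w ≤ 0 → δ ≤ dist z w)
    {k l : Fin 3} (x : List (Fin 3)) {z y : ℍ} (hz : z ∈ P.dom) (hy : y ∈ P.dom)
    (hzk : P.fcuff k z ≤ 0) (hyl : P.fcuff l y ≤ 0) :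
    (k = l ∧ ∃ x' : List (Fin 3), (∀ i ∈ x', i ≠ k) ∧ ∀ w, P.word x w = P.word x' w) ∨
      δ ≤ dist z (P.word x y) := by
  obtain ⟨x, hx, h⟩ : ∃ x', x'.IsChain (· ≠ ·) ∧ ∀ z, P.word x z = P.word x' z := by
    obtain ⟨x', hx', h⟩ := P.exists_reduced x
    exact ⟨x', hx', fun z => (h z).symm⟩
  simp only [h]
  clear h
  induction x with
  | nil =>
    by_cases hkl : k = l
    · exact Or.inl ⟨hkl, [], by simp, fun _ => rfl⟩
    · exact Or.inr (h1 k l hkl z y hzk hyl)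
  | cons i x ih =>
    have h4 := P.fseam_word_cons hx hy
    by_cases hik : i = k
    · subst hik
      exact Or.inr (h3 i z _ hzk h4)
    · rcases ih hx.tail with ⟨hkl, x', hx', he⟩ | hd
      · refine Or.inl ⟨hkl, i :: x', List.forall_mem_cons.2 ⟨hik, hx'⟩, fun w => ?_⟩
        rw [word_cons, word_cons, he]
      · refine Or.inr (hd.trans ?_)
        have := dist_refl_le (P.hexagon.bb_self i) (hz i) h4
        have h5 : refl (P.seam i) (P.hexagon.bb_self i) (P.word (i :: x) y) = P.word x y := by
          rw [word_cons]; exact P.rho_rho i _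
        rwa [h5] at this

lemma exists_word_of_mem_group {c : Γ} (hc : c ∈ P.group) :
    ∃ l, ∀ z, (c : Mob) • z = P.word l z := by
  induction hc using Subgroup.closure_induction with
  | mem x hx =>
    obtain ⟨k, rfl⟩ := hx
    exact ⟨[k + 1, k + 2], fun z => by
      rw [word_cons, word_cons, word_nil]; exact P.elt_smul k z⟩
  | one => exact ⟨[], fun z => one_smul _ z⟩
  | mul x y _ _ hx hy =>
    obtain ⟨l, hl⟩ := hx
    obtain ⟨l', hl'⟩ := hy
    exact ⟨l ++ l', fun z => by rw [word_append, ← hl', ← hl, ← mul_smul]; rfl⟩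
  | inv x _ hx =>
    obtain ⟨l, hl⟩ := hx
    refine ⟨l.reverse, fun z => ?_⟩
    rw [Subgroup.coe_inv, inv_smul_eq_iff, hl, word_reverse']

lemma elt_mem_group (k : Fin 3) : (P.cuff k).elt ∈ P.group := Subgroup.subset_closure ⟨k, rfl⟩

lemma exists_mem_group_pair (i j : Fin 3) :
    ∃ c ∈ P.group, ∀ z, (c : Mob) • z = P.rho i (P.rho j z) := by
  have hcases : ∀ i j : Fin 3, i = j ∨ (∃ k, i = k + 1 ∧ j = k + 2) ∨ ∃ k, i = k + 2 ∧ j = k + 1 := by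
    decide
  rcases hcases i j with rfl | ⟨k, rfl, rfl⟩ | ⟨k, rfl, rfl⟩
  · exact ⟨1, one_mem _, fun z => by rw [rho_rho]; exact one_smul _ z⟩
  · exact ⟨_, P.elt_mem_group k, P.elt_smul k⟩
  · refine ⟨_, inv_mem (P.elt_mem_group k), fun z => ?_⟩
    rw [Subgroup.coe_inv, inv_smul_eq_iff, P.elt_smul, rho_rho, rho_rho]

/-- Letters are grouped in pairs, each of which is trivial, a cuff element or the inverse of one. -/
lemma exists_mem_group_of_even {l : List (Fin 3)} (hl : Even l.length) :
    ∃ c ∈ P.group, ∀ z, (c : Mob) • z = P.word l z := by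
  match l with
  | [] => exact ⟨1, one_mem _, fun z => one_smul _ z⟩
  | [i] => simp at hl
  | i :: j :: l =>
    obtain ⟨c, hc, h⟩ := exists_mem_group_of_even (l := l) (by
      simpa [Nat.even_add_one] using hl)
    obtain ⟨d, hd, h'⟩ := P.exists_mem_group_pair i j
    exact ⟨d * c, mul_mem hd hc, fun z => by
      rw [word_cons, word_cons, ← h, ← h', ← mul_smul]; rfl⟩

/-- The stabilizer of a cuff in the reflection group. -/
lemma word_eq_zpow {k : Fin 3} {l : List (Fin 3)} (hl : ∀ i ∈ l, i ≠ k) :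
    ∃ m : ℤ, (∀ z, P.word l z = ((P.cuff k).elt ^ m : Γ) • z) ∨
      (∀ z, P.word l z = ((P.cuff k).elt ^ m : Γ) • P.rho (k + 1) z) := by
  have hg : ∀ z, (P.cuff k).elt • z = P.rho (k + 1) (P.rho (k + 2) z) := P.elt_smul k
  have hg' : ∀ z, P.rho (k + 2) z = P.rho (k + 1) ((P.cuff k).elt • z) := fun z => by
    rw [hg, rho_rho]
  have hinv : ∀ z, P.rho (k + 1) ((P.cuff k).elt • P.rho (k + 1) z) = (P.cuff k).elt⁻¹ • z :=
    fun z => by rw [← hg', eq_inv_smul_iff, hg, rho_rho, rho_rho]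
  have hcomm : ∀ (m : ℤ) z, P.rho (k + 1) ((P.cuff k).elt ^ m • z) =
      (P.cuff k).elt ^ (-m) • P.rho (k + 1) z := by
    have hone : ∀ z, P.rho (k + 1) ((P.cuff k).elt • z) = (P.cuff k).elt⁻¹ • P.rho (k + 1) z :=
      fun z => by rw [← hinv, rho_rho]
    have hone' : ∀ z, P.rho (k + 1) ((P.cuff k).elt⁻¹ • z) = (P.cuff k).elt • P.rho (k + 1) z :=
      fun z => by rw [← inv_smul_eq_iff, ← hone, smul_inv_smul]
    intro m
    induction m using Int.induction_on with
    | zero => intro z; simp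
    | succ m ih =>
      intro z
      rw [zpow_add_one, mul_smul, ih, hone, ← mul_smul, neg_add, zpow_add, zpow_neg_one]
    | pred m ih =>
      intro z
      rw [zpow_sub_one, mul_smul, ih, hone', ← mul_smul, neg_neg, ← zpow_add_one, neg_sub,
        sub_neg_eq_add, add_comm 1]
  have hcases : ∀ i k : Fin 3, i ≠ k → i = k + 1 ∨ i = k + 2 := by decide
  induction l with
  | nil => exact ⟨0, Or.inl fun z => by simp [word_nil]⟩
  | cons i l ih =>
    obtain ⟨hik, hl⟩ := List.forall_mem_cons.1 hl
    obtain ⟨m, hm⟩ := ih hl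
    rcases hcases i k hik with rfl | rfl
    · refine ⟨-m, hm.symm.imp (fun hm z => ?_) fun hm z => ?_⟩
      · rw [word_cons, hm, hcomm, rho_rho]
      · rw [word_cons, hm, hcomm]
    · refine ⟨-(m + 1), hm.symm.imp (fun hm z => ?_) fun hm z => ?_⟩
      · rw [word_cons, hm, hg', ← mul_smul, ← zpow_one_add, hcomm, rho_rho, add_comm]
      · rw [word_cons, hm, hg', ← mul_smul, ← zpow_one_add, hcomm, add_comm]

/-- Words that avoid `k` generate a dihedral group; its reflections are excluded because `c`
preserves the orientation. -/
lemma mem_zpowers_of_word {k : Fin 3} {l : List (Fin 3)} (hl : ∀ i ∈ l, i ≠ k) {c : Γ}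
    (hc : ∀ z, (c : Mob) • z = P.word l z) : c ∈ Subgroup.zpowers (P.cuff k).elt := by
  obtain ⟨m, hm | hm⟩ := P.word_eq_zpow hl
  · refine ⟨m, Subtype.ext (Mob.ext fun z => ?_)⟩
    rw [hc, hm]; rfl
  · exfalso
    refine smul_ne_refl (P.hexagon.bb_self (k + 1)) (((P.cuff k).elt ^ m)⁻¹ * c : Γ) fun z => ?_
    have h1 : (((P.cuff k).elt ^ m)⁻¹ * c : Γ) • z = P.rho (k + 1) z := by
      rw [mul_smul, inv_smul_eq_iff, ← hm]; exact hc z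
    exact h1

/-- Distinct lifts of cuffs bound half-planes outside of the pair of pants
at a positive distance. -/
theorem exists_cuff_separation : ∃ δ > 0, ∀ c ∈ P.group, ∀ k l,
    (k = l ∧ c ∈ Subgroup.zpowers (P.cuff k).elt) ∨
    ∀ z w, P.fcuff k z ≤ 0 → P.fcuff l w ≤ 0 → δ ≤ dist z ((c : Mob) • w) := by
  obtain ⟨δ, hδ, h1, -, h3⟩ := P.exists_delta
  refine ⟨δ, hδ, fun c hc k l => or_iff_not_imp_right.2 fun hne => ?_⟩
  push Not at hne
  obtain ⟨z, w, hz, hw, hd⟩ := hne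
  obtain ⟨x, hx⟩ := P.exists_word_of_mem_group hc
  -- Both points are moved into the domain by words that preserve their cuffs, and `c` is replaced
  -- by the corresponding word between the two new points.
  obtain ⟨u, hu, z', hz', hzk, rfl⟩ := P.exists_word_of_fcuff hz
  obtain ⟨u', hu', y, hy, hyl, rfl⟩ := P.exists_word_of_fcuff hw
  rcases P.separation_word h1 h3 (u.reverse ++ (x ++ u')) hz' hy hzk hyl with ⟨hkl, x', hx', he⟩ | h
  · refine ⟨hkl, P.mem_zpowers_of_word (l := u ++ (x' ++ u'.reverse)) ?_ fun z => ?_⟩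
    · subst hkl
      simp only [List.mem_append, List.mem_reverse]
      rintro i (hi | hi | hi)
      exacts [hu i hi, hx' i hi, hu' i hi]
    · rw [word_append, word_append, ← he, word_append, word_append, word_reverse', word_reverse', hx]
  · rw [hx, ← P.dist_word u.reverse, word_reverse, ← word_append, ← word_append,
      List.append_assoc] at hd
    linarith

lemma mem_region {z : ℍ} : z ∈ P.region ↔ ∀ h ∈ P.group, ∀ k, 0 ≤ P.fcuff k ((h : Mob)⁻¹ • z) := by
  simp only [region, mem_ofPred_eq, mem_closedRightSide, fcuff, nrm_mul, lq_mobLin_left, vec_smul]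

/-- The quotient of the region of a pair of pants by its group is bounded. -/
theorem exists_region_bound : ∃ r : ℝ, ∀ z ∈ P.region, ∃ c ∈ P.group,
    dist ((c : Mob)⁻¹ • z) UpperHalfPlane.I ≤ r := by
  obtain ⟨r, hr⟩ := P.hexagon.bounded
  refine ⟨r + dist (P.rho 0 UpperHalfPlane.I) UpperHalfPlane.I, fun z hz => ?_⟩
  rw [mem_region] at hz
  obtain ⟨l, y, hy, rfl⟩ := P.exists_word z
  rcases Nat.even_or_odd l.length with hl | hl
  · obtain ⟨c, hc, h⟩ := P.exists_mem_group_of_even hl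
    refine ⟨c, hc, ?_⟩
    rw [← h, inv_smul_smul]
    refine (hr y hy fun k => ?_).trans (le_add_of_nonneg_right dist_nonneg)
    have := hz c hc k
    rwa [← h, inv_smul_smul] at this
  -- One more reflection makes an odd word even. This is why the bound allows for the mirror image
  -- of the hexagon in the seam 0 as well.
  · have hodd : ∀ j, ∃ c ∈ P.group, (c : Mob)⁻¹ • P.word l y = P.rho j y := fun j => by
      obtain ⟨c, hc, h⟩ := P.exists_mem_group_of_even (l := l ++ [j]) (by
        simpa using hl.add_one)
      exact ⟨c, hc, by rw [inv_smul_eq_iff, h, word_append, word_cons, word_nil, rho_rho]⟩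
    obtain ⟨c, hc, h⟩ := hodd 0
    refine ⟨c, hc, ?_⟩
    rw [h]
    refine (dist_triangle _ (P.rho 0 UpperHalfPlane.I) _).trans ?_
    rw [dist_rho]
    gcongr
    refine hr y hy fun k => ?_
    -- To see that `y` is inside the cuff `k`, a seam `j ≠ k` is used, since its reflection
    -- preserves that cuff.
    obtain ⟨j, hj⟩ : ∃ j : Fin 3, j ≠ k := ⟨k + 1, by revert k; decide⟩
    obtain ⟨d, hd, h'⟩ := hodd j
    have := hz d hd k
    rw [h', P.fcuff_rho hj] at this
    exact this

end Pants

/-! ## Conjugate closed geodesics -/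

namespace ClosedGeodesic

variable {Γ : Subgroup Mob}

lemma elt_mul_axis (γ : ClosedGeodesic Γ) : (γ.elt : Mob) * γ.axis = γ.axis * trans γ.len := by
  rw [elt_eq, inv_mul_cancel_right]

lemma elt_zpow_mul_axis (γ : ClosedGeodesic Γ) (m : ℤ) :
    ((γ.elt ^ m : Γ) : Mob) * γ.axis = γ.axis * trans (m * γ.len) := by
  rw [Subgroup.coe_zpow, elt_eq, conj_zpow, inv_mul_cancel_right, trans_zpow]

lemma elt_zpow_smul_geodesic (γ : ClosedGeodesic Γ) (m : ℤ) (t : ℝ) :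
    ((γ.elt ^ m : Γ) : Mob) • geodesic γ.axis t = geodesic γ.axis (t + m * γ.len) := by
  rw [← geodesic_mul, elt_zpow_mul_axis, geodesic_mul_trans]

lemma conj_eq {Λ : Subgroup Mob} (γ : ClosedGeodesic Γ) (γ' : ClosedGeodesic Λ) {h : Mob}
    (H : h * γ.elt * h⁻¹ = γ'.elt) :
    γ.len = γ'.len ∧ ∃ t, h * γ.axis = γ'.axis * trans t := by
  obtain ⟨h1, t, ht⟩ := conj_trans (C := γ'.axis⁻¹ * (h * γ.axis)) γ.len_pos γ'.len_pos (by
    have h2 : (γ'.elt : Mob) * (h * γ.axis) = h * γ.axis * trans γ.len := by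
      rw [← H, mul_assoc h γ.axis, ← γ.elt_mul_axis]; group
    rw [mul_assoc, ← h2, γ'.elt_eq]; group)
  exact ⟨h1, t, by rw [← ht]; group⟩

lemma conj_eq_inv {Λ : Subgroup Mob} (γ : ClosedGeodesic Γ) (γ' : ClosedGeodesic Λ) {h : Mob}
    (H : h * γ.elt * h⁻¹ = (γ'.elt : Mob)⁻¹) :
    γ.len = γ'.len ∧ ∃ t, h * γ.axis = γ'.axis * trans t * swap := by
  obtain ⟨h1, t, ht⟩ := conj_trans_neg (C := γ'.axis⁻¹ * (h * γ.axis)) γ.len_pos γ'.len_pos (by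
    have h2 : (γ'.elt : Mob)⁻¹ * (h * γ.axis) = h * γ.axis * trans γ.len := by
      rw [← H, mul_assoc h γ.axis, ← γ.elt_mul_axis]; group
    rw [mul_assoc, ← h2, γ'.elt_eq, trans_neg]; group)
  exact ⟨h1, t, by rw [mul_assoc, ← ht]; group⟩

/-- A closed geodesic is not homotopic to the reversed one. -/
lemma not_conj_inv (hΓ : IsClosedSurfaceGroup Γ) (γ : ClosedGeodesic Γ) (h : Γ) :
    h * γ.elt * h⁻¹ ≠ γ.elt⁻¹ := by
  intro H
  obtain ⟨-, t, ht⟩ := γ.conj_eq_inv γ (h := h) (by exact_mod_cast congrArg Subtype.val H)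
  -- An element that reverses the axis fixes a point of it. Freeness makes it trivial, and then the
  -- translation would be its own inverse.
  have h1 : h • geodesic γ.axis (t / 2) = geodesic γ.axis (t / 2) := by
    have : (h : Mob) • geodesic γ.axis (t / 2) = geodesic γ.axis (t / 2) := by
      rw [← geodesic_mul, ht, geodesic_mul_swap, geodesic_mul_trans]; congr 1; ring
    exact this
  have h2 := hΓ.free h _ h1
  rw [h2, one_mul, inv_one, mul_one, eq_inv_iff_mul_eq_one] at H
  have h3 := γ.elt_zpow_smul_geodesic 2 0
  have h4 : γ.elt ^ (2 : ℤ) = 1 := by rw [zpow_two]; exact H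
  rw [h4] at h3
  have h5 := geodesic_injective γ.axis (a₁ := 0) (by rw [← h3]; exact (one_smul Mob _).symm)
  have := γ.len_pos
  push_cast at h5
  linarith

/-- The closed geodesic with the opposite orientation. -/
def reverse (γ : ClosedGeodesic Γ) : ClosedGeodesic Γ where
  elt := γ.elt⁻¹
  axis := γ.axis * swap
  len := γ.len
  len_pos := γ.len_pos
  translate t := by
    have := γ.elt_zpow_smul_geodesic (-1) (-t)
    rw [geodesic_mul_swap, geodesic_mul_swap]
    rw [zpow_neg_one] at this
    refine Eq.trans this ?_
    congr 1; push_cast; ring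

end ClosedGeodesic

/-! ## Feet -/

/-- The centre `s₀` is where the two terms are equal. -/
lemma exists_cosh_form {α β : ℝ} (hα : 0 < α) (hβ : 0 < β) : ∃ K > 0, ∃ s₀, ∀ s : ℝ,
    α * Real.exp s + β * Real.exp (-s) = K * Real.cosh (s - s₀) := by
  have h1 : ∃ s₀ : ℝ, α * Real.exp s₀ = β * Real.exp (-s₀) := by
    refine ⟨Real.log (β / α) / 2, ?_⟩
    have : Real.exp (Real.log (β / α) / 2) ^ 2 = β / α := by
      rw [← Real.exp_nat_mul, Nat.cast_ofNat, mul_div_cancel₀ _ two_ne_zero, Real.exp_log (by positivity)]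
    rw [Real.exp_neg]
    field_simp
    rw [this]; field_simp
  obtain ⟨s₀, hs⟩ := h1
  refine ⟨2 * (α * Real.exp s₀), by positivity, s₀, fun s => ?_⟩
  have e1 : Real.exp s = Real.exp s₀ * Real.exp (s - s₀) := by rw [← Real.exp_add]; congr 1; ring
  have e2 : Real.exp (-s) = Real.exp (-s₀) * Real.exp (-(s - s₀)) := by
    rw [← Real.exp_add]; congr 1; ring
  rw [Real.cosh_eq, e1, e2]
  linear_combination -(Real.exp (-(s - s₀))) * hs

/-- The distance between points of two ultraparallel geodesics. -/
lemma exists_cosh_dist_geodesic {A B : Mob} (h : lq (nrm A) (nrm B) < -1) :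
    ∃ K > 0, ∃ L > 0, ∃ s t : ℝ, ∀ a b, Real.cosh (dist (geodesic A a) (geodesic B b)) =
      K * Real.cosh (a + b - s) + L * Real.cosh (a - b - t) := by
  obtain ⟨M, hM⟩ := mob_surjective (A⁻¹ * B)
  have hB : B = A * mob M := by rw [hM]; group
  have hd := sl_det M
  have hQ : lq (nrm A) (nrm B) = M 0 0 * M 1 1 + M 0 1 * M 1 0 := by
    rw [hB, nrm_mul, nrm, nrm, lq_mobLin, mobLin_mob, slLin_apply]; simp [lq]
  rw [hQ] at h
  have hform : ∀ a b, Real.cosh (dist (geodesic A a) (geodesic B b)) =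
      ((M 1 0 ^ 2 / 2) * Real.exp (a + b) + (M 0 1 ^ 2 / 2) * Real.exp (-(a + b))) +
      ((M 1 1 ^ 2 / 2) * Real.exp (a - b) + (M 0 0 ^ 2 / 2) * Real.exp (-(a - b))) := fun a b => by
    rw [cosh_dist_eq, vec_geodesic, vec_geodesic, hB, mobLin_mul_apply, lq_mobLin, mobLin_mob,
      slLin_apply]
    simp only [lq]
    have e1 : Real.exp (a + b) = Real.exp a * Real.exp b := Real.exp_add _ _
    have e2 : Real.exp (-(a + b)) = Real.exp (-a) * Real.exp (-b) := by
      rw [← Real.exp_add]; congr 1; ring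
    have e3 : Real.exp (a - b) = Real.exp a * Real.exp (-b) := by
      rw [← Real.exp_add]; congr 1
    have e4 : Real.exp (-(a - b)) = Real.exp (-a) * Real.exp b := by
      rw [← Real.exp_add]; congr 1; ring
    rw [e1, e2, e3, e4]; ring
  -- If ad = 0 or bc = 0, then ad - bc = 1 would give ad + bc = ±1, against ultraparallelism.
  have hne : (M 0 0 * M 1 1) * (M 0 1 * M 1 0) ≠ 0 := by
    intro h0
    rcases mul_eq_zero.1 h0 with h0 | h0 <;> rw [h0] at hd h <;> linarith
  obtain ⟨h1, h2⟩ := mul_ne_zero_iff.1 hne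
  obtain ⟨ha, hdd⟩ := mul_ne_zero_iff.1 h1
  obtain ⟨hb, hc⟩ := mul_ne_zero_iff.1 h2
  obtain ⟨K, hK, s, hs⟩ := exists_cosh_form (α := M 1 0 ^ 2 / 2) (β := M 0 1 ^ 2 / 2)
    (by positivity) (by positivity)
  obtain ⟨L, hL, t, ht⟩ := exists_cosh_form (α := M 1 1 ^ 2 / 2) (β := M 0 0 ^ 2 / 2)
    (by positivity) (by positivity)
  exact ⟨K, hK, L, hL, s, t, fun a b => by rw [hform, hs, ht]⟩

namespace Pants

variable {Γ : Subgroup Mob}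

/-- In the variables a + b and a - b the cosh of the distance is a sum of two separate hyperbolic
cosines, each with a unique minimum. The common perpendicular and its initial point are therefore
unique. -/
lemma exists_footParam (P : Pants Γ) (k : Fin 3) :
    ∃ a, ∀ x, P.IsFootPoint k x ↔ x = geodesic (P.cuff k).axis a := by
  obtain ⟨K, hK, L, hL, s, t, h⟩ := exists_cosh_dist_geodesic
    (P.lq_nrm_lt (show k ≠ k + 1 by revert k; decide))
  have hle : ∀ a b a' b', dist (geodesic (P.cuff k).axis a) (geodesic (P.cuff (k + 1)).axis b) ≤
      dist (geodesic (P.cuff k).axis a') (geodesic (P.cuff (k + 1)).axis b') ↔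
      K * Real.cosh (a + b - s) + L * Real.cosh (a - b - t) ≤
        K * Real.cosh (a' + b' - s) + L * Real.cosh (a' - b' - t) := fun a b a' b' => by
    rw [← h, ← h, Real.cosh_le_cosh, abs_of_nonneg dist_nonneg, abs_of_nonneg dist_nonneg]
  refine ⟨(s + t) / 2, fun x => ⟨?_, ?_⟩⟩
  · rintro ⟨a, b, rfl, hmin⟩
    have h1 := (hle _ _ _ _).1 (hmin ((s + t) / 2) ((s - t) / 2))
    have e1 : (s + t) / 2 + (s - t) / 2 - s = 0 := by ring
    have e2 : (s + t) / 2 - (s - t) / 2 - t = 0 := by ring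
    rw [e1, e2, Real.cosh_zero, mul_one, mul_one] at h1
    have c1 := Real.one_le_cosh (a + b - s)
    have c2 := Real.one_le_cosh (a - b - t)
    have c3 : a + b - s = 0 := by
      by_contra hne
      have := Real.one_lt_cosh.2 hne
      nlinarith
    have c4 : a - b - t = 0 := by
      by_contra hne
      have := Real.one_lt_cosh.2 hne
      nlinarith
    congr 1; linarith
  · rintro rfl
    refine ⟨(s + t) / 2, (s - t) / 2, rfl, fun a' b' => ?_⟩
    rw [hle]
    have e1 : (s + t) / 2 + (s - t) / 2 - s = 0 := by ring
    have e2 : (s + t) / 2 - (s - t) / 2 - t = 0 := by ring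
    rw [e1, e2, Real.cosh_zero]
    gcongr <;> exact Real.one_le_cosh _

/-- The position of the foot on a cuff. -/
def footParam (P : Pants Γ) (k : Fin 3) : ℝ := (P.exists_footParam k).choose

lemma isFootPoint_iff (P : Pants Γ) (k : Fin 3) (x : ℍ) :
    P.IsFootPoint k x ↔ x = geodesic (P.cuff k).axis (P.footParam k) :=
  (P.exists_footParam k).choose_spec x

end Pants

/-! ## Tilings by regions with disjoint boundary lines -/

/-- Tiles with sides in the hyperbolic plane. The side `x` lies on the tile `tile x` and is opposite
to the side `bar x`; the half-plane on the side of the tile is given by `0 ≤ val x`. -/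
structure TileSystem (X T : Type*) where
  tile : X → T
  bar : X → X
  normal : X → Mob
  δ : ℝ
  δ_pos : 0 < δ
  bar_bar : ∀ x, bar (bar x) = x
  nrm_bar : ∀ x, nrm (normal (bar x)) = -nrm (normal x)
  separated : ∀ x y, tile x = tile y →
    (nrm (normal x) = nrm (normal y) ∧ tile (bar x) = tile (bar y)) ∨
    ∀ z w, lq (nrm (normal x)) (vec z) ≤ 0 → lq (nrm (normal y)) (vec w) ≤ 0 → δ ≤ dist z w

lemma exists_lq_neg_near {A : Mob} {z : ℍ} (hz : lq (nrm A) (vec z) = 0) {ε : ℝ} (hε : 0 < ε) :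
    ∃ w, dist z w < ε ∧ lq (nrm A) (vec w) < 0 := by
  have hc : Continuous fun s : ℝ => dist (A⁻¹ • z) (s +ᵥ (A⁻¹ • z)) := by
    have : Continuous fun s : ℝ => (s +ᵥ (A⁻¹ • z) : ℍ) := by
      rw [UpperHalfPlane.isEmbedding_coe.continuous_iff]
      simp only [Function.comp_def, UpperHalfPlane.coe_vadd]
      fun_prop
    exact continuous_const.dist this
  obtain ⟨r, hr, h⟩ := Metric.continuous_iff.1 hc 0 ε hε
  have h1 := h (-(r / 2)) (by rw [Real.dist_eq, sub_zero, abs_neg, abs_of_pos (by positivity)]; linarith)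
  rw [zero_vadd, dist_self, Real.dist_eq, sub_zero, abs_of_nonneg dist_nonneg] at h1
  refine ⟨A • (-(r / 2) +ᵥ (A⁻¹ • z)), ?_, ?_⟩
  · rwa [← Mob.dist_smul A⁻¹, inv_smul_smul]
  · rw [lq_nrm_vec, div_eq_zero_iff, or_iff_left (UpperHalfPlane.im_ne_zero _)] at hz
    rw [lq_nrm_vec, inv_smul_smul]
    refine div_neg_of_neg_of_pos ?_ (UpperHalfPlane.im_pos _)
    rw [UpperHalfPlane.vadd_re, hz]; linarith

lemma exists_lq_pos_near {A : Mob} {z : ℍ} (hz : lq (nrm A) (vec z) = 0) {ε : ℝ} (hε : 0 < ε) :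
    ∃ w, dist z w < ε ∧ 0 < lq (nrm A) (vec w) := by
  obtain ⟨w, h1, h2⟩ := exists_lq_neg_near (A := A * swap) (z := z)
    (by rw [nrm_swap, lq_neg_left, hz, neg_zero]) hε
  rw [nrm_swap, lq_neg_left] at h2
  exact ⟨w, h1, by linarith⟩

namespace TileSystem

variable {X T : Type*} (S : TileSystem X T)

/-- The position of a point with respect to a side. -/
def val (x : X) (z : ℍ) : ℝ := lq (nrm (S.normal x)) (vec z)

lemma val_bar (x : X) (z : ℍ) : S.val (S.bar x) z = -S.val x z := by
  rw [val, nrm_bar, lq_neg_left, val]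

/-- The region of a tile. -/
def reg (t : T) : Set ℍ := {z | ∀ x, S.tile x = t → 0 ≤ S.val x z}

/-- Two tiles have a common side. -/
def Adj (t t' : T) : Prop := ∃ x, S.tile x = t ∧ S.tile (S.bar x) = t'

/-- Two tiles are joined by a chain of tiles. -/
def Reach : T → T → Prop := Relation.ReflTransGen S.Adj

lemma adj_symm {t t' : T} : S.Adj t t' → S.Adj t' t :=
  fun ⟨x, h1, h2⟩ => ⟨S.bar x, h2, by rw [bar_bar, h1]⟩

lemma reach_symm {t t' : T} (h : S.Reach t t') : S.Reach t' t :=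
  have : Std.Symm S.Adj := ⟨fun _ _ => S.adj_symm⟩
  Std.Symm.symm (r := Relation.ReflTransGen S.Adj) _ _ h

/-- `x` and `y` are the first and the last side that are crossed by a path without
backtracking. -/
inductive RPath : X → X → Prop
  | single (x : X) : RPath x x
  | step {x y z : X} : RPath x y → S.tile z = S.tile (S.bar y) →
    (∀ u w, S.val z u ≤ 0 → S.val (S.bar y) w ≤ 0 → S.δ ≤ dist u w) → RPath x z

/-- Along a path without backtracking the half-planes beyond the successive sides are nested. -/
lemma RPath.val_le {x y : X} (h : S.RPath x y) {z : ℍ} (hz : S.val y z ≤ 0) : S.val x z ≤ 0 := by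
  induction h with
  | single => exact hz
  | @step y w _ _ hs ih =>
    refine ih ?_
    by_contra hc
    have := hs z z hz (by rw [val_bar]; linarith)
    rw [dist_self] at this
    linarith [S.δ_pos]

/-- Cancellation of backtracking: if the next side is the one just crossed, the last step is
dropped; otherwise `separated` provides the condition for prolonging the path. -/
lemma reach_cases {t t' : T} (h : S.Reach t t') :
    t = t' ∨ ∃ x y, S.RPath x y ∧ S.tile x = t ∧ S.tile (S.bar y) = t' := by
  induction h with
  | refl => exact Or.inl rfl
  | @tail t' t'' _ hadj ih =>
    obtain ⟨z, hz, rfl⟩ := hadj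
    rcases ih with rfl | ⟨x, y, hxy, hx, hy⟩
    · exact Or.inr ⟨z, z, .single z, hz, rfl⟩
    · rcases S.separated z (S.bar y) (hz.trans hy.symm) with ⟨-, h2⟩ | h2
      · rw [bar_bar] at h2
        rw [h2]
        cases hxy with
        | single => exact Or.inl hx.symm
        | @step y' _ h3 h4 _ => exact Or.inr ⟨x, y', h3, hx, h4.symm⟩
      · exact Or.inr ⟨x, z, .step hxy (hz.trans hy.symm) h2, hx, rfl⟩

lemma val_pos_of_mem_interior {x : X} {z : ℍ} (hz : z ∈ interior (S.reg (S.tile x))) :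
    0 < S.val x z := by
  refine lt_of_le_of_ne (interior_subset hz x rfl) fun h0 => ?_
  obtain ⟨ε, hε, h⟩ := Metric.isOpen_iff.1 isOpen_interior z hz
  obtain ⟨w, h1, h2⟩ := exists_lq_neg_near h0.symm hε
  have hw : w ∈ Metric.ball z ε := by rw [Metric.mem_ball, dist_comm]; exact h1
  have := interior_subset (h hw) x rfl
  exact not_le.2 h2 this

/-- The tiles of a component have disjoint interiors. -/
lemma eq_of_mem_interior {t t' : T} (h : S.Reach t t') {z : ℍ} (hz : z ∈ interior (S.reg t))
    (hz' : z ∈ S.reg t') : t = t' := by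
  rcases S.reach_cases h with h | ⟨x, y, hxy, rfl, rfl⟩
  · exact h
  · have h1 := S.val_pos_of_mem_interior hz
    have h2 := hz' (S.bar y) rfl
    rw [val_bar] at h2
    have := hxy.val_le S (z := z) (by linarith)
    linarith

/-- The points close to a side. -/
lemma mem_reg_of_dist_lt {x : X} {z w : ℍ} (hz : S.val x z ≤ 0) (hw : 0 ≤ S.val x w)
    (hd : dist z w < S.δ) : w ∈ S.reg (S.tile x) := by
  intro y hy
  by_contra hc
  push Not at hc
  rcases S.separated x y hy.symm with ⟨h, -⟩ | h
  · rw [val, ← h] at hc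
    exact absurd hw (not_le.2 hc)
  · exact absurd (h z w hz hc.le) (not_le.2 hd)

lemma exists_val_eq_zero (x : X) : ∃ z, S.val x z = 0 := exists_lq_vec_eq_zero (lq_nrm_self _)

/-- A side determines the tile behind it in its component. -/
lemma tile_bar_eq {x y : X} (h : S.Reach (S.tile x) (S.tile y))
    (hxy : nrm (S.normal y) = -nrm (S.normal x)) : S.tile (S.bar x) = S.tile y := by
  have h1 : S.Reach (S.tile (S.bar x)) (S.tile y) :=
    (S.reach_symm (Relation.ReflTransGen.single ⟨x, rfl, rfl⟩)).trans h
  have hval : ∀ z, S.val y z = S.val (S.bar x) z := fun z => by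
    rw [val, hxy, val, nrm_bar]
  rcases S.reach_cases h1 with h2 | ⟨w, v, hwv, hw, hv⟩
  · exact h2
  · exfalso
    -- Otherwise the whole tile of `y` lies beyond the first side `w`. This includes a point `z` of
    -- the line and a point `u` just inside. But `w` and `bar x` are sides of one tile, and `bar x`
    -- lies on the line of `y` with the same orientation. If they agree, `u` is on the wrong side;
    -- if they are separated, `z` cannot be beyond both.
    have hreg : ∀ z ∈ S.reg (S.tile y), S.val w z ≤ 0 := fun z hz => by
      refine hwv.val_le S ?_
      have := hz _ hv
      rw [val_bar] at this
      linarith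
    obtain ⟨z, hz⟩ := S.exists_val_eq_zero y
    obtain ⟨u, hu1, hu2⟩ := exists_lq_pos_near hz S.δ_pos
    have hzr := hreg z (S.mem_reg_of_dist_lt hz.le hz.ge (by rw [dist_self]; exact S.δ_pos))
    have hur := hreg u (S.mem_reg_of_dist_lt hz.le hu2.le hu1)
    rcases S.separated w (S.bar x) hw with ⟨h3, -⟩ | h3
    · rw [val, h3] at hur
      have := hval u
      rw [val, val] at this
      linarith
    · have := h3 z z hzr (by rw [← val, ← hval, hz])
      rw [dist_self] at this
      linarith [S.δ_pos]

/-- The tiles of a component cover the plane. -/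
lemma exists_reach_mem {t : T} (ht : (S.reg t).Nonempty) (z : ℍ) :
    ∃ t', S.Reach t t' ∧ z ∈ S.reg t' := by
  set U : Set ℍ := {z | ∃ t', S.Reach t t' ∧ z ∈ S.reg t'} with hU
  -- A point at distance less than δ from a tile and outside of it lies in the adjacent tile across
  -- any side that it violates.
  have key : ∀ z ∈ U, ∀ w, dist z w < S.δ → w ∈ U := by
    rintro z ⟨t', ht', hz⟩ w hw
    by_cases hwt : w ∈ S.reg t'
    · exact ⟨t', ht', hwt⟩
    · simp only [reg, mem_ofPred_eq, not_forall, not_le] at hwt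
      obtain ⟨x, rfl, hx⟩ := hwt
      refine ⟨S.tile (S.bar x), ht'.tail ⟨x, rfl, rfl⟩, S.mem_reg_of_dist_lt ?_ ?_ hw⟩
      · rw [val_bar]; linarith [hz x rfl]
      · rw [val_bar]; linarith
  have hne : U.Nonempty := by
    obtain ⟨y, hy⟩ := ht
    exact ⟨y, t, .refl, hy⟩
  have hclopen : IsClopen U := by
    constructor
    · rw [← isOpen_compl_iff, Metric.isOpen_iff]
      exact fun z hz => ⟨S.δ, S.δ_pos, fun w hw hwU => hz (key w hwU z hw)⟩
    · rw [Metric.isOpen_iff]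
      exact fun z hz => ⟨S.δ, S.δ_pos, fun w hw => key z hz w (by rw [dist_comm]; exact hw)⟩
  have hz : z ∈ U := by rw [hclopen.eq_univ hne]; trivial
  exact hz

end TileSystem

variable {Γ : Subgroup Mob}

namespace Pants

/-! ## Conjugating a pair of pants into a subgroup -/

/-- The translate of a lift of a pair of pants. -/
def conj (P : Pants Γ) (c : Γ) (Λ : Subgroup Mob)
    (hΛ : ∀ x ∈ P.group, ((c * x * c⁻¹ : Γ) : Mob) ∈ Λ) : Pants Λ where
  cuff k :=
    { elt := ⟨((c * (P.cuff k).elt * c⁻¹ : Γ) : Mob), hΛ _ (P.elt_mem_group k)⟩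
      axis := (c : Mob) * (P.cuff k).axis
      len := (P.cuff k).len
      len_pos := (P.cuff k).len_pos
      translate := fun t => by
        rw [geodesic_mul, geodesic_mul, ← (P.cuff k).translate t]
        change ((c : Mob) * (P.cuff k).elt * (c : Mob)⁻¹) • (c : Mob) • geodesic _ t = _
        rw [mul_smul, inv_smul_smul, mul_smul]; rfl }
  prod_eq_one := by
    refine Subtype.ext ?_
    change ((c * (P.cuff 0).elt * c⁻¹ : Γ) : Mob) * ((c * (P.cuff 1).elt * c⁻¹ : Γ) : Mob) *
      ((c * (P.cuff 2).elt * c⁻¹ : Γ) : Mob) = 1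
    have h := P.prod_eq_one
    have h2 : (c * (P.cuff 0).elt * c⁻¹) * (c * (P.cuff 1).elt * c⁻¹) *
        (c * (P.cuff 2).elt * c⁻¹) = c * ((P.cuff 0).elt * (P.cuff 1).elt * (P.cuff 2).elt) * c⁻¹ := by
      group
    rw [h, mul_one, mul_inv_cancel] at h2
    exact_mod_cast congrArg Subtype.val h2
  right i j hij t := by
    have := P.right i j hij t
    rw [mem_rightSide] at this ⊢
    rwa [geodesic_mul, nrm_mul, vec_smul, lq_mobLin]

variable (P : Pants Γ) (c : Γ) {Λ : Subgroup Mob}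
  (hΛ : ∀ x ∈ P.group, ((c * x * c⁻¹ : Γ) : Mob) ∈ Λ)

lemma mem_conj_group {h : Λ} :
    h ∈ (P.conj c Λ hΛ).group ↔ ∃ x ∈ P.group, ((c * x * c⁻¹ : Γ) : Mob) = h := by
  have h1 : (P.conj c Λ hΛ).group.map Λ.subtype =
      (P.group.map (MulAut.conj c).toMonoidHom).map Γ.subtype := by
    rw [group, group, MonoidHom.map_closure, MonoidHom.map_closure, MonoidHom.map_closure,
      ← range_comp, ← range_comp, ← range_comp]
    rfl
  have h2 : h ∈ (P.conj c Λ hΛ).group ↔ (h : Mob) ∈ (P.conj c Λ hΛ).group.map Λ.subtype := by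
    constructor
    · exact fun hh => ⟨h, hh, rfl⟩
    · rintro ⟨h', hh, he⟩
      rwa [← Subtype.ext he]
  rw [h2, h1]
  constructor
  · rintro ⟨_, ⟨x, hx, rfl⟩, he⟩
    exact ⟨x, hx, he⟩
  · rintro ⟨x, hx, he⟩
    exact ⟨_, ⟨x, hx, rfl⟩, he⟩

lemma fcuff_conj (k : Fin 3) (z : ℍ) :
    (P.conj c Λ hΛ).fcuff k z = P.fcuff k ((c : Mob)⁻¹ • z) := by
  rw [fcuff, fcuff, vec_smul, ← lq_mobLin_left, ← nrm_mul]; rfl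

lemma mem_conj_region {z : ℍ} : z ∈ (P.conj c Λ hΛ).region ↔ (c : Mob)⁻¹ • z ∈ P.region := by
  simp only [mem_region, fcuff_conj]
  constructor
  · intro H h hh k
    have := H ⟨((c * h * c⁻¹ : Γ) : Mob), hΛ h hh⟩ ((P.mem_conj_group c hΛ).2 ⟨h, hh, rfl⟩) k
    convert this using 2
    simp only [← mul_smul]
    congr 1
    push_cast
    group
  · intro H h hh k
    obtain ⟨x, hx, he⟩ := (P.mem_conj_group c hΛ).1 hh
    have := H x hx k
    convert this using 2
    rw [← he]
    simp only [← mul_smul]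
    congr 1
    push_cast
    group

lemma isFootPoint_conj {k : Fin 3} {x : ℍ} :
    (P.conj c Λ hΛ).IsFootPoint k x ↔ x = (c : Mob) • geodesic (P.cuff k).axis (P.footParam k) := by
  have : (P.conj c Λ hΛ).IsFootPoint k x ↔ P.IsFootPoint k ((c : Mob)⁻¹ • x) := by
    have hd : ∀ k' a b, dist (geodesic ((P.conj c Λ hΛ).cuff k).axis a)
        (geodesic ((P.conj c Λ hΛ).cuff k').axis b) =
        dist (geodesic (P.cuff k).axis a) (geodesic (P.cuff k').axis b) := fun k' a b => by
      change dist (geodesic ((c : Mob) * (P.cuff k).axis) a)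
        (geodesic ((c : Mob) * (P.cuff k').axis) b) = _
      rw [geodesic_mul, geodesic_mul, Mob.dist_smul]
    simp only [IsFootPoint, hd, inv_smul_eq_iff, ← geodesic_mul]
    rfl
  rw [this, isFootPoint_iff, inv_smul_eq_iff]

lemma conj_push_same (h : Λ ≤ Γ) : ((P.conj c Λ hΛ).push h).Same P := by
  refine ⟨c⁻¹, ?_⟩
  rw [group, group, MonoidHom.map_closure, ← range_comp]
  congr 2
  funext k
  change (P.cuff k).elt = c⁻¹ * (c * (P.cuff k).elt * c⁻¹) * (c⁻¹)⁻¹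
  group

end Pants

/-! ## Gluing pairs of pants along their cuffs -/

/-- Instructions for gluing the cuffs of a family of pairs of pants in pairs. -/
structure Gluing {ι : Type*} (μ : ι → Pants Γ) where
  partner : ι × Fin 3 → ι × Fin 3
  map : ι × Fin 3 → Γ
  partner_partner : ∀ e, partner (partner e) = e
  map_partner : ∀ e, map (partner e) = (map e)⁻¹
  conj : ∀ e, map e * ((μ (partner e).1).cuff (partner e).2).elt * (map e)⁻¹ =
    ((μ e.1).cuff e.2).elt⁻¹

namespace Gluing

variable {ι : Type*} {μ : ι → Pants Γ} (G : Gluing μ)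

/-- The cuff with a given index. -/
abbrev cuffAt (μ : ι → Pants Γ) (e : ι × Fin 3) : ClosedGeodesic Γ := (μ e.1).cuff e.2

lemma conj_mob (e : ι × Fin 3) : (G.map e : Mob) * (cuffAt μ (G.partner e)).elt * (G.map e : Mob)⁻¹ =
    ((cuffAt μ e).elt : Mob)⁻¹ := by
  exact_mod_cast congrArg Subtype.val (G.conj e)

lemma conj_zpow (e : ι × Fin 3) (m : ℤ) : (cuffAt μ e).elt ^ m * G.map e =
    G.map e * (cuffAt μ (G.partner e)).elt ^ (-m) := by
  have h : (cuffAt μ e).elt = G.map e * (cuffAt μ (G.partner e)).elt⁻¹ * (G.map e)⁻¹ := by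
    rw [eq_comm, ← inv_inj, ← G.conj e]; group
  rw [h, _root_.conj_zpow, inv_mul_cancel_right, inv_zpow, zpow_neg]

lemma nrm_partner (e : ι × Fin 3) :
    nrm ((G.map e : Mob) * (cuffAt μ (G.partner e)).axis) = -nrm (cuffAt μ e).axis := by
  obtain ⟨-, t, ht⟩ := ClosedGeodesic.conj_eq_inv _ _ (G.conj_mob e)
  rw [ht, nrm_swap, nrm_trans]

lemma exists_common_delta [Finite ι] (μ : ι → Pants Γ) : ∃ δ > 0, ∀ i, ∀ c ∈ (μ i).group, ∀ k l,
    (k = l ∧ c ∈ Subgroup.zpowers ((μ i).cuff k).elt) ∨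
    ∀ z w, (μ i).fcuff k z ≤ 0 → (μ i).fcuff l w ≤ 0 → δ ≤ dist z ((c : Mob) • w) := by
  choose δ hδ h using fun i => (μ i).exists_cuff_separation
  rcases isEmpty_or_nonempty ι with hι | hι
  · exact ⟨1, one_pos, fun i => isEmptyElim i⟩
  · obtain ⟨i₀, hi₀⟩ := Finite.exists_min δ
    refine ⟨δ i₀, hδ i₀, fun i c hc k l => (h i c hc k l).imp_right fun H z w hz hw => ?_⟩
    exact (hi₀ i).trans (H z w hz hw)

/-- The tile with index `i` translated by `g`. -/
def tl (μ : ι → Pants Γ) (i : ι) (g : Γ) : Σ i, Γ ⧸ (μ i).group := ⟨i, (g : Γ ⧸ (μ i).group)⟩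

lemma exists_tl (t : Σ i, Γ ⧸ (μ i).group) : ∃ i g, t = tl μ i g := by
  obtain ⟨i, q⟩ := t
  obtain ⟨g, rfl⟩ := QuotientGroup.mk_surjective q
  exact ⟨i, g, rfl⟩

lemma tl_eq_iff {i : ι} {g g' : Γ} : tl μ i g = tl μ i g' ↔ g⁻¹ * g' ∈ (μ i).group := by
  simp only [tl, Sigma.mk.injEq, heq_eq_eq, true_and, QuotientGroup.eq]

/-- The action of the group on the tiles. -/
def act (g : Γ) (t : Σ i, Γ ⧸ (μ i).group) : Σ i, Γ ⧸ (μ i).group := ⟨t.1, g • t.2⟩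

lemma act_tl (g : Γ) (i : ι) (g' : Γ) : act g (tl μ i g') = tl μ i (g * g') := rfl

variable [Finite ι]

/-- The tiles `g • region` and their sides. -/
def tiles : TileSystem ((ι × Fin 3) × Γ) (Σ i, Γ ⧸ (μ i).group) where
  tile x := ⟨x.1.1, (x.2 : Γ ⧸ (μ x.1.1).group)⟩
  bar x := (G.partner x.1, x.2 * G.map x.1)
  normal x := (x.2 : Mob) * (cuffAt μ x.1).axis
  δ := (exists_common_delta μ).choose
  δ_pos := (exists_common_delta μ).choose_spec.1
  bar_bar x := by
    rw [G.partner_partner, G.map_partner, mul_inv_cancel_right]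
  nrm_bar x := by
    rw [Subgroup.coe_mul, mul_assoc, nrm_mul, nrm_partner, map_neg, nrm_mul]
  separated := by
    rintro ⟨⟨i, k⟩, g⟩ ⟨⟨i', l⟩, g'⟩ h
    simp only [Sigma.mk.injEq] at h
    obtain ⟨rfl, h⟩ := h
    rw [heq_eq_eq, QuotientGroup.eq] at h
    -- If the two sides differ by a power of the cuff element, they are on the same line. The tiles
    -- behind them also agree, since the gluing element carries that power to a power of the
    -- partner, which stabilizes the tile behind.
    rcases (exists_common_delta μ).choose_spec.2 i _ h k l with ⟨rfl, m, hm⟩ | H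
    · left
      obtain rfl : g' = g * ((μ i).cuff k).elt ^ m := by
        simp only at hm
        rw [hm]; group
      constructor
      · change nrm ((g : Mob) * ((μ i).cuff k).axis) =
          nrm (((g * ((μ i).cuff k).elt ^ m : Γ) : Mob) * ((μ i).cuff k).axis)
        rw [Subgroup.coe_mul, mul_assoc, ClosedGeodesic.elt_zpow_mul_axis, ← mul_assoc, nrm_trans]
      · simp only
        congr 1
        rw [QuotientGroup.eq, mul_assoc g, G.conj_zpow (i, k)]
        have : (g * G.map (i, k))⁻¹ * (g * (G.map (i, k) *
            (cuffAt μ (G.partner (i, k))).elt ^ (-m))) =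
            (cuffAt μ (G.partner (i, k))).elt ^ (-m) := by group
        rw [this]
        exact zpow_mem (Pants.elt_mem_group _ _) _
    · right
      intro z w hz hw
      simp only [nrm_mul, lq_mobLin_left, ← vec_smul] at hz hw
      have := H _ _ hz hw
      rwa [Subgroup.coe_mul, Subgroup.coe_inv, mul_smul, smul_inv_smul, Mob.dist_smul] at this

lemma tile_eq (x : (ι × Fin 3) × Γ) : G.tiles.tile x = tl μ x.1.1 x.2 := rfl

lemma mem_reg {i : ι} {g : Γ} {z : ℍ} :
    z ∈ G.tiles.reg (tl μ i g) ↔ (g : Mob)⁻¹ • z ∈ (μ i).region := by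
  have hval : ∀ k (c : Γ), G.tiles.val ((i, k), g * c) z =
      (μ i).fcuff k ((c : Mob)⁻¹ • (g : Mob)⁻¹ • z) := fun k c => by
    rw [← mul_smul, Pants.fcuff, vec_smul, ← mul_inv_rev, ← lq_mobLin_left, ← nrm_mul]; rfl
  rw [Pants.mem_region]
  constructor
  · intro H c hc k
    rw [← hval]
    refine H _ ?_
    rw [tile_eq, eq_comm, tl_eq_iff, inv_mul_cancel_left]
    exact hc
  · rintro H ⟨⟨i', k⟩, g'⟩ hx
    obtain rfl : i' = i := congrArg Sigma.fst hx
    rw [tile_eq, eq_comm, tl_eq_iff] at hx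
    have := H _ hx k
    rwa [← hval, mul_inv_cancel_left] at this

lemma reach_act (g : Γ) {t t' : Σ i, Γ ⧸ (μ i).group} (h : G.tiles.Reach t t') :
    G.tiles.Reach (act g t) (act g t') := by
  induction h with
  | refl => exact .refl
  | tail _ hadj ih =>
    obtain ⟨⟨e, g'⟩, rfl, rfl⟩ := hadj
    refine ih.tail ⟨(e, g * g'), rfl, ?_⟩
    rw [tile_eq, tile_eq, act_tl]
    change tl μ _ (g * g' * G.map e) = tl μ _ (g * (g' * G.map e))
    rw [mul_assoc]
    rfl

lemma reach_tl (g : Γ) {i j : ι} {a b : Γ} (h : G.tiles.Reach (tl μ i a) (tl μ j b)) :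
    G.tiles.Reach (tl μ i (g * a)) (tl μ j (g * b)) := G.reach_act g h

/-- The elements that preserve the component of a tile. -/
def compGroup (i : ι) : Subgroup Γ where
  carrier := {g | G.tiles.Reach (tl μ i 1) (tl μ i g)}
  one_mem' := .refl
  mul_mem' {a b} ha hb := by
    have := G.reach_tl a hb
    rw [mul_one] at this
    exact ha.trans this
  inv_mem' {a} ha := by
    have := G.reach_tl a⁻¹ ha
    rw [mul_one, inv_mul_cancel] at this
    exact G.tiles.reach_symm this

lemma mem_compGroup {i : ι} {g : Γ} :
    g ∈ G.compGroup i ↔ G.tiles.Reach (tl μ i 1) (tl μ i g) := Iff.rfl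

lemma mem_compGroup_of_reach {i j : ι} {a b : Γ} (ha : G.tiles.Reach (tl μ i 1) (tl μ j a))
    (hb : G.tiles.Reach (tl μ i 1) (tl μ j b)) : a * b⁻¹ ∈ G.compGroup i := by
  rw [mem_compGroup]
  have := G.reach_tl (a * b⁻¹) hb
  rw [mul_one, inv_mul_cancel_right] at this
  exact ha.trans (G.tiles.reach_symm this)

lemma reach_of_mem_compGroup {i j : ι} {a g : Γ} (hg : g ∈ G.compGroup i)
    (ha : G.tiles.Reach (tl μ i 1) (tl μ j a)) : G.tiles.Reach (tl μ i 1) (tl μ j (g * a)) := by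
  have := G.reach_tl g ha
  rw [mul_one] at this
  exact (G.mem_compGroup.1 hg).trans this

lemma reg_nonempty (i : ι) (g : Γ) : (G.tiles.reg (tl μ i g)).Nonempty := by
  obtain ⟨z, hz⟩ := G.tiles.exists_val_eq_zero ((i, 0), g)
  exact ⟨z, G.tiles.mem_reg_of_dist_lt (x := ((i, 0), g)) hz.le hz.ge
    (by rw [dist_self]; exact G.tiles.δ_pos)⟩

lemma finite_dist_le (hΓ : IsClosedSurfaceGroup Γ) (r : ℝ) :
    {g : Γ | dist ((g : Mob)⁻¹ • UpperHalfPlane.I) UpperHalfPlane.I ≤ r}.Finite := by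
  have := hΓ.discontinuous
  have h := ProperlyDiscontinuousSMul.finite_disjoint_inter_image (Γ := Γ)
    (K := {UpperHalfPlane.I}) (L := Metric.closedBall UpperHalfPlane.I r) isCompact_singleton
    (isCompact_closedBall _ _)
  refine (h.preimage (f := fun g : Γ => g⁻¹) inv_injective.injOn).subset fun g hg => ?_
  simp only [mem_preimage, mem_ofPred_eq] at hg ⊢
  have hne : (((fun x : ℍ => g⁻¹ • x) '' {UpperHalfPlane.I}) ∩
      Metric.closedBall UpperHalfPlane.I r).Nonempty :=
    ⟨(g : Mob)⁻¹ • UpperHalfPlane.I, ⟨_, rfl, rfl⟩, hg⟩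
  exact hne

/-- Modulo the pants group, each such tile has a representative that moves the base point a bounded
distance, by `exists_region_bound`. Proper discontinuity leaves finitely many. -/
lemma finite_tiles_at (hΓ : IsClosedSurfaceGroup Γ) :
    {t | UpperHalfPlane.I ∈ G.tiles.reg t}.Finite := by
  choose r hr using fun i => (μ i).exists_region_bound
  have : Set.Finite (⋃ i, (tl μ i) '' {g : Γ | dist ((g : Mob)⁻¹ • UpperHalfPlane.I)
      UpperHalfPlane.I ≤ r i}) := Set.finite_iUnion fun i => (finite_dist_le hΓ (r i)).image _
  refine this.subset fun t ht => ?_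
  obtain ⟨i, g, rfl⟩ := exists_tl t
  obtain ⟨c, hc, h⟩ := hr i _ (G.mem_reg.1 ht)
  refine mem_iUnion.2 ⟨i, g * c, ?_, ?_⟩
  · simp only [mem_ofPred_eq]
    rwa [Subgroup.coe_mul, mul_inv_rev, mul_smul]
  · rw [eq_comm, tl_eq_iff, inv_mul_cancel_left]
    exact hc

/-- The component of each translate of tile `i` covers the plane, so it has a tile at the base
point. Two translates with the same such tile are in one component, hence in one coset. -/
lemma finiteIndex_compGroup (hΓ : IsClosedSurfaceGroup Γ) (i : ι) :
    (G.compGroup i).FiniteIndex := by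
  have h : ∀ g : Γ, ∃ t, G.tiles.Reach (tl μ i g) t ∧ UpperHalfPlane.I ∈ G.tiles.reg t :=
    fun g => G.tiles.exists_reach_mem (G.reg_nonempty i g) _
  choose s hs hI using h
  have hfin := (G.finite_tiles_at hΓ).to_subtype
  have : Finite (Γ ⧸ G.compGroup i) := by
    refine Finite.of_injective (fun q : Γ ⧸ G.compGroup i =>
      (⟨s q.out, hI _⟩ : {t | UpperHalfPlane.I ∈ G.tiles.reg t})) fun q q' h => ?_
    have h1 : s q.out = s q'.out := congrArg Subtype.val h
    rw [← q.out_eq, ← q'.out_eq]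
    refine QuotientGroup.eq.2 ?_
    have h2 := (hs q.out).trans (G.tiles.reach_symm (h1 ▸ hs q'.out))
    have h3 := G.reach_tl (q.out)⁻¹ h2
    rwa [inv_mul_cancel] at h3
  exact Subgroup.finiteIndex_of_finite_quotient

/-- Two cuffs match up if they are lifts of the two sides of one line in a component. -/
lemma eq_of_matching {i j : ι} {a b : Γ} {k l : Fin 3}
    (h : G.tiles.Reach (tl μ i a) (tl μ j b))
    (hn : nrm ((b : Mob) * ((μ j).cuff l).axis) = -nrm ((a : Mob) * ((μ i).cuff k).axis)) :
    G.partner (i, k) = (j, l) ∧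
      ∃ m : ℤ, b = a * G.map (i, k) * ((μ j).cuff l).elt ^ m := by
  have h1 := G.tiles.tile_bar_eq (x := ((i, k), a)) (y := ((j, l), b)) h hn
  have hnn : nrm (((a * G.map (i, k) : Γ) : Mob) * (cuffAt μ (G.partner (i, k))).axis) =
      nrm ((b : Mob) * ((μ j).cuff l).axis) := by
    rw [hn]; exact G.tiles.nrm_bar ((i, k), a)
  change tl μ (G.partner (i, k)).1 (a * G.map (i, k)) = tl μ j b at h1
  generalize hp : G.partner (i, k) = p at *
  obtain ⟨j', l'⟩ := p
  obtain rfl : j' = j := congrArg Sigma.fst h1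
  rw [tl_eq_iff] at h1
  -- Two sides of one tile on the same line have a common point, so they cannot be separated and
  -- must differ by a power of the cuff element.
  rcases (exists_common_delta μ).choose_spec.2 _ _ h1 l' l with ⟨rfl, m, hm⟩ | H
  · refine ⟨rfl, m, ?_⟩
    simp only at hm
    rw [hm]; group
  · exfalso
    obtain ⟨z, hz⟩ := exists_lq_vec_eq_zero (lq_nrm_self ((b : Mob) * ((μ j').cuff l).axis))
    have e1 : (μ j').fcuff l' (((a * G.map (i, k) : Γ) : Mob)⁻¹ • z) = 0 := by
      rw [Pants.fcuff, vec_smul, ← lq_mobLin_left, ← nrm_mul, hnn, hz]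
    have e2 : (μ j').fcuff l ((b : Mob)⁻¹ • z) = 0 := by
      rw [Pants.fcuff, vec_smul, ← lq_mobLin_left, ← nrm_mul, hz]
    have := H _ _ e1.le e2.le
    rw [Subgroup.coe_mul Γ (a * G.map (i, k))⁻¹ b, Subgroup.coe_inv, mul_smul, smul_inv_smul,
      dist_self] at this
    exact absurd (exists_common_delta μ).choose_spec.1 (not_lt.2 this)

end Gluing

/-! ### The components of the glued surface and their twists -/

lemma addCircle_norm_le {p : ℝ} (x : ℝ) (n : ℤ) : ‖(x : AddCircle p)‖ ≤ |x - n * p| := by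
  have h : (x : AddCircle p) = ((x - n * p : ℝ) : AddCircle p) := by
    rw [eq_comm, ← sub_eq_zero, ← AddCircle.coe_sub, AddCircle.coe_eq_zero_iff]
    exact ⟨-n, by simp⟩
  rw [h]
  exact QuotientAddGroup.norm_mk_le_norm

variable {ι : Type*} {μ : ι → Pants Γ}

namespace Gluing

variable [Finite ι] (G : Gluing μ)

/-- Two pairs of pants lie on the same component of the glued surface. -/
def compSetoid : Setoid ι where
  r i j := ∃ g, G.tiles.Reach (tl μ i 1) (tl μ j g)
  iseqv :=
    { refl := fun _ => ⟨1, .refl⟩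
      symm := fun {i j} ⟨g, hg⟩ => ⟨g⁻¹, by
        have := G.reach_tl g⁻¹ (G.tiles.reach_symm hg)
        rwa [inv_mul_cancel, mul_one] at this⟩
      trans := fun {i j k} ⟨g, hg⟩ ⟨g', hg'⟩ => ⟨g * g', by
        have := G.reach_tl g hg'
        rw [mul_one] at this
        exact hg.trans this⟩ }

/-- The components of the glued surface. -/
def compEquiv : Quotient G.compSetoid ≃ Fin (Nat.card (Quotient G.compSetoid)) :=
  Finite.equivFin _

/-- The component of a pair of pants. -/
def comp (i : ι) : Fin (Nat.card (Quotient G.compSetoid)) := G.compEquiv ⟦i⟧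

/-- A pair of pants on a component. -/
def rep (j : Fin (Nat.card (Quotient G.compSetoid))) : ι := (G.compEquiv.symm j).out

lemma comp_eq_iff {i : ι} {j : Fin (Nat.card (Quotient G.compSetoid))} :
    G.comp i = j ↔ ∃ g, G.tiles.Reach (tl μ (G.rep j) 1) (tl μ i g) := by
  rw [comp, ← Equiv.eq_symm_apply, rep]
  conv_lhs => rw [← Quotient.out_eq (G.compEquiv.symm j), eq_comm, Quotient.eq]
  rfl

/-- The surface that results from the gluing, as a covering surface. -/
def cover (hΓ : IsClosedSurfaceGroup Γ) : FiniteCover Γ where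
  numComponents := Nat.card (Quotient G.compSetoid)
  group j := (G.compGroup (G.rep j)).map Γ.subtype
  le j := Subgroup.map_subtype_le _
  finiteIndex j := by
    have := G.finiteIndex_compGroup hΓ (G.rep j)
    refine ⟨?_⟩
    rw [Subgroup.relIndex, Subgroup.subgroupOf,
      Subgroup.comap_map_eq_self_of_injective Γ.subtype_injective]
    exact this.index_ne_zero

/-- The position of a pair of pants on its component. -/
def shift {j : Fin (Nat.card (Quotient G.compSetoid))} (a : {i // G.comp i = j}) : Γ :=
  (G.comp_eq_iff.1 a.2).choose

lemma reach_shift {j : Fin (Nat.card (Quotient G.compSetoid))} (a : {i // G.comp i = j}) :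
    G.tiles.Reach (tl μ (G.rep j) 1) (tl μ a.1 (G.shift a)) := (G.comp_eq_iff.1 a.2).choose_spec

lemma shift_conj_mem {j : Fin (Nat.card (Quotient G.compSetoid))} (a : {i // G.comp i = j}) :
    ∀ x ∈ (μ a.1).group, ((G.shift a * x * (G.shift a)⁻¹ : Γ) : Mob) ∈
      (G.compGroup (G.rep j)).map Γ.subtype := fun x hx => by
  refine ⟨_, G.mem_compGroup_of_reach (j := a.1) ?_ (G.reach_shift a), rfl⟩
  have : tl μ a.1 (G.shift a * x) = tl μ a.1 (G.shift a) := by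
    rw [eq_comm, tl_eq_iff, inv_mul_cancel_left]; exact hx
  rw [this]
  exact G.reach_shift a

/-- The pieces of the glued surface. -/
def piece (j : Fin (Nat.card (Quotient G.compSetoid))) (a : {i // G.comp i = j}) :
    Pants ((G.compGroup (G.rep j)).map Γ.subtype) :=
  (μ a.1).conj (G.shift a) _ (G.shift_conj_mem a)

lemma region_piece (j : Fin (Nat.card (Quotient G.compSetoid))) (a : {i // G.comp i = j}) :
    (G.piece j a).region = G.tiles.reg (tl μ a.1 (G.shift a)) := by
  ext z
  rw [piece, Pants.mem_conj_region, mem_reg]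

/-- Any tile of the component with index `i` differs from the one placed by `shift` by an element of
the stabilizer, so covering and disjointness are those of the tiles. -/
lemma isPantsDecomposition (j : Fin (Nat.card (Quotient G.compSetoid))) :
    IsPantsDecomposition ((G.compGroup (G.rep j)).map Γ.subtype) (G.piece j) where
  covers z := by
    obtain ⟨t, ht, hz⟩ := G.tiles.exists_reach_mem (G.reg_nonempty (G.rep j) 1) z
    obtain ⟨i, g, rfl⟩ := exists_tl t
    have hi : G.comp i = j := G.comp_eq_iff.2 ⟨g, ht⟩
    have hmem := G.mem_compGroup_of_reach (G.reach_shift ⟨i, hi⟩) ht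
    refine ⟨⟨i, hi⟩, ⟨_, ⟨_, hmem, rfl⟩⟩, ?_⟩
    rw [piece, Pants.mem_conj_region]
    rw [mem_reg] at hz
    convert hz using 1
    change (G.shift ⟨i, hi⟩ : Mob)⁻¹ • ((G.shift ⟨i, hi⟩ : Mob) * (g : Mob)⁻¹) • z = _
    rw [mul_smul, inv_smul_smul]
  disjoint := by
    rintro a b ⟨h, h', hh', rfl⟩ z hz hhz
    have hz2 := interior_subset hhz
    rw [region_piece, mem_reg] at hz2
    rw [region_piece] at hz
    have hz3 : z ∈ G.tiles.reg (tl μ b.1 (h'⁻¹ * G.shift b)) := by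
      rw [mem_reg]
      convert hz2 using 1
      change _ = (G.shift b : Mob)⁻¹ • (h' : Mob) • z
      rw [← mul_smul]
      congr 1
    have hreach := (G.tiles.reach_symm (G.reach_shift a)).trans
      (G.reach_of_mem_compGroup (inv_mem hh') (G.reach_shift b))
    have heq := G.tiles.eq_of_mem_interior hreach hz hz3
    obtain rfl : a = b := Subtype.ext (congrArg Sigma.fst heq)
    refine ⟨rfl, ?_⟩
    rw [tl_eq_iff] at heq
    rw [piece, Pants.mem_conj_group]
    refine ⟨_, inv_mem heq, ?_⟩
    change _ = (h' : Mob)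
    congr 1
    group

/-- By `eq_of_matching`, cuffs that face each other in the cover are partners in the gluing, and the
element that matches them is the prescribed one up to a power of the cuff. Such a power is invisible
in the twist parameter. -/
lemma twist_piece {ε R : ℝ} (htw : ∀ e, ∃ (b : ℝ) (n : ℤ),
      (G.map e : Mob) • geodesic (cuffAt μ (G.partner e)).axis
        ((μ (G.partner e).1).footParam (G.partner e).2) = geodesic (cuffAt μ e).axis b ∧
      |b - (μ e.1).footParam e.2 - 1 - n * (cuffAt μ e).hl| < ε / R)
    (j : Fin (Nat.card (Quotient G.compSetoid))) (a b : {i // G.comp i = j}) (k l : Fin 3) :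
    ∀ s ∈ (G.piece j a).twist k (G.piece j b) l,
      ‖s - ((1 : ℝ) : AddCircle ((G.piece j a).cuff k).hl)‖ < ε / R := by
  rintro _ ⟨⟨h, h', hh', rfl⟩, hconj, x, y, u, v, hx, hy, hxu, hyv, rfl⟩
  rw [piece, Pants.isFootPoint_conj] at hx hy
  have hnrm : nrm (((h' * G.shift b : Γ) : Mob) * ((μ b.1).cuff l).axis) =
      -nrm ((G.shift a : Mob) * ((μ a.1).cuff k).axis) := by
    obtain ⟨-, t, ht⟩ := ClosedGeodesic.conj_eq_inv ((G.piece j b).cuff l) ((G.piece j a).cuff k)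
      (h := (h' : Mob)) (congrArg Subtype.val hconj)
    change (h' : Mob) * ((G.shift b : Mob) * ((μ b.1).cuff l).axis) =
      (G.shift a : Mob) * ((μ a.1).cuff k).axis * trans t * swap at ht
    rw [Subgroup.coe_mul, mul_assoc, ht, nrm_swap, nrm_trans]
  have hreach := (G.tiles.reach_symm (G.reach_shift a)).trans
      (G.reach_of_mem_compGroup hh' (G.reach_shift b))
  obtain ⟨hp, m, hm⟩ := G.eq_of_matching hreach hnrm
  obtain ⟨w, n, hw, hlt⟩ := htw (a.1, k)
  have hz := G.conj_zpow (a.1, k) (-m)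
  rw [hp] at hw hz
  simp only [neg_neg] at hz hw hlt
  have hxu' : u = (μ a.1).footParam k := by
    rw [hx, ← geodesic_mul] at hxu
    exact (geodesic_injective _ hxu).symm
  have hyv' : v = w - m * ((μ a.1).cuff k).len := by
    have e1 : (h' : Mob) • y = geodesic ((G.piece j a).cuff k).axis v := hyv
    rw [hy, ← mul_smul, ← Subgroup.coe_mul, hm, mul_assoc, ← hz, Subgroup.coe_mul, Subgroup.coe_mul,
      mul_smul, mul_smul, hw, ClosedGeodesic.elt_zpow_smul_geodesic, ← geodesic_mul] at e1
    have := geodesic_injective _ e1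
    rw [← this]; push_cast; ring
  have hlen : ((μ a.1).cuff k).len = 2 * ((μ a.1).cuff k).hl := by
    rw [ClosedGeodesic.hl]; ring
  rw [← AddCircle.coe_sub]
  -- The power `m` moves the foot by `m` full lengths, that is, `2 * m` half lengths.
  refine (addCircle_norm_le _ (n - 2 * m)).trans_lt ?_
  refine lt_of_eq_of_lt (congrArg abs ?_) hlt
  change v - u - 1 - ((n - 2 * m : ℤ) : ℝ) * ((μ a.1).cuff k).hl = _
  rw [hxu', hyv', hlen]
  push_cast
  ring

end Gluing

/-! ## Matchings of equidistributed families on a circle -/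

/-- Two equidistributed families of finite subsets of a circle can be matched up such that the
second is close to the first, reflected and shifted by one. -/
lemma exists_injective_matching {p : ℝ} [Fact (0 < p)] {E : Type*} [Fintype E]
    {f g : E → Set (AddCircle p)} {F G : Finset E} {N : ℝ≥0∞} (hN0 : N ≠ 0) (hN : N ≠ ⊤)
    (hf : ∀ e ∉ F, f e = ∅) (hg : ∀ e ∉ G, g e = ∅) (hfN : ∀ e ∈ F, Measure.count (f e) = N)
    (hgN : ∀ e ∈ G, Measure.count (g e) = N) (hcard : F.card = G.card) {δ : ℝ} {K K' : ℝ≥0}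
    (h1 : MeasureEquivalent δ (∑ e, Measure.count.restrict (f e))
      (K • (volume : Measure (AddCircle p))))
    (h2 : MeasureEquivalent δ (∑ e, Measure.count.restrict (g e))
      (K' • (volume : Measure (AddCircle p)))) :
    ∃ φ : F → G, Function.Injective φ ∧
      ∀ e : F, ∃ s ∈ f e, ∃ t ∈ g (φ e), ‖-t - s - ((1 : ℝ) : AddCircle p)‖ < 2 * δ := by
  classical
  have hcount : ∀ {f : E → Set (AddCircle p)} {F : Finset E}, (∀ e ∉ F, f e = ∅) →
      (∀ e ∈ F, Measure.count (f e) = N) →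
      (∑ e, Measure.count.restrict (f e)) univ = F.card * N := by
    intro f F hf hfN
    simp only [Measure.coe_finsetSum, Finset.sum_apply, Measure.restrict_apply_univ]
    rw [← Finset.sum_subset (Finset.subset_univ F) fun e _ he => by rw [hf e he, measure_empty],
      Finset.sum_congr rfl hfN, Finset.sum_const, nsmul_eq_mul]
  -- Equidistribution, applied to the union of the feet in `S`, bounds the volume of its
  -- δ-neighbourhood from below.
  have hle : ∀ {f : E → Set (AddCircle p)} {F S : Finset E}, S ⊆ F →
      (∀ e ∈ F, Measure.count (f e) = N) → ∀ {K : ℝ≥0},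
      MeasureEquivalent δ (∑ e, Measure.count.restrict (f e))
      (K • (volume : Measure (AddCircle p))) →
      S.card * N ≤ K * volume (Metric.thickening δ (⋃ e ∈ S, f e)) := by
    intro f F S hS hfN K h
    have hmeas : MeasurableSet (⋃ e ∈ S, f e) := by
      refine S.measurableSet_biUnion fun e he => Set.Finite.measurableSet ?_
      exact Measure.count_apply_lt_top.1 (by rw [hfN e (hS he)]; exact hN.lt_top)
    have h3 := h.2 _ hmeas
    rw [Measure.smul_apply] at h3
    refine le_trans ?_ h3
    simp only [Measure.coe_finsetSum, Finset.sum_apply, Measure.restrict_apply hmeas]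
    calc (S.card : ℝ≥0∞) * N = ∑ e ∈ S, Measure.count (f e) := by
          rw [Finset.sum_congr rfl fun e he => hfN e (hS he), Finset.sum_const, nsmul_eq_mul]
      _ ≤ ∑ e ∈ S, Measure.count ((⋃ e ∈ S, f e) ∩ f e) := by
          refine Finset.sum_le_sum fun e he => measure_mono ?_
          exact subset_inter (Set.subset_biUnion_of_mem (u := f) he) subset_rfl
      _ ≤ _ := Finset.sum_le_sum_of_subset (Finset.subset_univ S)
  have hp : (0 : ℝ) < p := Fact.out
  have hV : (volume : Measure (AddCircle p)) univ = ENNReal.ofReal p := AddCircle.measure_univ p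
  -- Equally many cuffs give equal total masses, hence the same multiple of Lebesgue measure.
  have hKK' : (K : ℝ≥0∞) = K' := by
    have e1 := h1.1
    have e2 := h2.1
    rw [hcount hf hfN, Measure.smul_apply, hV] at e1
    rw [hcount hg hgN, ← hcard, e1, Measure.smul_apply, hV] at e2
    exact (ENNReal.mul_left_inj (by simpa using hp) ENNReal.ofReal_ne_top).1 e2
  have hsum : (K : ℝ≥0∞) * volume (univ : Set (AddCircle p)) = G.card * N := by
    have e2 := h2.1
    rw [hcount hg hgN, Measure.smul_apply] at e2
    rw [e2, hKK']; rfl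
  set t : F → Finset G := fun e => Finset.univ.filter fun e' : G =>
    ∃ s ∈ f e, ∃ t ∈ g e', ‖-t - s - ((1 : ℝ) : AddCircle p)‖ < 2 * δ with ht
  obtain ⟨φ, hφ, hφt⟩ := (Finset.all_card_le_biUnion_card_iff_exists_injective t).1 (by
    intro S
    set S' : Finset E := S.map (Function.Embedding.subtype _) with hS'
    -- The elements that are admissible for nothing in `S`. Hall's condition becomes |S| + |B| ≤
    -- |G|.
    set B : Finset G := (S.biUnion t)ᶜ with hB
    set B' : Finset E := B.map (Function.Embedding.subtype _) with hB'
    have hSF : S' ⊆ F := fun e he => by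
      obtain ⟨x, -, rfl⟩ := Finset.mem_map.1 he; exact x.2
    have hBG : B' ⊆ G := fun e he => by
      obtain ⟨x, -, rfl⟩ := Finset.mem_map.1 he; exact x.2
    have a1 := hle hSF hfN h1
    have a2 := hle hBG hgN h2
    rw [← hKK'] at a2
    set X := Metric.thickening δ (⋃ e ∈ S', f e) with hX
    set Y := Metric.thickening δ (⋃ e ∈ B', g e) with hY
    have hYo : MeasurableSet Y := Metric.isOpen_thickening.measurableSet
    -- This reflection preserves the volume, and -q - s - 1 = (x - s) + (ψ x - q). A common point
    -- `x` of the two neighbourhoods would thus yield an admissible pair between `S` and `B`.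
    set ψ : AddCircle p → AddCircle p := fun y => -((1 : ℝ) : AddCircle p) - y with hψ
    have hmp : MeasurePreserving ψ volume volume :=
      Measure.measurePreserving_sub_left volume _
    have hdisj : Disjoint X (ψ ⁻¹' Y) := by
      rw [Set.disjoint_left]
      intro x hx hy
      obtain ⟨s, hs, hsx⟩ := Metric.mem_thickening_iff.1 hx
      rw [Set.mem_preimage, hY] at hy
      obtain ⟨q, hq, hqy⟩ := Metric.mem_thickening_iff.1 hy
      obtain ⟨e, he, hse⟩ := mem_iUnion₂.1 hs
      obtain ⟨e', he', hqe⟩ := mem_iUnion₂.1 hq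
      obtain ⟨e, heS, rfl⟩ := Finset.mem_map.1 he
      obtain ⟨e', heB, rfl⟩ := Finset.mem_map.1 he'
      refine Finset.mem_compl.1 heB (Finset.mem_biUnion.2 ⟨e, heS, ?_⟩)
      refine Finset.mem_filter.2 ⟨Finset.mem_univ _, s, hse, q, hqe, ?_⟩
      rw [dist_eq_norm] at hsx hqy
      have : -q - s - ((1 : ℝ) : AddCircle p) = (x - s) + (ψ x - q) := by
        simp only [hψ]; abel
      rw [this]
      exact (norm_add_le _ _).trans_lt (by linarith)
    have hvol : volume X + volume Y ≤ volume (univ : Set (AddCircle p)) := by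
      rw [← hmp.measure_preimage hYo.nullMeasurableSet,
        ← measure_union hdisj (hmp.measurable hYo)]
      exact measure_mono (subset_univ _)
    have hfin : ((S'.card + B'.card : ℕ) : ℝ≥0∞) * N ≤ G.card * N := by
      rw [← hsum]
      push_cast
      rw [add_mul]
      refine (add_le_add a1 a2).trans ?_
      rw [← mul_add]
      gcongr
    have hfin' : S'.card + B'.card ≤ G.card := by
      rw [ENNReal.mul_le_mul_iff_left hN0 hN] at hfin
      exact_mod_cast hfin
    rw [hS', hB', Finset.card_map, Finset.card_map, hB, Finset.card_compl, Fintype.card_coe] at hfin'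
    have : (S.biUnion t).card ≤ G.card := by
      simpa using Finset.card_le_univ (S.biUnion t)
    omega)
  exact ⟨φ, hφ, fun e => (Finset.mem_filter.1 (hφt e)).2⟩

/-- An involution from bijections between opposite classes. -/
lemma exists_involution {E C H : Type*} [Group H] (cl : E → C) {inv : C → C}
    (hinv : ∀ c, inv (inv c) = c) (hne : ∀ e, inv (cl e) ≠ cl e) {W : E → E → H → Prop}
    (hW : ∀ e e' h, W e e' h → W e' e h⁻¹) {f : E → E} (hf : Function.Bijective f)
    (hcl : ∀ e, cl (f e) = inv (cl e)) (hfW : ∀ e, ∃ h, W e (f e) h) :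
    ∃ (τ : E → E) (m : E → H), (∀ e, τ (τ e) = e) ∧ (∀ e, m (τ e) = (m e)⁻¹) ∧
      ∀ e, W e (τ e) (m e) := by
  classical
  choose m hm using hfW
  set F := Equiv.ofBijective f hf with hF
  have hcl' : ∀ e, cl (F.symm e) = inv (cl e) := fun e => by
    have := hcl (F.symm e)
    rw [← hinv (cl (F.symm e)), ← this]
    congr 2
    exact (F.apply_symm_apply e)
  -- A well-ordering of the classes selects one of each two opposite ones. There the involution is
  -- `f`, on the other class the inverse of `f`.
  set pos : E → Prop := fun e => WellOrderingRel (cl e) (inv (cl e)) with hpos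
  have hpos1 : ∀ e e', cl e' = inv (cl e) → pos e → ¬ pos e' := fun e e' h h1 h2 => by
    simp only [hpos] at h1 h2
    rw [h, hinv] at h2
    exact asymm h1 h2
  have hpos2 : ∀ e e', cl e' = inv (cl e) → ¬ pos e → pos e' := fun e e' h h1 => by
    simp only [hpos] at h1 ⊢
    rw [h, hinv]
    rcases trichotomous_of WellOrderingRel (cl e) (inv (cl e)) with h2 | h2 | h2
    · exact absurd h2 h1
    · exact absurd h2.symm (hne e)
    · exact h2
  have hfF : ∀ e, F e = f e := fun _ => rfl
  refine ⟨fun e => if pos e then f e else F.symm e,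
    fun e => if pos e then m e else (m (F.symm e))⁻¹, fun e => ?_, fun e => ?_, fun e => ?_⟩
  · by_cases h : pos e
    · simp only [h, if_true, if_neg (hpos1 e _ (hcl e) h)]
      exact F.symm_apply_apply e
    · simp only [h, if_false, if_pos (hpos2 e _ (hcl' e) h)]
      exact F.apply_symm_apply e
  · by_cases h : pos e
    · simp only [h, if_true, if_neg (hpos1 e _ (hcl e) h)]
      rw [← hfF, F.symm_apply_apply]
    · simp only [h, if_false, if_pos (hpos2 e _ (hcl' e) h), inv_inv]
  · by_cases h : pos e
    · simp only [h, if_true]; exact hm e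
    · simp only [h, if_false]
      have := hW _ _ _ (hm (F.symm e))
      rwa [← hfF, F.apply_symm_apply] at this

/-! ## Counting cuffs -/

/-- The conjugacy class of the inverse. -/
def classInv : ConjClasses Γ → ConjClasses Γ :=
  Quotient.map (fun g => g⁻¹) fun a b h => by
    obtain ⟨c, hc⟩ := isConj_iff.1 h
    exact isConj_iff.2 ⟨c, by rw [← hc]; group⟩

lemma classInv_mk (g : Γ) : classInv (ConjClasses.mk g) = ConjClasses.mk g⁻¹ := rfl

lemma classInv_classInv (c : ConjClasses Γ) : classInv (classInv c) = c := by
  induction c using Quotient.inductionOn with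
  | h g => exact congrArg ConjClasses.mk (inv_inv g)

/-- The coefficients of each relation γ + γ̄ are symmetric under reversal, and this passes to the
subgroup they generate. -/
lemma apply_classInv_of_mem {f : ConjClasses Γ →₀ ℤ} (hf : f ∈ reversalRelations Γ)
    (c : ConjClasses Γ) : f (classInv c) = f c := by
  classical
  induction hf using AddSubgroup.closure_induction with
  | mem f h =>
    obtain ⟨g, rfl⟩ := h
    have e1 : ConjClasses.mk g = classInv c ↔ ConjClasses.mk g⁻¹ = c := by
      rw [← classInv_mk]
      exact ⟨fun h => by rw [h, classInv_classInv], fun h => by rw [← h, classInv_classInv]⟩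
    have e2 : ConjClasses.mk g⁻¹ = classInv c ↔ ConjClasses.mk g = c := by
      rw [← classInv_mk]
      exact ⟨fun h => by rw [← classInv_classInv (ConjClasses.mk g), h, classInv_classInv],
        fun h => by rw [h]⟩
    simp only [Finsupp.add_apply, Finsupp.single_apply, e1, e2]
    ring
  | zero => rfl
  | add x y _ _ hx hy => rw [Finsupp.add_apply, Finsupp.add_apply, hx, hy]
  | neg x _ hx => rw [Finsupp.neg_apply, Finsupp.neg_apply, hx]

open Gluing in
/-- Every oriented closed geodesic occurs as often as the reversed one. -/
lemma card_class_eq {ι : Type*} [Fintype ι] {μ : ι → Pants Γ} (heven : multiBoundary μ = 0)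
    (c : ConjClasses Γ) [DecidablePred fun e : ι × Fin 3 => ConjClasses.mk (cuffAt μ e).elt = c]
    [DecidablePred fun e : ι × Fin 3 => ConjClasses.mk (cuffAt μ e).elt = classInv c] :
    (Finset.univ.filter fun e : ι × Fin 3 => ConjClasses.mk (cuffAt μ e).elt = c).card =
    (Finset.univ.filter fun e : ι × Fin 3 => ConjClasses.mk (cuffAt μ e).elt = classInv c).card := by
  classical
  have h : ∑ e : ι × Fin 3, Finsupp.single (ConjClasses.mk (cuffAt μ e).elt) (1 : ℤ) ∈
      reversalRelations Γ := by
    rw [← QuotientAddGroup.eq_zero_iff, ← heven, multiBoundary, Fintype.sum_prod_type]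
    simp only [Pants.boundary, ClosedGeodesic.toMultiCurve]
    exact map_sum (QuotientAddGroup.mk' (reversalRelations Γ)) _ _ |>.trans
      (Finset.sum_congr rfl fun i _ => map_sum (QuotientAddGroup.mk' (reversalRelations Γ)) _ _)
  have h2 := apply_classInv_of_mem h c
  simp only [Finsupp.finsetSum_apply, Finsupp.single_apply, Finset.sum_boole] at h2
  have h3 := (Nat.cast_injective (R := ℤ) h2).symm
  convert h3

/-! ## Counting feet -/

namespace ClosedGeodesic

/-- The rotations of a closed geodesic over itself. -/
def rotations (γ : ClosedGeodesic Γ) : Set (AddCircle γ.hl) :=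
  {s | ∃ z : Γ, z * γ.elt * z⁻¹ = γ.elt ∧
    ∃ t : ℝ, (z : Mob) * γ.axis = γ.axis * trans t ∧ s = (t : AddCircle γ.hl)}

lemma zero_mem_rotations (γ : ClosedGeodesic Γ) : (0 : AddCircle γ.hl) ∈ γ.rotations :=
  ⟨1, by group, 0, by
    have := γ.elt_zpow_mul_axis 0
    rw [zpow_zero] at this
    simpa using this, rfl⟩

lemma rotations_reverse (γ : ClosedGeodesic Γ) :
    γ.reverse.rotations = (fun s : AddCircle γ.hl => -s) '' γ.rotations := by
  have h1 : ∀ z : Γ, z * γ.elt⁻¹ * z⁻¹ = γ.elt⁻¹ ↔ z * γ.elt * z⁻¹ = γ.elt := fun z => by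
    rw [← conj_inv, inv_inj]
  have h2 : ∀ (z : Γ) (t : ℝ), (z : Mob) * (γ.axis * swap) = γ.axis * swap * trans (-t) ↔
      (z : Mob) * γ.axis = γ.axis * trans t := fun z t => by
    rw [mul_assoc γ.axis, swap_mul_trans, neg_neg, ← mul_assoc, ← mul_assoc, mul_left_inj]
  ext s
  constructor
  · rintro ⟨z, hz, t, ht, rfl⟩
    refine ⟨((-t : ℝ) : AddCircle γ.hl), ⟨z, (h1 z).1 hz, -t, (h2 z (-t)).1 ?_, rfl⟩, ?_⟩
    · rw [neg_neg]; exact ht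
    · exact neg_neg (t : AddCircle γ.hl)
  · rintro ⟨_, ⟨z, hz, t, ht, rfl⟩, rfl⟩
    exact ⟨z, (h1 z).2 hz, -t, (h2 z t).2 ht, rfl⟩

lemma count_rotations_reverse (γ : ClosedGeodesic Γ) :
    Measure.count γ.reverse.rotations = Measure.count γ.rotations := by
  rw [rotations_reverse]
  exact Measure.count_injective_image (β := AddCircle γ.hl) neg_injective _

end ClosedGeodesic

namespace Pants

lemma mem_foot {P : Pants Γ} {k : Fin 3} {γ : ClosedGeodesic Γ} {s : AddCircle γ.hl} :
    s ∈ P.foot k γ ↔ ∃ h : Γ, h * (P.cuff k).elt * h⁻¹ = γ.elt ∧ ∃ b : ℝ,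
      (h : Mob) • geodesic (P.cuff k).axis (P.footParam k) = geodesic γ.axis b ∧
        s = (b : AddCircle γ.hl) := by
  constructor
  · rintro ⟨h, hh, x, b, hx, hb, rfl⟩
    rw [isFootPoint_iff] at hx
    exact ⟨h, hh, b, hx ▸ hb, rfl⟩
  · rintro ⟨h, hh, b, hb, rfl⟩
    exact ⟨h, hh, _, b, (isFootPoint_iff _ _ _).2 rfl, hb, rfl⟩

lemma foot_eq_empty {P : Pants Γ} {k : Fin 3} {γ : ClosedGeodesic Γ}
    (h : ¬ IsConj (P.cuff k).elt γ.elt) : P.foot k γ = ∅ := by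
  rw [Set.eq_empty_iff_forall_notMem]
  intro s hs
  obtain ⟨g, hg, -⟩ := mem_foot.1 hs
  exact h (isConj_iff.2 ⟨g, hg⟩)

/-- All feet on a closed geodesic arise from one by rotation. -/
lemma count_foot {P : Pants Γ} {k : Fin 3} {γ : ClosedGeodesic Γ}
    (h : IsConj (P.cuff k).elt γ.elt) :
    Measure.count (P.foot k γ) = Measure.count γ.rotations := by
  obtain ⟨g, hg⟩ := isConj_iff.1 h
  obtain ⟨-, u, hu⟩ := ClosedGeodesic.conj_eq (P.cuff k) γ (h := (g : Mob))
    (congrArg Subtype.val hg)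
  -- Two elements that conjugate the cuff to γ differ by one that commutes with γ. The set of feet
  -- is therefore the set of rotations, translated by the position of the foot carried over by `g`.
  rw [← Measure.count_injective_image
    (add_right_injective ((u + P.footParam k : ℝ) : AddCircle γ.hl)) γ.rotations]
  congr 1
  ext s
  rw [mem_foot, Set.mem_image]
  constructor
  · rintro ⟨h, hh, b, hb, rfl⟩
    have hz : h * g⁻¹ * γ.elt * (h * g⁻¹)⁻¹ = γ.elt := by
      have e1 : h * g⁻¹ * (g * (P.cuff k).elt * g⁻¹) * (h * g⁻¹)⁻¹ =
          h * (P.cuff k).elt * h⁻¹ := by group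
      rwa [hg, hh] at e1
    obtain ⟨-, t, ht⟩ := γ.conj_eq γ (h := ((h * g⁻¹ : Γ) : Mob)) (congrArg Subtype.val hz)
    refine ⟨t, ⟨_, hz, t, ht, rfl⟩, ?_⟩
    have e1 : (h : Mob) * (P.cuff k).axis = γ.axis * trans t * trans u := by
      rw [← ht, mul_assoc, ← hu]
      push_cast
      group
    rw [← geodesic_mul, e1, geodesic_mul_trans, geodesic_mul_trans] at hb
    rw [← geodesic_injective _ hb, ← AddCircle.coe_add]
    congr 1; ring
  · rintro ⟨_, ⟨z, hz, t, ht, rfl⟩, rfl⟩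
    refine ⟨z * g, ?_, u + P.footParam k + t, ?_, by rw [← AddCircle.coe_add]⟩
    · rw [← hz, ← hg]
      group
    · rw [Subgroup.coe_mul, ← geodesic_mul, mul_assoc, hu, ← mul_assoc, ht, geodesic_mul_trans,
        geodesic_mul_trans]
      congr 1; ring

end Pants

/-! ## Gluing instructions with small twists -/

open Gluing

/-- The cuff `e'`, moved by `h`, is the cuff `e` with the opposite orientation, and the feet on the
two sides are at signed distance almost `1`. -/
def IsMatch (μ : ι → Pants Γ) (δ : ℝ) (e e' : ι × Fin 3) (h : Γ) : Prop :=
  h * (cuffAt μ e').elt * h⁻¹ = (cuffAt μ e).elt⁻¹ ∧ ∃ (b : ℝ) (n : ℤ),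
    (h : Mob) • geodesic (cuffAt μ e').axis ((μ e'.1).footParam e'.2) =
      geodesic (cuffAt μ e).axis b ∧
    |b - (μ e.1).footParam e.2 - 1 - n * (cuffAt μ e).hl| < δ

/-- The transition between the two parametrizations is x ↦ t - x. The twist is t minus both foot
parameters, which is symmetric in the two cuffs; hence it does not depend on the orientation. -/
lemma IsMatch.symm {δ : ℝ} {e e' : ι × Fin 3} {h : Γ} (H : IsMatch μ δ e e' h) :
    IsMatch μ δ e' e h⁻¹ := by
  obtain ⟨hc, b, n, hb, hlt⟩ := H
  have hc' : h⁻¹ * (cuffAt μ e).elt * h⁻¹⁻¹ = (cuffAt μ e').elt⁻¹ := by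
    rw [← inv_inv (cuffAt μ e).elt, ← hc]
    group
  obtain ⟨hl, t, ht⟩ := ClosedGeodesic.conj_eq_inv (cuffAt μ e') (cuffAt μ e) (h := (h : Mob))
    (by exact_mod_cast congrArg Subtype.val hc)
  have hb' : t - (μ e'.1).footParam e'.2 = b := by
    rw [← geodesic_mul, ht, geodesic_mul_swap, geodesic_mul_trans] at hb
    rw [← geodesic_injective _ hb]; ring
  refine ⟨hc', t - (μ e.1).footParam e.2, n, ?_, ?_⟩
  · rw [Subgroup.coe_inv, inv_smul_eq_iff, ← geodesic_mul, ht, geodesic_mul_swap,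
      geodesic_mul_trans]
    congr 1; ring
  · rw [ClosedGeodesic.hl, hl]
    rw [← hb', ClosedGeodesic.hl] at hlt
    convert hlt using 2
    ring

/-- Moving `e` to γ by `p` and `e'` to the reversed γ by `q`, the element p⁻¹q matches the cuffs. A
parameter on the reversed geodesic changes sign on γ, so the signed length between the feet is -t -
s. -/
lemma isMatch_of_mem_foot {γ : ClosedGeodesic Γ} {e e' : ι × Fin 3} {s t : AddCircle γ.hl}
    (hs : s ∈ (μ e.1).foot e.2 γ) (ht : t ∈ (μ e'.1).foot e'.2 γ.reverse) {δ : ℝ}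
    (hst : ‖-t - s - ((1 : ℝ) : AddCircle γ.hl)‖ < δ) : ∃ h, IsMatch μ δ e e' h := by
  obtain ⟨p, hp, a, ha, rfl⟩ := Pants.mem_foot.1 hs
  obtain ⟨q, hq, b, hb, rfl⟩ := Pants.mem_foot.1 ht
  have hq' : q * (cuffAt μ e').elt * q⁻¹ = γ.elt⁻¹ := hq
  have hb' : (q : Mob) • geodesic (cuffAt μ e').axis ((μ e'.1).footParam e'.2) =
      geodesic γ.axis (-b) := by
    rw [hb]; exact geodesic_mul_swap _ _
  obtain ⟨hlen, u, hu⟩ := ClosedGeodesic.conj_eq (cuffAt μ e) γ (h := (p : Mob))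
    (congrArg Subtype.val hp)
  have ha' : (μ e.1).footParam e.2 = a - u := by
    rw [← geodesic_mul, hu, geodesic_mul_trans] at ha
    rw [← geodesic_injective _ ha]; ring
  refine ⟨p⁻¹ * q, ?_, -b - u, round (γ.hl⁻¹ * (-b - a - 1)), ?_, ?_⟩
  · have e1 : p⁻¹ * q * (cuffAt μ e').elt * (p⁻¹ * q)⁻¹ =
        p⁻¹ * (q * (cuffAt μ e').elt * q⁻¹) * p := by group
    rw [e1, hq', ← hp]
    group
  · rw [Subgroup.coe_mul, mul_smul, hb', Subgroup.coe_inv, inv_smul_eq_iff, ← geodesic_mul, hu,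
      geodesic_mul_trans]
    congr 1; ring
  · have hst' : ‖((-b - a - 1 : ℝ) : AddCircle γ.hl)‖ < δ := hst
    rw [AddCircle.norm_eq] at hst'
    have hl : (cuffAt μ e).hl = γ.hl := by rw [ClosedGeodesic.hl, hlen]; rfl
    rw [hl, ha']
    convert hst' using 2
    ring

/-- The cuffs in opposite classes can be matched up. -/
lemma exists_injective_isMatch [Fintype ι] {ε R : ℝ} (hμ : ∀ i, (μ i).IsGood ε R)
    (heven : multiBoundary μ = 0)
    (hequi : ∀ γ : ClosedGeodesic Γ, γ.IsGood ε R → EquidistributedOn (ε / (2 * R)) μ γ)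
    (c : ConjClasses Γ) :
    ∃ φ : {e : ι × Fin 3 // ConjClasses.mk (cuffAt μ e).elt = c} →
        {e : ι × Fin 3 // ConjClasses.mk (cuffAt μ e).elt = classInv c},
      Function.Injective φ ∧ ∀ e, ∃ h, IsMatch μ (ε / R) e.1 (φ e).1 h := by
  classical
  by_cases hc : ∃ e : ι × Fin 3, ConjClasses.mk (cuffAt μ e).elt = c
  swap
  · exact ⟨fun e => absurd ⟨e.1, e.2⟩ hc, fun e => absurd ⟨e.1, e.2⟩ hc,
      fun e => absurd ⟨e.1, e.2⟩ hc⟩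
  obtain ⟨e₀, rfl⟩ := hc
  set γ := cuffAt μ e₀ with hγ
  set c := ConjClasses.mk γ.elt with hcdef
  have hγg : γ.IsGood ε R := hμ e₀.1 e₀.2
  obtain ⟨K, hK⟩ := hequi γ hγg
  obtain ⟨K', hK'⟩ := hequi γ.reverse hγg
  have hsum : ∀ γ : ClosedGeodesic Γ, footMeasure μ γ =
      ∑ e : ι × Fin 3, Measure.count.restrict ((μ e.1).foot e.2 γ) := fun γ => by
    rw [footMeasure, Fintype.sum_prod_type]
  rw [hsum] at hK hK'
  have hiff : ∀ (e : ι × Fin 3) (g : Γ), ConjClasses.mk (cuffAt μ e).elt = ConjClasses.mk g ↔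
      IsConj (cuffAt μ e).elt g := fun e g => ConjClasses.mk_eq_mk_iff_isConj
  -- The foot of `e₀` is part of the foot measure, whose total mass is that of a multiple of
  -- Lebesgue measure on the circle.
  have hNt : Measure.count γ.rotations ≠ ⊤ := by
    rw [← Pants.count_foot (P := μ e₀.1) (k := e₀.2) (IsConj.refl _)]
    refine ne_top_of_le_ne_top (b := (K • (volume : Measure (AddCircle γ.hl))) univ) ?_ ?_
    · rw [Measure.smul_apply, AddCircle.measure_univ]
      exact ENNReal.mul_ne_top ENNReal.coe_ne_top ENNReal.ofReal_ne_top
    · rw [← hK.1, Measure.coe_finsetSum, Finset.sum_apply]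
      refine le_trans ?_ (Finset.single_le_sum (f := fun e : ι × Fin 3 =>
        (Measure.count.restrict ((μ e.1).foot e.2 γ)) univ) (fun _ _ => zero_le)
        (Finset.mem_univ e₀))
      rw [Measure.restrict_apply_univ]
  have hF : ∀ (c : ConjClasses Γ) (e : ι × Fin 3), e ∈ Finset.univ.filter
      (fun e => ConjClasses.mk (cuffAt μ e).elt = c) ↔ ConjClasses.mk (cuffAt μ e).elt = c :=
    fun c e => by rw [Finset.mem_filter, and_iff_right (Finset.mem_univ e)]
  set f : ι × Fin 3 → Set (AddCircle γ.hl) := fun e => (μ e.1).foot e.2 γ with hf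
  set g : ι × Fin 3 → Set (AddCircle γ.hl) := fun e => (μ e.1).foot e.2 γ.reverse with hg
  -- Reversal keeps the length, so both foot measures live on definitionally the same circle.
  have hK₁ : MeasureEquivalent (ε / (2 * R)) (∑ e, Measure.count.restrict (g e))
    (K' • (volume : Measure (AddCircle γ.hl))) := hK'
  have hf0 : ∀ e ∉ Finset.univ.filter (fun e => ConjClasses.mk (cuffAt μ e).elt = c), f e = ∅ :=
    fun e he => Pants.foot_eq_empty fun h => he ((hF _ _).2 ((hiff e _).2 h))
  have hg0 : ∀ e ∉ Finset.univ.filter (fun e => ConjClasses.mk (cuffAt μ e).elt = classInv c),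
      g e = ∅ :=
    fun e he => Pants.foot_eq_empty fun h => he ((hF _ _).2 ((hiff e γ.elt⁻¹).2 h))
  have hfN : ∀ e ∈ Finset.univ.filter (fun e => ConjClasses.mk (cuffAt μ e).elt = c),
      Measure.count (f e) = Measure.count γ.rotations :=
    fun e he => Pants.count_foot ((hiff e _).1 ((hF _ _).1 he))
  have hgN : ∀ e ∈ Finset.univ.filter (fun e => ConjClasses.mk (cuffAt μ e).elt = classInv c),
      Measure.count (g e) = Measure.count γ.rotations :=
    fun e he => (Pants.count_foot (γ := γ.reverse) ((hiff e γ.elt⁻¹).1 ((hF _ _).1 he))).trans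
      γ.count_rotations_reverse
  obtain ⟨φ, hφ, hφm⟩ := exists_injective_matching
    (Measure.count_ne_zero ⟨_, γ.zero_mem_rotations⟩) hNt hf0 hg0 hfN hgN
    (card_class_eq heven c) hK hK₁
  refine ⟨fun e => ⟨φ ⟨e.1, (hF _ _).2 e.2⟩, (hF _ _).1 (φ ⟨e.1, (hF _ _).2 e.2⟩).2⟩,
    fun a b h => ?_, fun e => ?_⟩
  · have := hφ (Subtype.ext (Subtype.mk.inj h))
    exact Subtype.ext (Subtype.mk.inj this)
  · obtain ⟨s, hs, t, ht, hst⟩ := hφm ⟨e.1, (hF _ _).2 e.2⟩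
    -- Twice the equidistribution scale ε/(2R) is ε/R.
    refine isMatch_of_mem_foot hs ht (hst.trans_eq ?_)
    ring

/-- The cuffs can be matched up in pairs. -/
lemma exists_gluing [Fintype ι] (hΓ : IsClosedSurfaceGroup Γ) {ε R : ℝ}
    (hμ : ∀ i, (μ i).IsGood ε R) (heven : multiBoundary μ = 0)
    (hequi : ∀ γ : ClosedGeodesic Γ, γ.IsGood ε R → EquidistributedOn (ε / (2 * R)) μ γ) :
    ∃ G : Gluing μ, ∀ e, IsMatch μ (ε / R) e (G.partner e) (G.map e) := by
  choose φ hφ hm using exists_injective_isMatch hμ heven hequi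
  set cl : ι × Fin 3 → ConjClasses Γ := fun e => ConjClasses.mk (cuffAt μ e).elt with hcl
  -- The class of the image determines the class of the cuff, so the injections on the classes
  -- combine to an injection of the finite set of all cuffs into itself, which is a bijection.
  have hinj : Function.Injective fun e => (φ (cl e) ⟨e, rfl⟩).1 := by
    intro a b hab
    have h1 : cl a = cl b := by
      have h2 := congrArg cl hab
      rw [← classInv_classInv (cl a), ← classInv_classInv (cl b)]
      exact congrArg classInv ((φ (cl a) ⟨a, rfl⟩).2.symm.trans (h2.trans (φ (cl b) ⟨b, rfl⟩).2))
    have h3 : ∀ c (h : cl b = c), (φ (cl b) ⟨b, rfl⟩).1 = (φ c ⟨b, h⟩).1 := by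
      rintro _ rfl; rfl
    simp only [h3 _ h1.symm] at hab
    exact congrArg Subtype.val (hφ _ (Subtype.ext hab))
  have hne : ∀ e, classInv (cl e) ≠ cl e := fun e h => by
    obtain ⟨g, hg⟩ := isConj_iff.1 (ConjClasses.mk_eq_mk_iff_isConj.1 h.symm)
    exact ClosedGeodesic.not_conj_inv hΓ _ _ hg
  obtain ⟨τ, m, h1, h2, h3⟩ := exists_involution cl classInv_classInv hne
    (W := IsMatch μ (ε / R)) (fun _ _ _ h => h.symm) (Finite.injective_iff_bijective.1 hinj)
    (fun e => (φ (cl e) ⟨e, rfl⟩).2) (fun e => hm _ ⟨e, rfl⟩)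
  exact ⟨⟨τ, m, h1, h2, fun e => (h3 e).1⟩, h3⟩

end

end GoodPants

open GoodPants in
/-- If the pants of a good multi-pants `μ` are evenly distributed and equidistributed, then they can
be glued to a finite cover with a good pants decomposition: the pieces `P j a` of the cover are
indexed by the index set of `μ`, split up according to the component on which they
lie, and the piece with index `i` maps to the pair of pants `μ i`. -/
theorem lemma2p1 (Γ : Subgroup Mob) (hΓ : IsClosedSurfaceGroup Γ) (ε R : ℝ) (hε : 0 < ε)
    (hR : 0 < R) {ι : Type*} [Fintype ι] (μ : ι → Pants Γ) (hμ : ∀ i, (μ i).IsGood ε R)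
    (heven : multiBoundary μ = 0)
    (hequi : ∀ γ : ClosedGeodesic Γ, γ.IsGood ε R → EquidistributedOn (ε / (2 * R)) μ γ) :
    ∃ (M₀ : FiniteCover Γ) (component : ι → Fin M₀.numComponents)
      (P : ∀ j, {i // component i = j} → Pants (M₀.group j)),
      (∀ j, IsGoodPantsDecomposition ε R (M₀.group j) (P j)) ∧
      ∀ j (a : {i // component i = j}), ((P j a).push (M₀.le j)).Same (μ a) := by
  obtain ⟨G, hG⟩ := exists_gluing hΓ hμ heven hequi
  refine ⟨G.cover hΓ, G.comp, G.piece, fun j => ?_, fun j a => Pants.conj_push_same _ _ _ _⟩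
  exact
    { G.isPantsDecomposition j with
      good := fun i k => hμ i.1 k
      twist_close := G.twist_piece (fun e => (hG e).2) j }
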